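/- Let $K$ be a field of characteristic zero and $n\ge 0$. **Cyclic braces trees.** A cyclic braces tree with $n$ external vertices is a planar rooted tree with $n$ external vertices, labelled bijectively by $1,\dots,n$, and finitely many unlabelled internal vertices, each of valence at least $3$ (the root edge is counted in the valence of the root vertex), such that each external vertex carries exactly one of the following decorations: a mark on one of its incident edges (the root edge included), or an additional edge connecting it to a symbol $\mathbb 1$, placed in one of the corners (spaces between cyclically consecutive incident edges). Internal vertices carry no decoration. A *braces tree* is a cyclic braces tree in which every external vertex is marked in the direction of the root. Two trees have the same shape if they agree after forgetting marks and edges to $\mathbb 1$. **The complexes.** $\mathsf{CBr}(n)$ is the graded $K$-vector space spanned by cyclic braces trees together with an order of their non-root edges (edges to $\mathbb 1$ included), where a permutation of the edges acts by its sign. Non-root edges and edges to $\mathbb 1$ have degree $-1$, internal vertices degree $2$, external vertices degree $0$. The differential $d$ has degree $+1$ and is the sum, over all vertices, of all planar ways to split an internal vertex out of that vertex; the new edge is put first in the order of edges. In detail: * an internal vertex is split into two internal vertices, both at least trivalent; * an external vertex $v$ is split into $v$ and an internal vertex, joined by the new edge, where the internal vertex takes over a set $S$ of at least two cyclically consecutive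 edges of $v$ (the root-direction edge may belong to $S$; if $S$ consists of all edges of $v$, the splitting includes the choice of the corner of $v$ at which $S$ is cut open). A mark of $v$ on an edge of $S$ becomes a mark on the new edge; any other mark stays. An edge from $v$ to $\mathbb 1$ stays at $v$ if its corner is not strictly inside $S$, and the term is zero if it is; * if $v$ has an edge to $\mathbb 1$ in the corner between the consecutive edges $e$ and $e'$ (in this order; $e=e'$ if $v$ is univalent), there is one further contribution: (the tree with this edge to $\mathbb 1$ replaced by a mark on $e'$) minus (the tree with it replaced by a mark on $e$), where the edge to $\mathbb 1$ is first moved to the first place in the order of the edges and then deleted. (This is the splitting in which an internal vertex takes the edge to $\mathbb 1$ and one other edge, a trivalent internal vertex with an edge to $\mathbb 1$ being identified with a plain edge.) $\mathsf{Br}(n)\subset\mathsf{CBr}(n)$ is the subcomplex spanned by the braces trees. Let $K\oplus K[1]$ have zero differential, with $(1,0)$ in degree $0$ and $(0,1)$ in degree $-1$, and give $\mathsf{Br}(n)\otimes(K\oplus K[1])^{\otimes n}$ the differential $d\otimes\mathrm{id}$. **The map.** Let $f:\mathsf{Br}(n)\otimes(K\oplus K[1])^{\otimes n}\to\mathsf{CBr}(n)$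 be the linear map that sends $T\otimes\epsilon_1\otimes\dots\otimes\epsilon_n$, where $T$ is a braces tree and each $\epsilon_i\in\{(1,0),(0,1)\}$, to the following sum of cyclic braces trees of the same shape as $T$: if $\epsilon_i=(1,0)$, the vertex labelled $i$ keeps its mark in the direction of the root; if $\epsilon_i=(0,1)$, the vertex labelled $i$ is replaced by the sum over all ways of inserting an edge to $\mathbb 1$ in one of its corners. The new edges to $\mathbb 1$ are placed behind the edges of $T$, in increasing order of their labels $i$. **Claim.** $\mathsf{CBr}(n)$ and $\mathsf{Br}(n)\otimes(K\oplus K[1])^{\otimes n}$ are complexes (the differentials have degree $1$ and square to zero), $f$ is a morphism of complexes of degree $0$, and $f$ is a quasi-isomorphism. -/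

import Mathlib

open CategoryTheory
open scoped TensorProduct

namespace CyclicBraces

/-! ## Decorated planar rooted trees

The operad of cyclic braces is a quotient of the twisted operad of cyclic planar trees. In the
quotient, a tree is zero if an external vertex is connected to `𝟙` but its mark points elsewhere,
the marks of the internal vertices are irrelevant, a trivalent internal vertex with an edge to `𝟙`
equals a plain edge, and an internal vertex with an edge to `𝟙` and any other valence is zero.
Therefore it has a basis of trees whose external vertices carry either a mark at an edge or one
(marked) edge to `𝟙`, and whose internal vertices are undecorated and at least trivalent.

The edges incident to a vertex with `k` children are numbered `0, 1, …, k` in the planar cyclic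
order: edge `0` goes towards the root, edge `j` (for `1 ≤ j ≤ k`) goes to the `j`-th child.
Corner `j` (for `0 ≤ j ≤ k`) is the space between edge `j` and the cyclically next edge. -/

/-- The decoration of an external vertex: a mark on one of the incident edges, or an additional
(automatically marked) edge that connects the vertex to the symbol `𝟙` and sits in a corner. -/
inductive Mark : Type
  | edge (j : ℕ) : Mark
  | unit (j : ℕ) : Mark

/-- `1` if the vertex is connected to `𝟙`, and `0` otherwise. -/
def Mark.ones : Mark → ℕ
  | .edge _ => 0
  | .unit _ => 1

/-- The position of the mark makes sense at a vertex with `k` children. -/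
def Mark.InRange (k : ℕ) : Mark → Prop
  | .edge j => j ≤ k
  | .unit j => j ≤ k

/-- Planar rooted trees. An external vertex carries a label and a decoration; an internal vertex
carries neither. The children of a vertex are listed in planar order. -/
inductive PlanarTree (n : ℕ) : Type
  | ext (i : Fin n) (m : Mark) (cs : List (PlanarTree n)) : PlanarTree n
  | int (cs : List (PlanarTree n)) : PlanarTree n

variable {n : ℕ}

mutual
/-- The list of the labels of all external vertices. -/
def labels : PlanarTree n → List (Fin n)
  | .ext i _ cs => i :: labelsList cs
  | .int cs => labelsList cs
/-- `labels` for a forest. -/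
def labelsList : List (PlanarTree n) → List (Fin n)
  | [] => []
  | c :: cs => labels c ++ labelsList cs
end

mutual
/-- All marks are placed at existing edges or corners, and all internal vertices are at least
trivalent (that is, have at least two children). -/
def WellFormed : PlanarTree n → Prop
  | .ext _ m cs => m.InRange cs.length ∧ WellFormedList cs
  | .int cs => 2 ≤ cs.length ∧ WellFormedList cs
/-- `WellFormed` for a forest. -/
def WellFormedList : List (PlanarTree n) → Prop
  | [] => True
  | c :: cs => WellFormed c ∧ WellFormedList cs
end

mutual
/-- All external vertices are marked in the direction of the root. -/
def RootMarked : PlanarTree n → Prop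
  | .ext _ m cs => m = .edge 0 ∧ RootMarkedList cs
  | .int cs => RootMarkedList cs
/-- `RootMarked` for a forest. -/
def RootMarkedList : List (PlanarTree n) → Prop
  | [] => True
  | c :: cs => RootMarked c ∧ RootMarkedList cs
end

/-- Cyclic braces trees with external vertices `1, …, n`: every label occurs exactly once. -/
def IsCyclicBracesTree (t : PlanarTree n) : Prop :=
  WellFormed t ∧ ∀ i : Fin n, (labels t).count i = 1

/-- Braces trees: cyclic braces trees whose marks all point towards the root. -/
def IsBracesTree (t : PlanarTree n) : Prop :=
  IsCyclicBracesTree t ∧ RootMarked t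

mutual
/-- The number of edges of a tree, including the ones that connect to `𝟙`, but not the root edge.
These are the elements of degree `-1`. -/
def numEdges : PlanarTree n → ℕ
  | .ext _ m cs => m.ones + numEdgesList cs
  | .int cs => numEdgesList cs
/-- The number of edges of a forest that is grafted to a vertex (so that each tree of the forest
also contributes the edge by which it is grafted). -/
def numEdgesList : List (PlanarTree n) → ℕ
  | [] => 0
  | c :: cs => (1 + numEdges c) + numEdgesList cs
end

mutual
/-- The number of internal vertices. -/
def numInt : PlanarTree n → ℕ
  | .ext _ _ cs => numIntList cs
  | .int cs => 1 + numIntList cs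
/-- `numInt` for a forest. -/
def numIntList : List (PlanarTree n) → ℕ
  | [] => 0
  | c :: cs => numInt c + numIntList cs
end

/-- The (cohomological) degree: edges have degree `-1`, internal vertices have degree `2`. -/
def degree (t : PlanarTree n) : ℤ := 2 * (numInt t : ℤ) - (numEdges t : ℤ)

/-! ## The differential

As edges are odd, a generator is a tree together with an order of its edges, and a permutation of
the edges acts by its sign. A planar rooted tree has no automorphisms and its edges have a canonical
order, so the canonically ordered trees form a basis. The canonical order is the depth-first one:
first the edge from the root vertex to `𝟙`, if there is one; then, for each child in planar order,
the edge to that child followed by the edges of the subtree at that child.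

The differential is the sum of all ways of splitting an internal vertex out of a vertex, where the
newly created edge is put in front of all other edges; the signs below come from bringing the edges
back to the canonical order. -/

/-- The sign `(-1) ^ k`. -/
def sgn (k : ℕ) : ℤ := (-1) ^ k

/-- The intervals `(a, l)` of a list of length `k`: `l` consecutive entries after the first `a`. -/
def intervals (k : ℕ) : List (ℕ × ℕ) :=
  (List.range (k + 1)).flatMap fun a => (List.range (k + 1 - a)).map fun l => (a, l)

/-- The new mark at an external vertex after the edges `a + 1, …, a + l` have been moved to a new
internal vertex, which is connected to the external vertex by the new edge `a + 1`. If one of these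
edges is marked, then the mark goes to the new edge. If there is an edge to `𝟙` strictly between two
of them, it would be moved to the internal vertex, and the result is zero. -/
def Mark.splitBelow (a l : ℕ) : Mark → Option Mark
  | .edge j =>
      if j ≤ a then some (.edge j)
      else if j ≤ a + l then some (.edge (a + 1))
      else some (.edge (j + 1 - l))
  | .unit j =>
      if j ≤ a then some (.unit j)
      else if j < a + l then none
      else some (.unit (j + 1 - l))

/-- The new mark at an external vertex after all edges but `a + 1, …, a + l`, in particular the edge
towards the root, have been moved to a new internal vertex above it. If one of the moved edges is
marked, then the mark goes to the new edge, which is edge `0`. If there is an edge to `𝟙` strictly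
between two of the moved edges, it would be moved to the internal vertex, and the result is zero. -/
def Mark.splitAbove (a l : ℕ) : Mark → Option Mark
  | .edge j => if a < j ∧ j ≤ a + l then some (.edge (j - a)) else some (.edge 0)
  | .unit j => if a ≤ j ∧ j ≤ a + l then some (.unit (j - a)) else none

/-- Splitting an internal vertex into two internal vertices (each at least trivalent). -/
def splitInt (cs : List (PlanarTree n)) : List (ℤ × PlanarTree n) :=
  ((intervals cs.length).filter fun p => 2 ≤ p.2 ∧ p.2 < cs.length).map fun (a, l) =>
    (sgn (numEdgesList (cs.take a)),
      .int (cs.take a ++ .int ((cs.drop a).take l) :: cs.drop (a + l)))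

/-- Splitting an (at least trivalent) internal vertex out of an external vertex, such that the
external vertex is closer to the root. -/
def splitExtBelow (i : Fin n) (m : Mark) (cs : List (PlanarTree n)) : List (ℤ × PlanarTree n) :=
  ((intervals cs.length).filter fun p => 2 ≤ p.2).flatMap fun (a, l) =>
    ((m.splitBelow a l).toList).map fun m' =>
      (sgn (m.ones + numEdgesList (cs.take a)),
        .ext i m' (cs.take a ++ .int ((cs.drop a).take l) :: cs.drop (a + l)))

/-- Splitting an (at least trivalent) internal vertex out of an external vertex, such that the
internal vertex is closer to the root. -/
def splitExtAbove (i : Fin n) (m : Mark) (cs : List (PlanarTree n)) : List (ℤ × PlanarTree n) :=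
  ((intervals cs.length).filter fun p => p.2 < cs.length).flatMap fun (a, l) =>
    ((m.splitAbove a l).toList).map fun m' =>
      (sgn ((1 + m.ones) * numEdgesList (cs.take a)),
        .int (cs.take a ++ .ext i m' ((cs.drop a).take l) :: cs.drop (a + l)))

/-- Splitting off an internal vertex that takes over the edge to `𝟙` and exactly one further edge,
where a trivalent internal vertex connected to `𝟙` is identified with a plain edge: the edge to `𝟙`
in a corner is replaced by the mark on the following edge minus the mark on the preceding edge. -/
def turnMark (i : Fin n) (m : Mark) (cs : List (PlanarTree n)) : List (ℤ × PlanarTree n) :=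
  match m with
  | .edge _ => []
  | .unit j =>
      [(1, .ext i (.edge (if j = cs.length then 0 else j + 1)) cs), (-1, .ext i (.edge j) cs)]

mutual
/-- The signed list of the terms of the differential of a tree. -/
def dTerms : PlanarTree n → List (ℤ × PlanarTree n)
  | .ext i m cs =>
      turnMark i m cs ++ splitExtBelow i m cs ++ splitExtAbove i m cs ++
        (dTermsList cs).map fun p => (sgn m.ones * p.1, .ext i m p.2)
  | .int cs => splitInt cs ++ (dTermsList cs).map fun p => (p.1, .int p.2)
/-- `dTerms` for a forest that is grafted to a vertex. -/
def dTermsList : List (PlanarTree n) → List (ℤ × List (PlanarTree n))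
  | [] => []
  | c :: cs =>
      (dTerms c).map (fun p => (-p.1, p.2 :: cs)) ++
        (dTermsList cs).map fun p => (sgn (1 + numEdges c) * p.1, c :: p.2)
end

/-! ## The map on trees -/

mutual
/-- All trees that arise from `t` by placing an edge to `𝟙` in some corner at each external vertex
whose label is in `A`, and marking all other external vertices in the direction of the root. -/
def insertUnits (A : Finset (Fin n)) : PlanarTree n → List (PlanarTree n)
  | .ext i _ cs =>
      (insertUnitsList A cs).flatMap fun cs' =>
        if i ∈ A then (List.range (cs.length + 1)).map fun j => .ext i (.unit j) cs'
        else [.ext i (.edge 0) cs']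
  | .int cs => (insertUnitsList A cs).map .int
/-- `insertUnits` for a forest. -/
def insertUnitsList (A : Finset (Fin n)) : List (PlanarTree n) → List (List (PlanarTree n))
  | [] => [[]]
  | c :: cs => (insertUnits A c).flatMap fun c' => (insertUnitsList A cs).map fun cs' => c' :: cs'
end

mutual
/-- The canonically ordered list of the edges of a tree: `⊥` stands for an edge between two
vertices, and `i` for the edge from the external vertex `i` to `𝟙`. -/
def edgeWord : PlanarTree n → List (WithBot (Fin n))
  | .ext i m cs =>
      (match m with
        | .edge _ => []
        | .unit _ => [(i : WithBot (Fin n))]) ++ edgeWordList cs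
  | .int cs => edgeWordList cs
/-- `edgeWord` for a forest that is grafted to a vertex. -/
def edgeWordList : List (PlanarTree n) → List (WithBot (Fin n))
  | [] => []
  | c :: cs => ⊥ :: (edgeWord c ++ edgeWordList cs)
end

/-- The number of inversions of a word. -/
def inversions : List (WithBot (Fin n)) → ℕ
  | [] => 0
  | x :: xs => xs.countP (fun y => y < x) + inversions xs

/-- The sign of the permutation between the canonical order of the edges of a tree, and the order in
which the edges between vertices (in canonical order) come first and are followed by the edges to
`𝟙` in the order of the labels of their vertices. -/
def unitSign (t : PlanarTree n) : ℤ := sgn (inversions (edgeWord t))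

/-! ## The complexes -/

noncomputable section

variable (K : Type*) [Field K] (n : ℕ)

/-- The formal linear combination with the given list of terms. -/
def ofTerms {n : ℕ} (L : List (ℤ × PlanarTree n)) : PlanarTree n →₀ K :=
  (L.map fun p => Finsupp.single p.2 (p.1 : K)).sum

/-- The differential on linear combinations of trees. -/
def dTree : (PlanarTree n →₀ K) →ₗ[K] (PlanarTree n →₀ K) :=
  Finsupp.linearCombination K fun t => ofTerms K (dTerms t)

/-- The part of degree `p` of `CBr(n)`: the span of the cyclic braces trees of degree `p`. -/
def CBr (p : ℤ) : Submodule K (PlanarTree n →₀ K) :=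
  Finsupp.supported K K {t | IsCyclicBracesTree t ∧ degree t = p}

/-- The part of degree `p` of `Br(n)`: the span of the braces trees of degree `p`. -/
def Br (p : ℤ) : Submodule K (PlanarTree n →₀ K) :=
  Finsupp.supported K K {t | IsBracesTree t ∧ degree t = p}

/-- The vector space `(K ⊕ K[1])^{⊗ n}`. It has zero differential. -/
abbrev Circles := ⨂[K] _ : Fin n, (K × K)

/-- The tensor `ε_1 ⊗ ⋯ ⊗ ε_n` with `ε_i = (0, 1)` for `i ∈ A` and `ε_i = (1, 0)` for `i ∉ A`. -/
def circleTensor {n : ℕ} (A : Finset (Fin n)) : Circles K n :=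
  PiTensorProduct.tprod K fun i => if i ∈ A then ((0, 1) : K × K) else (1, 0)

/-- The part of degree `p` of `(K ⊕ K[1])^{⊗ n}`, where `K[1]` is concentrated in degree `-1`. -/
def circleGrading (p : ℤ) : Submodule K (Circles K n) :=
  Submodule.span K {x | ∃ A : Finset (Fin n), -(A.card : ℤ) = p ∧ x = circleTensor K A}

/-- The part of degree `p` of `Br(n) ⊗ (K ⊕ K[1])^{⊗ n}`. -/
def BrCircles (p : ℤ) : Submodule K ((PlanarTree n →₀ K) ⊗[K] Circles K n) :=
  ⨆ (q : ℤ) (r : ℤ) (_ : q + r = p),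
    Submodule.map₂ (TensorProduct.mk K (PlanarTree n →₀ K) (Circles K n))
      (Br K n q) (circleGrading K n r)

/-- The differential `d ⊗ id` of `Br(n) ⊗ (K ⊕ K[1])^{⊗ n}`. -/
def dBrCircles :
    (PlanarTree n →₀ K) ⊗[K] Circles K n →ₗ[K] (PlanarTree n →₀ K) ⊗[K] Circles K n :=
  (dTree K n).rTensor (Circles K n)

/-- The map `T ↦ f (T ⊗ ε)`, for `ε` with `ε_i = (0, 1)` if `i ∈ A` and `ε_i = (1, 0)` if `i ∉ A`:
the edges to `𝟙` come after the edges of `T`, in the order of the tensor factors. -/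
def fComponent {n : ℕ} (A : Finset (Fin n)) : (PlanarTree n →₀ K) →ₗ[K] (PlanarTree n →₀ K) :=
  Finsupp.linearCombination K fun t =>
    ofTerms K ((insertUnits A t).map fun t' => (unitSign t', t'))

/-- The linear form on `(K ⊕ K[1])^{⊗ n}` dual to `circleTensor K A`; it takes the product of the
second coordinates of the factors in `A` and of the first coordinates of the others. -/
def circleCoord {n : ℕ} (A : Finset (Fin n)) : Circles K n →ₗ[K] K :=
  PiTensorProduct.lift ((MultilinearMap.mkPiAlgebra K (Fin n) K).compLinearMap
    fun i => if i ∈ A then LinearMap.snd K K K else LinearMap.fst K K K)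

/-- The map `f : Br(n) ⊗ (K ⊕ K[1])^{⊗ n} → CBr(n)`. -/
def f : (PlanarTree n →₀ K) ⊗[K] Circles K n →ₗ[K] (PlanarTree n →₀ K) :=
  ∑ A : Finset (Fin n),
    (TensorProduct.rid K (PlanarTree n →₀ K)).toLinearMap ∘ₗ
      TensorProduct.map (fComponent K A) (circleCoord K A)

end

/-! ## Cochain complexes from internally graded modules -/

section Cochain

universe u

variable {K : Type u} [Field K] {M N : Type u} [AddCommGroup M] [Module K M] [AddCommGroup N]
  [Module K N]

/-- `d` restricts to a differential (of degree `1`) on the graded module with the parts `gr p`. -/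
structure IsDifferential (gr : ℤ → Submodule K M) (d : M →ₗ[K] M) : Prop where
  degree_one : ∀ p, ∀ x ∈ gr p, d x ∈ gr (p + 1)
  square_zero : ∀ p, ∀ x ∈ gr p, d (d x) = 0

/-- `f` restricts to a morphism of complexes. -/
structure IsCochainMap (gr : ℤ → Submodule K M) (d : M →ₗ[K] M) (gr' : ℤ → Submodule K N)
    (d' : N →ₗ[K] N) (f : M →ₗ[K] N) : Prop where
  degree_zero : ∀ p, ∀ x ∈ gr p, f x ∈ gr' p
  comm : ∀ p, ∀ x ∈ gr p, f (d x) = d' (f x)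

/-- The cochain complex with the graded parts `gr p` and the differential `d`. -/
noncomputable def cochainComplex (gr : ℤ → Submodule K M) (d : M →ₗ[K] M)
    (h : IsDifferential gr d) : CochainComplex (ModuleCat.{u} K) ℤ :=
  CochainComplex.of (fun p => ModuleCat.of K (gr p))
    (fun p => ModuleCat.ofHom (d.restrict (h.degree_one p)))
    (fun p => by
      ext x
      exact h.square_zero p x.1 x.2)

/-- The morphism of cochain complexes given by a linear map. -/
noncomputable def cochainMap {gr : ℤ → Submodule K M} {d : M →ₗ[K] M} {gr' : ℤ → Submodule K N}
    {d' : N →ₗ[K] N} {f : M →ₗ[K] N} (h : IsDifferential gr d) (h' : IsDifferential gr' d')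
    (hf : IsCochainMap gr d gr' d' f) : cochainComplex gr d h ⟶ cochainComplex gr' d' h' :=
  CochainComplex.ofHom
    (fun p => ModuleCat.ofHom (f.restrict (hf.degree_zero p)))
    (fun p => by
      simp only [cochainComplex, CochainComplex.of_d]
      ext x
      exact (hf.comm p x.1 x.2).symm)

end Cochain

end CyclicBraces

-- Write `F_S` (`subcomplex K S`) for the span of the trees whose external vertices with label
-- outside `S` are marked towards the root. Then `F_∅` is `Br(n)` and `F_univ` is `CBr(n)`, and the
-- proof adds one label `i` to `S` at a time.
--
-- At a vertex `i` with `k` children, the `k + 1` possible marks and the `k + 1` corners for the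
-- edge to `𝟙` are the 0-cells and the 1-cells of a circle, and the part of `d` that removes the
-- edge to `𝟙` is, up to a sign, the cellular boundary (`Vertex.dTerms_tree`). The homology of the
-- circle is spanned by the mark at edge `0`, which gives back `F_S`, and by the sum of all corners,
-- which gives the image of `F_S` under the operator `U_i` (`unitMap i`) that inserts an edge to `𝟙`
-- in all corners of `i`. So `(x, x') ↦ x + U_i x'` is a quasi-isomorphism from `F_S ⊕ F_S[1]` to
-- the subcomplex for `insert i S`. No spectral sequence is needed: `exists_of_add_unitMap_eq`
-- contracts the cone by explicit operators. The component of `f` at a set `A` is the composition of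
-- the `U_i` for `i ∈ A` in increasing order (`fComponent_insert`), because a new edge to `𝟙` with
-- the largest label is put last. Induction over the largest label then shows that the cone of `f`
-- is acyclic (`exists_of_sum_fComponent_eq`).
--
-- What remains, and takes most of the work, is `d² = 0` and `d U_i = U_i d`. The children of a
-- vertex form a word of odd or even letters, and operations from words to letters extend to
-- coderivations of words (`coder`). Grafting to an internal vertex together with `d` on single
-- trees gives operations `μ` (`muT`), those of a free A∞-algebra; `d² = 0` at internal vertices is
-- their A∞-relation. For external vertices, words may carry one decoration: a marked child, or a
-- letter `𝟙` that acts as a strict unit (`mu`). An external vertex is then an operation `ξ_i`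
-- (`xi`) from decorated words to letters, and the formula for `d` at an external vertex, including
-- the replacement of `𝟙` by a difference of marks, says exactly that `μ` and `ξ_i` anticommute
-- (`xi_relation`). This holds without knowing that `d² = 0`.
--
-- Hence `ξ_i` commutes with `μ²`. Suppose that `d²` vanishes on the trees of a word `w`. Then `μ²`
-- annihilates `w`, so it annihilates the sum of all words that arise by inserting the vertex `i`
-- into `w`. All of these but the single letter `ξ_i(w)` involve a vertex with a shorter word, so
-- that an induction over the length leaves `d² = 0` on `ξ_i(w)` (`annihilate_of_coder_xi`,
-- `squareZero_of_mem_xi`). The same argument, with `μ²` replaced by the anticommutator of `μ` and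
-- the insertion at `i`, treats the insertion at vertices below a vertex `j ≠ i`
-- (`unitAnticomm_of_mem_xi`). At the vertex `i` itself, the insertion is `ξ_i` after placing a
-- letter `𝟙` anywhere in the word, and the latter anticommutes with `μ` because `𝟙 x` and `x 𝟙`
-- cancel (`mu_insertOne_relation`).
--
-- Throughout, linear combinations are represented by their values on test functions. Compositions
-- therefore read from the outside in: `coder s ψ (coder s φ g) w` applies `ψ` to `w` first and `φ`
-- afterwards.

namespace CyclicBraces

/-! ## Formal sums and words -/

section Words

variable {L L' W : Type*} [AddCommGroup W]

/-- The value of a formal sum under a function on its basis. -/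
def ev (l : List (ℤ × L)) (h : L → W) : W := (l.map fun p => p.1 • h p.2).sum

@[simp] theorem ev_nil (h : L → W) : ev [] h = 0 := rfl

@[simp] theorem ev_cons (p : ℤ × L) (l : List (ℤ × L)) (h : L → W) :
    ev (p :: l) h = p.1 • h p.2 + ev l h := by simp [ev]

@[simp] theorem ev_append (l l' : List (ℤ × L)) (h : L → W) :
    ev (l ++ l') h = ev l h + ev l' h := by simp [ev]

theorem ev_map (l : List (ℤ × L')) (a : ℤ) (f : L' → L) (h : L → W) :
    ev (l.map fun p => (a * p.1, f p.2)) h = a • ev l fun t => h (f t) := by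
  induction l with
  | nil => simp
  | cons p l ih => simp [ih, smul_add, mul_smul]

theorem ev_congr {l : List (ℤ × L)} {h h' : L → W} (H : ∀ p ∈ l, h p.2 = h' p.2) :
    ev l h = ev l h' := by
  induction l with
  | nil => rfl
  | cons p l ih =>
    rw [ev_cons, ev_cons, H p (by simp), ih fun q hq => H q (by simp [hq])]

theorem ev_add (l : List (ℤ × L)) (h h' : L → W) :
    ev l (fun t => h t + h' t) = ev l h + ev l h' := by
  induction l with
  | nil => simp
  | cons p l ih => simp only [ev_cons, ih, smul_add]; abel

@[simp] theorem ev_zero (l : List (ℤ × L)) : ev l (fun _ => (0 : W)) = 0 := by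
  induction l with
  | nil => simp
  | cons p l ih => simp [ih]

theorem ev_zsmul (l : List (ℤ × L)) (a : ℤ) (h : L → W) :
    ev l (fun t => a • h t) = a • ev l h := by
  induction l with
  | nil => simp
  | cons p l ih => simp only [ev_cons, ih, smul_add, smul_comm a p.1]

theorem ev_neg (l : List (ℤ × L)) (h : L → W) : ev l (fun t => - h t) = - ev l h := by
  simpa using ev_zsmul l (-1) h

-- Deconcatenation of words

/-- The sum over all ways to cut a word into two. -/
def cut (g : List L → List L → W) : List L → W
  | [] => g [] []
  | c :: w => g [] (c :: w) + cut (fun v z => g (c :: v) z) w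

@[simp] theorem cut_nil (g : List L → List L → W) : cut g [] = g [] [] := rfl

theorem cut_cons (g : List L → List L → W) (c : L) (w : List L) :
    cut g (c :: w) = g [] (c :: w) + cut (fun v z => g (c :: v) z) w := rfl

theorem cut_congr {g g' : List L → List L → W} {w : List L}
    (H : ∀ v z, v ++ z = w → g v z = g' v z) : cut g w = cut g' w := by
  induction w generalizing g g' with
  | nil => exact H _ _ rfl
  | cons c w ih =>
    rw [cut_cons, cut_cons, H [] (c :: w) rfl, ih fun v z hv => H (c :: v) z (by simp [hv])]

theorem cut_add (g g' : List L → List L → W) (w : List L) :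
    cut (fun v z => g v z + g' v z) w = cut g w + cut g' w := by
  induction w generalizing g g' with
  | nil => rfl
  | cons c w ih => simp only [cut_cons, ih]; abel

@[simp] theorem cut_zero (w : List L) : cut (fun _ _ => (0 : W)) w = 0 := by
  induction w with
  | nil => rfl
  | cons c w ih => simp [cut_cons, ih]

theorem cut_zsmul (a : ℤ) (g : List L → List L → W) (w : List L) :
    cut (fun v z => a • g v z) w = a • cut g w := by
  induction w generalizing g with
  | nil => rfl
  | cons c w ih => simp only [cut_cons, ih, smul_add]

theorem cut_eq_zero {g : List L → List L → W} {w : List L}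
    (H : ∀ v z, v ++ z = w → g v z = 0) : cut g w = 0 := by
  rw [cut_congr H, cut_zero]

theorem cut_map (f : L' → L) (g : List L → List L → W) (w : List L') :
    cut g (w.map f) = cut (fun v z => g (v.map f) (z.map f)) w := by
  induction w generalizing g with
  | nil => rfl
  | cons c w ih => simp only [List.map_cons, cut_cons, ih, List.map_nil]

theorem cut_append_cons (g : List L → List L → W) (u : List L) (c : L) (z : List L) :
    cut g (u ++ c :: z) = cut (fun a b => g a (b ++ c :: z)) u +
      cut (fun a b => g (u ++ c :: a) b) z := by
  induction u generalizing g with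
  | nil => simp [cut_cons]
  | cons x u ih => simp only [List.cons_append, cut_cons, ih]; simp [add_assoc]

/-- The cut at the seam occurs twice on the right, once at the end of `u` and once at the start of
`z`; the extra term on the left compensates this. -/
theorem cut_append (g : List L → List L → W) (u z : List L) :
    cut g (u ++ z) + g u z = cut (fun a b => g a (b ++ z)) u + cut (fun a b => g (u ++ a) b) z := by
  induction u generalizing g with
  | nil => simp [add_comm]
  | cons x u ih =>
    have := ih fun v z => g (x :: v) z
    simp only [List.cons_append, cut_cons] at *
    rw [add_assoc, this]; simp [add_assoc]

/-- Both sides run over the factorizations of `w` into three words: deconcatenation is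
coassociative. -/
theorem cut_assoc (g : List L → List L → List L → W) (w : List L) :
    cut (fun u y => cut (fun v z => g u v z) y) w =
      cut (fun x z => cut (fun u v => g u v z) x) w := by
  induction w generalizing g with
  | nil => rfl
  | cons c w ih =>
    simp only [cut_cons, ih, cut_nil]
    rw [cut_add, add_assoc]

theorem cut_eq_sum_range (g : List L → List L → W) (w : List L) :
    ((List.range (w.length + 1)).map fun a => g (w.take a) (w.drop a)).sum = cut g w := by
  induction w generalizing g with
  | nil => simp
  | cons c w ih =>
    rw [List.length_cons, List.range_succ_eq_map, List.map_cons, List.sum_cons, List.map_map,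
      cut_cons, ← ih]
    rfl

theorem ev_cut (l : List (ℤ × L')) (g : L' → List L → List L → W) (w : List L) :
    ev l (fun c => cut (g c) w) = cut (fun v z => ev l fun c => g c v z) w := by
  induction l with
  | nil => simp
  | cons p l ih => simp only [ev_cons, ih, cut_add, cut_zsmul]

-- Odd coderivations of the tensor coalgebra

/-- The sign of a word, where `s` is the sign of a letter. -/
def wsign (s : L → ℤ) (w : List L) : ℤ := (w.map s).prod

@[simp] theorem wsign_nil (s : L → ℤ) : wsign s [] = 1 := rfl
@[simp] theorem wsign_cons (s : L → ℤ) (c : L) (w : List L) :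
    wsign s (c :: w) = s c * wsign s w := by simp [wsign]
@[simp] theorem wsign_append (s : L → ℤ) (v w : List L) :
    wsign s (v ++ w) = wsign s v * wsign s w := by simp [wsign]

theorem wsign_mul_self {s : L → ℤ} (hs : ∀ c, s c * s c = 1) (w : List L) :
    wsign s w * wsign s w = 1 := by
  induction w with
  | nil => rfl
  | cons c w ih => rw [wsign_cons, mul_mul_mul_comm, hs, ih, one_mul]

/-- The odd coderivation of words that replaces subwords by letters according to `φ`, evaluated by
the function `g` on words. -/
def coder (s : L → ℤ) (φ : List L → List (ℤ × L)) (g : List L → W) (w : List L) : W :=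
  cut (fun u y => cut (fun v z => wsign s u • ev (φ v) fun c => g (u ++ c :: z)) y) w

/-- The part of `coder` that replaces a prefix. -/
def pre (φ : List L → List (ℤ × L)) (g : List L → W) (w : List L) : W :=
  cut (fun v z => ev (φ v) fun c => g (c :: z)) w

variable (s : L → ℤ) (φ ψ : List L → List (ℤ × L))

theorem coder_nil (g : List L → W) : coder s φ g [] = pre φ g [] := by simp [coder, pre]

/-- The replaced subword either starts at `c` or in front of it, which is a prefix, or begins after
`c`; in the last case the odd operation has to pass `c`. -/
theorem coder_cons (g : List L → W) (c : L) (w : List L) :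
    coder s φ g (c :: w) = pre φ g (c :: w) + s c • coder s φ (fun y => g (c :: y)) w := by
  rw [coder, cut_cons, coder, ← cut_zsmul]
  congr 1
  · simp [pre]
  · refine cut_congr fun v z _ => ?_
    rw [← cut_zsmul]
    simp [mul_smul]

theorem coder_add (g g' : List L → W) (w : List L) :
    coder s φ (fun y => g y + g' y) w = coder s φ g w + coder s φ g' w := by
  simp only [coder, ev_add, smul_add, cut_add]

@[simp] theorem coder_zero (w : List L) : coder s φ (fun _ => (0 : W)) w = 0 := by
  simp [coder]

theorem coder_zsmul (a : ℤ) (g : List L → W) (w : List L) :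
    coder s φ (fun y => a • g y) w = a • coder s φ g w := by
  simp only [coder, ev_zsmul, smul_comm _ a, cut_zsmul]

theorem coder_neg (g : List L → W) (w : List L) :
    coder s φ (fun y => - g y) w = - coder s φ g w := by
  simpa using coder_zsmul s φ (-1) g w

theorem coder_congr {s : L → ℤ} {φ : List L → List (ℤ × L)} {g g' : List L → W} {w : List L}
    (H : ∀ u v z, u ++ (v ++ z) = w → ∀ p ∈ φ v, g (u ++ p.2 :: z) = g' (u ++ p.2 :: z)) :
    coder s φ g w = coder s φ g' w := by
  refine cut_congr fun u y hy => cut_congr fun v z hz => ?_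
  subst hz
  rw [ev_congr (h' := fun c => g' (u ++ c :: z)) (H u v z hy)]

theorem coder_eq_zero {s : L → ℤ} {φ : List L → List (ℤ × L)} {g : List L → W} {w : List L}
    (H : ∀ u v z, u ++ (v ++ z) = w → ∀ p ∈ φ v, g (u ++ p.2 :: z) = 0) :
    coder s φ g w = 0 := by
  rw [coder_congr (g' := fun _ => 0) H, coder_zero]

theorem ev_coder (l : List (ℤ × L')) (g : L' → List L → W) (w : List L) :
    ev l (fun c => coder s φ (g c) w) = coder s φ (fun y => ev l fun c => g c y) w := by
  induction l with
  | nil => simp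
  | cons p l ih => simp only [ev_cons, ih, coder_add, coder_zsmul]

theorem pre_add (g g' : List L → W) (w : List L) :
    pre φ (fun y => g y + g' y) w = pre φ g w + pre φ g' w := by
  simp only [pre, ev_add, cut_add]

/-- A coderivation is compatible with the deconcatenation of words. -/
theorem coder_cut (g : List L → List L → W) (w : List L) :
    coder s ψ (cut g) w = cut (fun v z => coder s ψ (fun y => g y z) v +
      wsign s v • coder s ψ (fun y => g v y) z) w := by
  induction w generalizing g with
  | nil => simp [coder_nil, pre, cut_cons, ev_add, add_comm]
  | cons c w ih =>
    -- After a prefix has been replaced by a letter, a cut lies either before the new letter or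
    -- after it.
    have key : pre ψ (cut g) (c :: w) = pre ψ (g []) (c :: w) +
        (pre ψ (fun y => g y (c :: w)) [] + cut (fun v z => pre ψ (fun y => g y z) (c :: v)) w) := by
      have : pre ψ (cut g) (c :: w) = pre ψ (g []) (c :: w) +
          cut (fun v y => cut (fun a b => ev (ψ v) fun c' => g (c' :: a) b) y) (c :: w) := by
        rw [pre, pre, ← cut_add]
        refine cut_congr fun v z _ => ?_
        rw [← ev_cut, ← ev_add]
        rfl
      rw [this, cut_assoc]
      rfl
    rw [coder_cons, key, cut_cons, coder_nil, wsign_nil, one_smul, coder_cons]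
    have h2 : (fun y => cut g (c :: y)) =
        fun y => g [] (c :: y) + cut (fun v z => g (c :: v) z) y := rfl
    rw [h2, coder_add, ih]
    simp only [coder_cons, wsign_cons, mul_smul, cut_add, cut_zsmul, smul_add]
    abel

/-- The composition of two coderivations in terms of the prefixes of a word. -/
theorem coder_coder_aux (hψ : ∀ v, ∀ p ∈ ψ v, s p.2 = - wsign s v) (g : List L → W)
    (w : List L) :
    coder s ψ (pre φ g) w + pre ψ (fun y => coder s φ g y - pre φ g y) w =
      cut (fun v z => coder s ψ (fun y => ev (φ y) fun c => g (c :: z)) v +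
        wsign s v • (ev (φ v) (fun c => coder s ψ (fun y => g (c :: y)) z) -
          ev (ψ v) (fun c => coder s φ (fun y => g (c :: y)) z))) w := by
  have h1 : (pre φ g) = cut (fun v z => ev (φ v) fun c => g (c :: z)) := rfl
  rw [h1, coder_cut, pre, ← cut_add]
  refine cut_congr fun v z _ => ?_
  rw [← ev_coder, smul_sub, ← h1, add_assoc, sub_eq_add_neg, ← smul_neg, ← ev_neg, ← ev_zsmul _ _
    (fun c => -coder s φ (fun y => g (c :: y)) z)]
  congr 2
  refine ev_congr fun p hp => ?_
  -- `φ` acts behind the letter that `ψ` has made from `v`. Passing this letter costs minus the sign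
  -- of `v`, as `ψ` is odd.
  rw [coder_cons, add_sub_cancel_left, hψ v p hp, neg_smul, smul_neg]

theorem coder_coder_nil (hψ : ∀ v, ∀ p ∈ ψ v, s p.2 = - wsign s v) (g : List L → W) :
    coder s ψ (coder s φ g) [] =
      cut (fun v z => coder s ψ (fun y => ev (φ y) fun c => g (c :: z)) v +
        wsign s v • (ev (φ v) (fun c => coder s ψ (fun y => g (c :: y)) z) -
          ev (ψ v) (fun c => coder s φ (fun y => g (c :: y)) z))) [] := by
  rw [← coder_coder_aux s φ ψ hψ, coder_nil, coder_nil, ← pre_add]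
  simp

/-- Either one of the two operations involves the first letter, or both pass `c`; in the latter case
the sign of `c` occurs twice and disappears. -/
theorem coder_coder_cons (hs : ∀ c, s c * s c = 1) (hψ : ∀ v, ∀ p ∈ ψ v, s p.2 = - wsign s v)
    (g : List L → W) (c : L) (w : List L) :
    coder s ψ (coder s φ g) (c :: w) =
      cut (fun v z => coder s ψ (fun y => ev (φ y) fun c => g (c :: z)) v +
        wsign s v • (ev (φ v) (fun c => coder s ψ (fun y => g (c :: y)) z) -
          ev (ψ v) (fun c => coder s φ (fun y => g (c :: y)) z))) (c :: w) +
      coder s ψ (coder s φ fun y => g (c :: y)) w := by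
  rw [← coder_coder_aux s φ ψ hψ, coder_cons, coder_cons]
  have h1 : (fun y => coder s φ g (c :: y)) =
      fun y => pre φ g (c :: y) + s c • coder s φ (fun y => g (c :: y)) y := by
    funext y; rw [coder_cons]
  rw [h1, coder_add, coder_zsmul, smul_add, smul_smul, hs, one_smul]
  have h2 : pre ψ (coder s φ g) (c :: w) =
      pre ψ (pre φ g) (c :: w) + pre ψ (fun y => coder s φ g y - pre φ g y) (c :: w) := by
    rw [← pre_add]; simp
  rw [h2]
  abel

variable {s φ ψ}

/-- Odd coderivations anticommute if they do so after the projection to letters. -/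
theorem coder_anticomm (hs : ∀ c, s c * s c = 1) (hφ : ∀ v, ∀ p ∈ φ v, s p.2 = - wsign s v)
    (hψ : ∀ v, ∀ p ∈ ψ v, s p.2 = - wsign s v) (w : List L)
    (H : ∀ u v z, u ++ (v ++ z) = w → ∀ h : L → W,
      coder s ψ (fun y => ev (φ y) h) v + coder s φ (fun y => ev (ψ y) h) v = 0) (g : List L → W) :
    coder s ψ (coder s φ g) w + coder s φ (coder s ψ g) w = 0 := by
  -- Nested applications cancel by `H`. Applications to disjoint subwords occur in both orders with
  -- opposite signs.
  have key : ∀ w : List L, (∀ u v z, u ++ (v ++ z) = w → ∀ h : L → W,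
      coder s ψ (fun y => ev (φ y) h) v + coder s φ (fun y => ev (ψ y) h) v = 0) → ∀ g : List L → W,
      cut (fun v z => coder s ψ (fun y => ev (φ y) fun c => g (c :: z)) v +
        wsign s v • (ev (φ v) (fun c => coder s ψ (fun y => g (c :: y)) z) -
          ev (ψ v) (fun c => coder s φ (fun y => g (c :: y)) z))) w +
      cut (fun v z => coder s φ (fun y => ev (ψ y) fun c => g (c :: z)) v +
        wsign s v • (ev (ψ v) (fun c => coder s φ (fun y => g (c :: y)) z) -
          ev (φ v) (fun c => coder s ψ (fun y => g (c :: y)) z))) w = 0 := by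
    intro w H g
    rw [← cut_add]
    refine cut_eq_zero fun v z hv => ?_
    have := H [] v z hv fun c => g (c :: z)
    rw [smul_sub, smul_sub, ← this]
    abel
  induction w generalizing g with
  | nil =>
    rw [coder_coder_nil s φ ψ hψ, coder_coder_nil s ψ φ hφ]
    exact key [] H g
  | cons c w ih =>
    rw [coder_coder_cons s φ ψ hs hψ, coder_coder_cons s ψ φ hs hφ, add_add_add_comm,
      key _ H g, zero_add]
    exact ih (fun u v z h => H (c :: u) v z (by simp [h])) _

/-- An odd coderivation squares to zero if it does so after the projection to letters. -/
theorem coder_sq (hs : ∀ c, s c * s c = 1) (hφ : ∀ v, ∀ p ∈ φ v, s p.2 = - wsign s v) (w : List L)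
    (H : ∀ u v z, u ++ (v ++ z) = w → ∀ h : L → W, coder s φ (fun y => ev (φ y) h) v = 0)
    (g : List L → W) : coder s φ (coder s φ g) w = 0 := by
  induction w generalizing g with
  | nil =>
    rw [coder_coder_nil s φ φ hφ]
    refine cut_eq_zero fun v z hv => ?_
    rw [H [] v z hv, sub_self, smul_zero, add_zero]
  | cons c w ih =>
    rw [coder_coder_cons s φ φ hs hφ, ih (fun u v z h => H (c :: u) v z (by simp [h])), add_zero]
    refine cut_eq_zero fun v z hv => ?_
    rw [H [] v z hv, sub_self, smul_zero, add_zero]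

end Words

section

variable {n : ℕ}

/-! ## Induction over trees and over the terms of the differential -/

/-- Trees are a nested inductive type, so the recursor needs a second motive for forests; it is
taken to be `P` for all members. -/
theorem PlanarTree.induction {P : PlanarTree n → Prop}
    (ext : ∀ i m cs, (∀ c ∈ cs, P c) → P (.ext i m cs))
    (int : ∀ cs, (∀ c ∈ cs, P c) → P (.int cs)) (t : PlanarTree n) : P t :=
  PlanarTree.rec (motive_1 := P) (motive_2 := fun cs => ∀ c ∈ cs, P c)
    (fun i m cs h => ext i m cs h) (fun cs h => int cs h) (by simp)
    (fun c cs hc hcs x hx => by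
      rcases List.mem_cons.1 hx with rfl | hx
      exacts [hc, hcs x hx]) t

theorem le_of_mem_intervals {k : ℕ} {p : ℕ × ℕ} (hp : p ∈ intervals k) : p.1 + p.2 ≤ k := by
  simp only [intervals, List.mem_flatMap, List.mem_range, List.mem_map] at hp
  obtain ⟨a, ha, l, hl, rfl⟩ := hp
  dsimp only
  omega

/-- Translates the pairs `(a, l)` of the differential to the factorizations `u ++ (v ++ z)` that the
calculus of words uses. -/
theorem exists_of_mem_intervals {α : Type*} {cs : List α} {p : ℕ × ℕ}
    (hp : p ∈ intervals cs.length) : ∃ u v z, cs = u ++ (v ++ z) ∧ u.length = p.1 ∧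
      v.length = p.2 ∧ cs.take p.1 = u ∧ (cs.drop p.1).take p.2 = v ∧ cs.drop (p.1 + p.2) = z := by
  have := le_of_mem_intervals hp
  refine ⟨_, _, _, ?_, ?_, ?_, rfl, rfl, rfl⟩
  · rw [← List.drop_drop, List.take_append_drop, List.take_append_drop]
  · rw [List.length_take]; omega
  · rw [List.length_take, List.length_drop]; omega

theorem mem_dTermsList {cs : List (PlanarTree n)} {p : ℤ × List (PlanarTree n)}
    (hp : p ∈ dTermsList cs) : ∃ u c z, cs = u ++ c :: z ∧ ∃ q ∈ dTerms c, p.2 = u ++ q.2 :: z := by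
  induction cs generalizing p with
  | nil => simp [dTermsList] at hp
  | cons c cs ih =>
    simp only [dTermsList, List.mem_append, List.mem_map] at hp
    rcases hp with ⟨q, hq, rfl⟩ | ⟨q, hq, rfl⟩
    · exact ⟨[], c, cs, rfl, q, hq, rfl⟩
    · obtain ⟨u, c', z, rfl, r, hr, hqr⟩ := ih hq
      exact ⟨c :: u, c', z, rfl, r, hr, by simp [hqr]⟩

/-- A relation holds between a tree and all terms of its differential if it holds for all ways of
splitting the root vertex and is compatible with grafting. -/
theorem dTerms_induction {R : PlanarTree n → PlanarTree n → Prop}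
    (split_int : ∀ u v z, 2 ≤ v.length → v.length < (u ++ (v ++ z)).length →
      R (.int (u ++ (v ++ z))) (.int (u ++ .int v :: z)))
    (split_below : ∀ i m m' u v z, 2 ≤ v.length → m.splitBelow u.length v.length = some m' →
      R (.ext i m (u ++ (v ++ z))) (.ext i m' (u ++ .int v :: z)))
    (split_above : ∀ i m m' u v z, v.length < (u ++ (v ++ z)).length →
      m.splitAbove u.length v.length = some m' →
      R (.ext i m (u ++ (v ++ z))) (.int (u ++ .ext i m' v :: z)))
    (turn : ∀ i j j' cs, (j ≤ cs.length → j' ≤ cs.length) →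
      R (.ext i (.unit j) cs) (.ext i (.edge j') cs))
    (ext : ∀ i m u c c' z, R c c' → R (.ext i m (u ++ c :: z)) (.ext i m (u ++ c' :: z)))
    (int : ∀ u c c' z, R c c' → R (.int (u ++ c :: z)) (.int (u ++ c' :: z)))
    (t : PlanarTree n) : ∀ p ∈ dTerms t, R t p.2 := by
  induction t using PlanarTree.induction with
  | ext i m cs ih =>
    intro p hp
    simp only [dTerms, List.mem_append, List.mem_map] at hp
    rcases hp with ((hp | hp) | hp) | ⟨q, hq, rfl⟩
    · cases m with
      | edge j => simp [turnMark] at hp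
      | unit j =>
        simp only [turnMark, List.mem_cons, List.not_mem_nil, or_false] at hp
        rcases hp with rfl | rfl
        · refine turn _ _ _ _ fun h => ?_
          split_ifs <;> omega
        · exact turn _ _ _ _ id
    · simp only [splitExtBelow, List.mem_flatMap, List.mem_filter, List.mem_map,
        decide_eq_true_eq, Option.mem_toList] at hp
      obtain ⟨q, ⟨hq, h2⟩, m', hm, rfl⟩ := hp
      obtain ⟨u, v, z, h, hu, hv, h3, h4, h5⟩ := exists_of_mem_intervals hq
      rw [← hv] at h2
      rw [← hu, ← hv] at hm
      dsimp only
      rw [h3, h4, h5, h]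
      exact split_below _ _ _ _ _ _ h2 hm
    · simp only [splitExtAbove, List.mem_flatMap, List.mem_filter, List.mem_map,
        decide_eq_true_eq, Option.mem_toList] at hp
      obtain ⟨q, ⟨hq, h2⟩, m', hm, rfl⟩ := hp
      obtain ⟨u, v, z, h, hu, hv, h3, h4, h5⟩ := exists_of_mem_intervals hq
      rw [← hv] at h2
      rw [← hu, ← hv] at hm
      dsimp only
      rw [h3, h4, h5, h]
      rw [h] at h2
      exact split_above _ _ _ _ _ _ h2 hm
    · obtain ⟨u, c, z, rfl, r, hr, hq⟩ := mem_dTermsList hq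
      dsimp only
      rw [hq]
      exact ext _ _ _ _ _ _ (ih c (by simp) r hr)
  | int cs ih =>
    intro p hp
    simp only [dTerms, List.mem_append, List.mem_map] at hp
    rcases hp with hp | ⟨q, hq, rfl⟩
    · simp only [splitInt, List.mem_filter, List.mem_map, decide_eq_true_eq] at hp
      obtain ⟨q, ⟨hq, h2, h2'⟩, rfl⟩ := hp
      obtain ⟨u, v, z, h, hu, hv, h3, h4, h5⟩ := exists_of_mem_intervals hq
      dsimp only
      rw [h3, h4, h5]
      rw [← hv] at h2 h2'
      rw [h] at h2' ⊢
      exact split_int _ _ _ h2 h2'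
    · obtain ⟨u, c, z, rfl, r, hr, hq⟩ := mem_dTermsList hq
      dsimp only
      rw [hq]
      exact int _ _ _ _ (ih c (by simp) r hr)

/-! ## Properties of trees that the differential respects -/

theorem labelsList_append (u z : List (PlanarTree n)) :
    labelsList (u ++ z) = labelsList u ++ labelsList z := by
  induction u with
  | nil => rfl
  | cons c u ih => simp [labelsList, ih]

theorem numEdgesList_append (u z : List (PlanarTree n)) :
    numEdgesList (u ++ z) = numEdgesList u + numEdgesList z := by
  induction u with
  | nil => simp [numEdgesList]
  | cons c u ih => simp [numEdgesList, ih]; ring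

theorem numIntList_append (u z : List (PlanarTree n)) :
    numIntList (u ++ z) = numIntList u + numIntList z := by
  induction u with
  | nil => simp [numIntList]
  | cons c u ih => simp [numIntList, ih]; ring

theorem wellFormedList_iff (cs : List (PlanarTree n)) :
    WellFormedList cs ↔ ∀ c ∈ cs, WellFormed c := by
  induction cs with
  | nil => simp [WellFormedList]
  | cons c cs ih => simp [WellFormedList, ih]

theorem rootMarkedList_iff (cs : List (PlanarTree n)) :
    RootMarkedList cs ↔ ∀ c ∈ cs, RootMarked c := by
  induction cs with
  | nil => simp [RootMarkedList]
  | cons c cs ih => simp [RootMarkedList, ih]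

mutual
/-- All external vertices with a label outside of `S` are marked in the direction of the root. -/
def RootMarkedOff (S : Finset (Fin n)) : PlanarTree n → Prop
  | .ext i m cs => (i ∉ S → m = .edge 0) ∧ RootMarkedOffList S cs
  | .int cs => RootMarkedOffList S cs
/-- `RootMarkedOff` for a forest. -/
def RootMarkedOffList (S : Finset (Fin n)) : List (PlanarTree n) → Prop
  | [] => True
  | c :: cs => RootMarkedOff S c ∧ RootMarkedOffList S cs
end

theorem rootMarkedOffList_iff (S : Finset (Fin n)) (cs : List (PlanarTree n)) :
    RootMarkedOffList S cs ↔ ∀ c ∈ cs, RootMarkedOff S c := by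
  induction cs with
  | nil => simp [RootMarkedOffList]
  | cons c cs ih => simp [RootMarkedOffList, ih]

theorem rootMarkedOff_empty (t : PlanarTree n) : RootMarkedOff ∅ t ↔ RootMarked t := by
  induction t using PlanarTree.induction with
  | ext i m cs ih =>
    simp only [RootMarkedOff, RootMarked, rootMarkedOffList_iff, rootMarkedList_iff]
    simp +contextual [ih]
  | int cs ih =>
    simp only [RootMarkedOff, RootMarked, rootMarkedOffList_iff, rootMarkedList_iff]
    simp +contextual [ih]

theorem rootMarkedOff_univ (t : PlanarTree n) : RootMarkedOff Finset.univ t := by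
  induction t using PlanarTree.induction with
  | ext i m cs ih =>
    simpa only [RootMarkedOff, rootMarkedOffList_iff, Finset.mem_univ, not_true_eq_false,
      false_imp_iff, true_and] using ih
  | int cs ih =>
    simpa only [RootMarkedOff, rootMarkedOffList_iff] using ih

theorem RootMarkedOff.mono {S S' : Finset (Fin n)} (h : S ⊆ S') {t : PlanarTree n}
    (ht : RootMarkedOff S t) : RootMarkedOff S' t := by
  induction t using PlanarTree.induction with
  | ext i m cs ih =>
    simp only [RootMarkedOff, rootMarkedOffList_iff] at ht ⊢
    exact ⟨fun hi => ht.1 fun hi' => hi (h hi'), fun c hc => ih c hc (ht.2 c hc)⟩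
  | int cs ih =>
    simp only [RootMarkedOff, rootMarkedOffList_iff] at ht ⊢
    exact fun c hc => ih c hc (ht c hc)

theorem Mark.ones_splitBelow {m m' : Mark} {a l : ℕ} (h : m.splitBelow a l = some m') :
    m'.ones = m.ones := by
  cases m <;> simp only [Mark.splitBelow] at h <;> split_ifs at h <;>
    cases h <;> rfl

theorem Mark.ones_splitAbove {m m' : Mark} {a l : ℕ} (h : m.splitAbove a l = some m') :
    m'.ones = m.ones := by
  cases m <;> simp only [Mark.splitAbove] at h <;> split_ifs at h <;>
    cases h <;> rfl

theorem labels_perm_of_mem_dTerms (t : PlanarTree n) :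
    ∀ p ∈ dTerms t, (labels p.2).Perm (labels t) := by
  refine dTerms_induction (R := fun t t' => (labels t').Perm (labels t)) ?_ ?_ ?_ ?_ ?_ ?_ t
  · intro u v z _ _
    simp [labels, labelsList_append, labelsList]
  · intro i m m' u v z _ _
    simp [labels, labelsList_append, labelsList]
  · intro i m m' u v z _ _
    simp only [labels, labelsList_append, labelsList]
    exact List.perm_middle
  · intro i j j' cs _
    rfl
  · intro i m u c c' z h
    simp only [labels, labelsList_append, labelsList]
    exact (((h.append_right _).append_left _).cons _)
  · intro u c c' z h
    simp only [labels, labelsList_append, labelsList]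
    exact ((h.append_right _).append_left _)

theorem degree_of_mem_dTerms (t : PlanarTree n) : ∀ p ∈ dTerms t, degree p.2 = degree t + 1 := by
  refine dTerms_induction (R := fun t t' => degree t' = degree t + 1) ?_ ?_ ?_ ?_ ?_ ?_ t
  · intro u v z _ _
    simp [degree, numEdges, numInt, numEdgesList_append, numIntList_append, numEdgesList, numIntList]
    ring
  · intro i m m' u v z _ h
    simp [degree, numEdges, numInt, numEdgesList_append, numIntList_append, numEdgesList,
      numIntList, Mark.ones_splitBelow h]
    ring
  · intro i m m' u v z _ h
    simp [degree, numEdges, numInt, numEdgesList_append, numIntList_append, numEdgesList,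
      numIntList, Mark.ones_splitAbove h]
    ring
  · intro i j j' cs _
    simp [degree, numEdges, numInt, Mark.ones]
    ring
  · intro i m u c c' z h
    simp [degree, numEdges, numInt, numEdgesList_append, numIntList_append, numEdgesList,
      numIntList] at h ⊢
    linarith
  · intro u c c' z h
    simp [degree, numEdges, numInt, numEdgesList_append, numIntList_append, numEdgesList,
      numIntList] at h ⊢
    linarith

theorem Mark.InRange.splitBelow {m m' : Mark} {a l b : ℕ} (h : m.splitBelow a l = some m')
    (_ : 2 ≤ l) (hm : m.InRange (a + (l + b))) : m'.InRange (a + (b + 1)) := by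
  cases m <;> simp only [Mark.splitBelow] at h <;> split_ifs at h <;> cases h <;>
    simp only [Mark.InRange] at * <;> omega

theorem Mark.InRange.splitAbove {m m' : Mark} {a l : ℕ} (h : m.splitAbove a l = some m') :
    m'.InRange l := by
  cases m <;> simp only [Mark.splitAbove] at h <;> split_ifs at h <;> cases h <;>
    simp only [Mark.InRange] at * <;> omega

theorem wellFormed_of_mem_dTerms (t : PlanarTree n) :
    ∀ p ∈ dTerms t, WellFormed t → WellFormed p.2 := by
  refine dTerms_induction (R := fun t t' => WellFormed t → WellFormed t') ?_ ?_ ?_ ?_ ?_ ?_ t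
  · intro u v z h1 h2
    simp only [WellFormed, wellFormedList_iff, List.mem_append, List.mem_cons, List.length_append,
      List.length_cons] at *
    rintro ⟨h3, h4⟩
    refine ⟨by omega, ?_⟩
    rintro c (h | rfl | h)
    · exact h4 _ (.inl h)
    · simp only [WellFormed, wellFormedList_iff]
      exact ⟨h1, fun c hc => h4 c (.inr (.inl hc))⟩
    · exact h4 _ (.inr (.inr h))
  · intro i m m' u v z h1 h2
    simp only [WellFormed, wellFormedList_iff, List.mem_append, List.mem_cons, List.length_append,
      List.length_cons] at *
    rintro ⟨h3, h4⟩
    refine ⟨h3.splitBelow h2 h1, ?_⟩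
    rintro c (h | rfl | h)
    · exact h4 _ (.inl h)
    · simp only [WellFormed, wellFormedList_iff]
      exact ⟨h1, fun c hc => h4 c (.inr (.inl hc))⟩
    · exact h4 _ (.inr (.inr h))
  · intro i m m' u v z h1 h2
    simp only [WellFormed, wellFormedList_iff, List.mem_append, List.mem_cons, List.length_append,
      List.length_cons] at *
    rintro ⟨h3, h4⟩
    refine ⟨by omega, ?_⟩
    rintro c (h | rfl | h)
    · exact h4 _ (.inl h)
    · simp only [WellFormed, wellFormedList_iff]
      exact ⟨Mark.InRange.splitAbove h2, fun c hc => h4 c (.inr (.inl hc))⟩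
    · exact h4 _ (.inr (.inr h))
  · exact fun i j j' cs h h1 => ⟨h h1.1, h1.2⟩
  · intro i m u c c' z h
    simp only [WellFormed, wellFormedList_iff, List.mem_append, List.mem_cons, List.length_append,
      List.length_cons]
    rintro ⟨h1, h2⟩
    refine ⟨h1, ?_⟩
    rintro x (hx | rfl | hx)
    exacts [h2 _ (.inl hx), h (h2 _ (.inr (.inl rfl))), h2 _ (.inr (.inr hx))]
  · intro u c c' z h
    simp only [WellFormed, wellFormedList_iff, List.mem_append, List.mem_cons, List.length_append,
      List.length_cons]
    rintro ⟨h1, h2⟩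
    refine ⟨h1, ?_⟩
    rintro x (hx | rfl | hx)
    exacts [h2 _ (.inl hx), h (h2 _ (.inr (.inl rfl))), h2 _ (.inr (.inr hx))]

/-- A mark towards the root stays there: `splitBelow` does not touch edge `0`, and `splitAbove`
transfers the mark to the new edge, which is again edge `0`. The remaining source of other marks,
`turnMark`, needs an edge to `𝟙`, which only vertices with label in `S` have. -/
theorem rootMarkedOff_of_mem_dTerms (S : Finset (Fin n)) (t : PlanarTree n) :
    ∀ p ∈ dTerms t, RootMarkedOff S t → RootMarkedOff S p.2 := by
  refine dTerms_induction (R := fun t t' => RootMarkedOff S t → RootMarkedOff S t')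
    ?_ ?_ ?_ ?_ ?_ ?_ t
  · intro u v z _ _
    simp only [RootMarkedOff, rootMarkedOffList_iff, List.mem_append, List.mem_cons]
    rintro h c (hc | rfl | hc)
    · exact h _ (.inl hc)
    · simp only [RootMarkedOff, rootMarkedOffList_iff]
      exact fun c hc => h c (.inr (.inl hc))
    · exact h _ (.inr (.inr hc))
  · intro i m m' u v z _ hm
    simp only [RootMarkedOff, rootMarkedOffList_iff, List.mem_append, List.mem_cons]
    rintro ⟨h1, h⟩
    refine ⟨fun hi => ?_, ?_⟩
    · rw [h1 hi, Mark.splitBelow, if_pos (Nat.zero_le _)] at hm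
      exact (Option.some.inj hm).symm
    rintro c (hc | rfl | hc)
    · exact h _ (.inl hc)
    · simp only [RootMarkedOff, rootMarkedOffList_iff]
      exact fun c hc => h c (.inr (.inl hc))
    · exact h _ (.inr (.inr hc))
  · intro i m m' u v z _ hm
    simp only [RootMarkedOff, rootMarkedOffList_iff, List.mem_append, List.mem_cons]
    rintro ⟨h1, h⟩
    rintro c (hc | rfl | hc)
    · exact h _ (.inl hc)
    · simp only [RootMarkedOff, rootMarkedOffList_iff]
      refine ⟨fun hi => ?_, fun c hc => h c (.inr (.inl hc))⟩
      rw [h1 hi, Mark.splitAbove, if_neg (by omega)] at hm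
      exact (Option.some.inj hm).symm
    · exact h _ (.inr (.inr hc))
  · rintro i j j' cs h ⟨h1, h2⟩
    exact ⟨fun hi => absurd (h1 hi) (by simp), h2⟩
  · intro i m u c c' z h
    simp only [RootMarkedOff, rootMarkedOffList_iff, List.mem_append, List.mem_cons]
    rintro ⟨h1, h2⟩
    refine ⟨h1, ?_⟩
    rintro x (hx | rfl | hx)
    exacts [h2 _ (.inl hx), h (h2 _ (.inr (.inl rfl))), h2 _ (.inr (.inr hx))]
  · intro u c c' z h
    simp only [RootMarkedOff, rootMarkedOffList_iff, List.mem_append, List.mem_cons]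
    rintro h2 x (hx | rfl | hx)
    exacts [h2 _ (.inl hx), h (h2 _ (.inr (.inl rfl))), h2 _ (.inr (.inr hx))]

-- Sums over subwords and the projection to letters

section Words

variable {L L' W : Type*} [AddCommGroup W]

/-- The sum over all subwords `v` of a word `u ++ v ++ z`. -/
def tri (F : List L → List L → List L → W) (w : List L) : W :=
  cut (fun u y => cut (fun v z => F u v z) y) w

theorem tri_congr {F F' : List L → List L → List L → W} {w : List L}
    (H : ∀ u v z, u ++ (v ++ z) = w → F u v z = F' u v z) : tri F w = tri F' w := by
  refine cut_congr fun u y hy => cut_congr fun v z hz => ?_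
  subst hz
  exact H u v z hy

theorem tri_add (F F' : List L → List L → List L → W) (w : List L) :
    tri (fun u v z => F u v z + F' u v z) w = tri F w + tri F' w := by
  simp only [tri, cut_add]

theorem tri_zsmul (a : ℤ) (F : List L → List L → List L → W) (w : List L) :
    tri (fun u v z => a • F u v z) w = a • tri F w := by
  simp only [tri, cut_zsmul]

theorem tri_neg (F : List L → List L → List L → W) (w : List L) :
    tri (fun u v z => - F u v z) w = - tri F w := by
  simpa using tri_zsmul (-1) F w

theorem tri_eq_zero {F : List L → List L → List L → W} {w : List L}
    (H : ∀ u v z, u ++ (v ++ z) = w → F u v z = 0) : tri F w = 0 := by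
  rw [tri_congr (F' := fun _ _ _ => 0) H]
  simp [tri]

theorem tri_map (f : L' → L) (F : List L → List L → List L → W) (w : List L') :
    tri F (w.map f) = tri (fun u v z => F (u.map f) (v.map f) (z.map f)) w := by
  simp only [tri, cut_map]

/-- A subword lies to the left of `c`, contains `c`, or lies to the right of `c`. -/
theorem tri_append_cons (F : List L → List L → List L → W) (u : List L) (c : L) (z : List L) :
    tri F (u ++ c :: z) = tri (fun a v b => F a v (b ++ c :: z)) u +
      cut (fun u₁ u₂ => cut (fun z₁ z₂ => F u₁ (u₂ ++ c :: z₁) z₂) z) u +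
      tri (fun a v b => F (u ++ c :: a) v b) z := by
  simp only [tri, cut_append_cons, cut_add]

/-- Without a letter at the seam the three cases overlap: nonempty subwords that end or start there
are counted twice and the empty one three times. The two cuts on the left account for this. -/
theorem tri_append (F : List L → List L → List L → W) (u z : List L) :
    tri F (u ++ z) + cut (fun a b => F a b z) u + cut (fun a b => F u a b) z =
      tri (fun a v b => F a v (b ++ z)) u +
      cut (fun u₁ u₂ => cut (fun z₁ z₂ => F u₁ (u₂ ++ z₁) z₂) z) u +
      tri (fun a v b => F (u ++ a) v b) z := by
  have h1 := cut_append (fun u y => cut (fun v z => F u v z) y) u z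
  have h2 : cut (fun a b => cut (fun v z => F a v z) (b ++ z)) u + cut (fun a b => F a b z) u =
      tri (fun a v b => F a v (b ++ z)) u +
      cut (fun u₁ u₂ => cut (fun z₁ z₂ => F u₁ (u₂ ++ z₁) z₂) z) u := by
    rw [← cut_add, tri, ← cut_add]
    exact cut_congr fun a b _ => cut_append _ _ _
  simp only [tri] at *
  rw [add_right_comm, h1, ← h2]
  abel

/-- The sum over the cuts of a word with an empty second part. -/
theorem cut_right_nil (g : List L → W) (w : List L) :
    cut (fun a b => if b = [] then g a else 0) w = g w := by
  induction w generalizing g with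
  | nil => simp
  | cons c w ih => rw [cut_cons, ih fun a => g (c :: a)]; simp

/-- The sum over the cuts of a word with an empty first part. -/
theorem cut_left_nil (g : List L → W) (w : List L) :
    cut (fun a b => if a = [] then g b else 0) w = g w := by
  cases w with
  | nil => simp
  | cons c w => rw [cut_cons]; simp

/-- Evaluation of words of length one. -/
def sgl (k : L → W) : List L → W
  | [x] => k x
  | _ => 0

@[simp] theorem sgl_nil (k : L → W) : sgl k [] = 0 := rfl
@[simp] theorem sgl_singleton (k : L → W) (x : L) : sgl k [x] = k x := rfl
@[simp] theorem sgl_cons_cons (k : L → W) (x y : L) (w : List L) : sgl k (x :: y :: w) = 0 := rfl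

theorem sgl_append_cons (k : L → W) (u : List L) (x : L) (z : List L) :
    sgl k (u ++ x :: z) = if u = [] ∧ z = [] then k x else 0 := by
  rcases u with _ | ⟨a, _ | ⟨b, u⟩⟩ <;> rcases z with _ | ⟨c, z⟩ <;> simp

theorem tri_full (F : List L → W) (w : List L) :
    tri (fun u v z => if u = [] ∧ z = [] then F v else 0) w = F w := by
  have h : ∀ u y : List L, cut (fun v z => if u = [] ∧ z = [] then F v else 0) y =
      if u = [] then F y else 0 := by
    intro u y
    by_cases hu : u = []
    · simp [hu, cut_right_nil]
    · simp [hu]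
  simp only [tri, h, cut_left_nil]

variable (s : L → ℤ) (φ ψ : List L → List (ℤ × L))

theorem coder_eq_tri (g : List L → W) (w : List L) : coder s φ g w =
    tri (fun u v z => wsign s u • ev (φ v) fun c => g (u ++ c :: z)) w := rfl

/-- Only the replacement of the whole word leaves a single letter, so the projection of a
coderivation to letters recovers the operation. -/
theorem coder_sgl (k : L → W) (w : List L) : coder s φ (sgl k) w = ev (φ w) k := by
  rw [coder_eq_tri, ← tri_full (fun v => ev (φ v) k) w]
  refine tri_congr fun u v z _ => ?_
  simp only [sgl_append_cons]
  by_cases h : u = [] ∧ z = []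
  · simp [h.1, h.2]
  · simp [h]

theorem coder_append_cons (g : List L → W) (u : List L) (c : L) (z : List L) :
    coder s φ g (u ++ c :: z) = coder s φ (fun y => g (y ++ c :: z)) u +
      cut (fun u₁ u₂ => cut (fun z₁ z₂ => wsign s u₁ •
        ev (φ (u₂ ++ c :: z₁)) fun c' => g (u₁ ++ c' :: z₂)) z) u +
      (wsign s u * s c) • coder s φ (fun y => g (u ++ c :: y)) z := by
  rw [coder_eq_tri, tri_append_cons, coder_eq_tri, coder_eq_tri, ← tri_zsmul]
  simp [mul_smul]

end Words

/-! ## The differential on words of trees -/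

section Trees

variable {W : Type*} [AddCommGroup W]

theorem sgn_add (a b : ℕ) : sgn (a + b) = sgn a * sgn b := pow_add _ _ _

@[simp] theorem sgn_zero : sgn 0 = 1 := rfl
@[simp] theorem sgn_one : sgn 1 = -1 := rfl

@[simp] theorem sgn_mul_self (a : ℕ) : sgn a * sgn a = 1 := by
  rw [sgn, ← mul_pow]; simp

/-- The sign of a tree together with the edge below it. -/
def tsign (t : PlanarTree n) : ℤ := sgn (1 + numEdges t)

theorem tsign_mul_self (t : PlanarTree n) : tsign t * tsign t = 1 := sgn_mul_self _

theorem wsign_tsign (cs : List (PlanarTree n)) : wsign tsign cs = sgn (numEdgesList cs) := by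
  induction cs with
  | nil => rfl
  | cons c cs ih => rw [wsign_cons, ih, numEdgesList, sgn_add, tsign]

@[simp] theorem tsign_int (cs : List (PlanarTree n)) : tsign (.int cs) = - wsign tsign cs := by
  rw [tsign, numEdges, sgn_add, wsign_tsign, sgn_one, neg_one_mul]

@[simp] theorem tsign_ext (i : Fin n) (m : Mark) (cs : List (PlanarTree n)) :
    tsign (.ext i m cs) = - (sgn m.ones * wsign tsign cs) := by
  rw [tsign, numEdges, sgn_add, sgn_add, wsign_tsign, sgn_one, neg_one_mul]

theorem tsign_of_mem_dTerms (t : PlanarTree n) : ∀ p ∈ dTerms t, tsign p.2 = - tsign t := by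
  refine dTerms_induction (R := fun t t' => tsign t' = - tsign t) ?_ ?_ ?_ ?_ ?_ ?_ t
  · intro u v z _ _
    simp
  · intro i m m' u v z _ h
    simp [Mark.ones_splitBelow h]
  · intro i m m' u v z _ h
    simp [Mark.ones_splitAbove h]
    ring
  · intro i j j' cs _
    simp [Mark.ones]
  · intro i m u c c' z h
    simp [h]
  · intro u c c' z h
    simp [h]

/-- The differential of a word of length one. -/
def dLetter : List (PlanarTree n) → List (ℤ × PlanarTree n)
  | [t] => (dTerms t).map fun p => (-1 * p.1, p.2)
  | _ => []

/-- The operations of the free `A∞`-algebra: the differential on words of length one, and grafting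
to an internal vertex on longer words. -/
def muT : List (PlanarTree n) → List (ℤ × PlanarTree n)
  | [] => []
  | [t] => dLetter [t]
  | c :: c' :: cs => [(1, .int (c :: c' :: cs))]

/-- Grafting a word of length at least two to an internal vertex. -/
def graft (h : PlanarTree n → W) (cs : List (PlanarTree n)) : W :=
  if 2 ≤ cs.length then h (.int cs) else 0

/-- The minus sign comes from moving the new edge past the edge by which the tree is grafted. -/
theorem ev_dLetter (v : List (PlanarTree n)) (h : PlanarTree n → W) :
    ev (dLetter v) h = - sgl (fun t => ev (dTerms t) h) v := by
  match v with
  | [] => simp [dLetter]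
  | [t] => rw [dLetter, ev_map _ (-1) (fun x => x)]; simp
  | c :: c' :: cs => simp [dLetter]

theorem ev_muT (v : List (PlanarTree n)) (h : PlanarTree n → W) :
    ev (muT v) h = - sgl (fun t => ev (dTerms t) h) v + graft h v := by
  match v with
  | [] => simp [muT, graft]
  | [t] => simp [muT, ev_dLetter, graft]
  | c :: c' :: cs => simp [muT, graft]

theorem tsign_of_mem_muT (v : List (PlanarTree n)) : ∀ p ∈ muT v, tsign p.2 = - wsign tsign v := by
  match v with
  | [] => simp [muT]
  | [t] =>
    simp only [muT, dLetter, List.mem_map]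
    rintro p ⟨q, hq, rfl⟩
    simpa using tsign_of_mem_dTerms t q hq
  | c :: c' :: cs => simp [muT]

/-- The recursion for forests is the signed Leibniz rule, that is, a coderivation that replaces only
single letters. -/
theorem ev_dTermsList (cs : List (PlanarTree n)) (g : List (PlanarTree n) → W) :
    ev (dTermsList cs) g = coder tsign dLetter g cs := by
  induction cs generalizing g with
  | nil => simp [dTermsList, coder_nil, pre, dLetter]
  | cons c cs ih =>
    have h1 : (fun p : ℤ × PlanarTree n => (-p.1, p.2 :: cs)) = fun p => (-1 * p.1, p.2 :: cs) := by
      simp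
    rw [dTermsList, ev_append, h1, ev_map _ (-1) (fun t => t :: cs), ev_map _ _ (fun t => c :: t),
      ih, coder_cons, pre]
    congr 1
    have h2 : cut (fun v z => ev (dLetter v) fun c' => g (c' :: z)) (c :: cs) =
        0 + cut (fun v z => if v = [] then -ev (dTerms c) fun c' => g (c' :: z) else 0) cs := by
      rw [cut_cons]
      congr 1
      refine cut_congr fun v z _ => ?_
      rw [ev_dLetter]
      cases v <;> simp
    rw [h2, cut_left_nil]
    simp

/-- Separates the operations by arity: one letter gives the differential of a child, and a longer
subword is grafted to a new internal vertex, as in the splittings of the vertex that carries the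
word. -/
theorem coder_muT (g : List (PlanarTree n) → W) (cs : List (PlanarTree n)) :
    coder tsign muT g cs = ev (dTermsList cs) g + tri (fun u v z => if 2 ≤ v.length then
      wsign tsign u • g (u ++ .int v :: z) else 0) cs := by
  rw [ev_dTermsList, coder_eq_tri, coder_eq_tri, ← tri_add]
  refine tri_congr fun u v z _ => ?_
  rw [ev_dLetter, ev_muT, graft, smul_add]
  split_ifs <;> simp

theorem ev_filter_flatMap {α β : Type*} (l : List α) (q : α → Bool) (F : α → List (ℤ × β))
    (h : β → W) : ev ((l.filter q).flatMap F) h =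
      (l.map fun x => if q x then ev (F x) h else 0).sum := by
  induction l with
  | nil => simp
  | cons x l ih =>
    by_cases hx : q x <;> simp [hx, ih]

theorem ev_intervals {α β : Type*} (cs : List α) (q : ℕ × ℕ → Bool)
    (F : ℕ × ℕ → List (ℤ × β)) (h : β → W) :
    ev (((intervals cs.length).filter q).flatMap F) h =
      tri (fun u v _ => if q (u.length, v.length) then ev (F (u.length, v.length)) h else 0) cs := by
  rw [ev_filter_flatMap, tri, ← cut_eq_sum_range, intervals, List.map_flatMap, List.flatMap_def,
    List.sum_flatten, List.map_map]
  refine congrArg List.sum (List.map_congr_left fun a ha => ?_)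
  have ha' : a ≤ cs.length := by simpa [Nat.lt_succ_iff] using ha
  rw [Function.comp_apply, ← cut_eq_sum_range, List.map_map, List.length_drop, Nat.sub_add_comm ha']
  refine congrArg List.sum (List.map_congr_left fun l hl => ?_)
  have hl' : l < cs.length + 1 - a := by simpa [Nat.sub_add_comm ha'] using hl
  have h1 : (cs.take a).length = a := by simp [ha']
  have h2 : ((cs.drop a).take l).length = l := by
    rw [List.length_take, List.length_drop]; omega
  rw [h1, h2]
  rfl

/-- The differential of an internal vertex is the bar differential of the word of its children.
`graft` is zero on words of length below two, and this discards the excluded splitting in which the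
new vertex takes all children. -/
theorem ev_dTerms_int (h : PlanarTree n → W) {cs : List (PlanarTree n)} (hcs : 2 ≤ cs.length) :
    ev (dTerms (.int cs)) h = coder tsign muT (graft h) cs := by
  rw [coder_muT, dTerms, ev_append, add_comm]
  congr 1
  · have := ev_map (dTermsList cs) 1 PlanarTree.int h
    simp only [one_mul, one_smul] at this
    rw [this]
    refine ev_congr fun p hp => ?_
    obtain ⟨u, c, z, rfl, q, -, hq⟩ := mem_dTermsList hp
    rw [graft, if_pos]
    rw [hq]
    simpa using hcs
  · rw [splitInt, ← List.flatMap_pure_eq_map, ev_intervals]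
    refine tri_congr fun u v z hw => ?_
    subst hw
    simp only [graft, List.length_append, List.length_cons, decide_eq_true_eq]
    by_cases h2 : 2 ≤ v.length
    · by_cases h3 : 2 ≤ u.length + (z.length + 1)
      · rw [if_pos ⟨h2, by omega⟩, if_pos h2, if_pos h3]
        simp [pure, wsign_tsign, ← List.drop_drop]
      · rw [if_neg (by omega), if_pos h2, if_neg h3, smul_zero]
    · rw [if_neg (by omega), if_neg h2]

end Trees

/-! ## Decorated words -/

/-- Letters of the word that describes a vertex: a child, which may be marked, or the edge to `𝟙`. -/
inductive Letter (n : ℕ) : Type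
  | tree (b : Bool) (t : PlanarTree n) : Letter n
  | one : Letter n

namespace Letter

/-- The sign of a letter. -/
def sign : Letter n → ℤ
  | tree _ t => tsign t
  | one => -1

theorem sign_mul_self : ∀ c : Letter n, c.sign * c.sign = 1
  | tree _ t => tsign_mul_self t
  | one => rfl

/-- Whether a letter is marked or the edge to `𝟙`. -/
def special : Letter n → Bool
  | tree b _ => b
  | one => true

/-- Forget the decoration. -/
def toTree? : Letter n → Option (PlanarTree n)
  | tree _ t => some t
  | one => none

/-- Whether a letter is the edge to `𝟙`. -/
def isOne : Letter n → Bool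
  | tree _ _ => false
  | one => true

end Letter

/-- The trees in a word. -/
def forget (w : List (Letter n)) : List (PlanarTree n) := w.filterMap Letter.toTree?

/-- Undecorated words. -/
def plain (cs : List (PlanarTree n)) : List (Letter n) := cs.map (Letter.tree false)

/-- The number of decorations of a word. -/
def weight (w : List (Letter n)) : ℕ := w.countP Letter.special

@[simp] theorem forget_append (u z : List (Letter n)) : forget (u ++ z) = forget u ++ forget z :=
  List.filterMap_append

@[simp] theorem forget_nil : forget ([] : List (Letter n)) = [] := rfl
@[simp] theorem forget_one_cons (w : List (Letter n)) : forget (.one :: w) = forget w := rfl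
@[simp] theorem forget_tree_cons (b : Bool) (t : PlanarTree n) (w : List (Letter n)) :
    forget (.tree b t :: w) = t :: forget w := rfl

@[simp] theorem plain_append (u z : List (PlanarTree n)) : plain (u ++ z) = plain u ++ plain z :=
  List.map_append
@[simp] theorem plain_nil : plain ([] : List (PlanarTree n)) = [] := rfl
@[simp] theorem plain_cons (t : PlanarTree n) (w : List (PlanarTree n)) :
    plain (t :: w) = .tree false t :: plain w := rfl

@[simp] theorem forget_plain (cs : List (PlanarTree n)) : forget (plain cs) = cs := by
  induction cs with
  | nil => rfl
  | cons c cs ih => simp [ih]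

@[simp] theorem weight_append (u z : List (Letter n)) : weight (u ++ z) = weight u + weight z :=
  List.countP_append
@[simp] theorem weight_nil : weight ([] : List (Letter n)) = 0 := rfl
@[simp] theorem weight_one_cons (w : List (Letter n)) : weight (.one :: w) = weight w + 1 :=
  List.countP_cons_of_pos rfl
@[simp] theorem weight_true_cons (t : PlanarTree n) (w : List (Letter n)) :
    weight (.tree true t :: w) = weight w + 1 :=
  List.countP_cons_of_pos rfl
@[simp] theorem weight_false_cons (t : PlanarTree n) (w : List (Letter n)) :
    weight (.tree false t :: w) = weight w := by
  simp [weight, Letter.special]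

@[simp] theorem weight_plain (cs : List (PlanarTree n)) : weight (plain cs) = 0 := by
  induction cs with
  | nil => rfl
  | cons c cs ih => simp [ih]

theorem eq_plain_of_weight {w : List (Letter n)} (h : weight w = 0) : ∃ cs, w = plain cs := by
  induction w with
  | nil => exact ⟨[], rfl⟩
  | cons c w ih =>
    match c with
    | .one => simp at h
    | .tree true t => simp at h
    | .tree false t =>
      obtain ⟨cs, rfl⟩ := ih (by simpa using h)
      exact ⟨t :: cs, rfl⟩

/-- A word with at most one decoration has one of three forms. -/
theorem weight_le_one_cases {w : List (Letter n)} (h : weight w ≤ 1) :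
    (∃ cs, w = plain cs) ∨ (∃ u x z, w = plain u ++ .tree true x :: plain z) ∨
      ∃ u z, w = plain u ++ .one :: plain z := by
  induction w with
  | nil => exact .inl ⟨[], rfl⟩
  | cons c w ih =>
    match c with
    | .one =>
      obtain ⟨cs, rfl⟩ := eq_plain_of_weight (w := w) (by simpa using h)
      exact .inr (.inr ⟨[], cs, rfl⟩)
    | .tree true t =>
      obtain ⟨cs, rfl⟩ := eq_plain_of_weight (w := w) (by simpa using h)
      exact .inr (.inl ⟨[], t, cs, rfl⟩)
    | .tree false t =>
      obtain ⟨cs, rfl⟩ | ⟨u, x, z, rfl⟩ | ⟨u, z, rfl⟩ := ih (by simpa using h)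
      · exact .inl ⟨t :: cs, rfl⟩
      · exact .inr (.inl ⟨t :: u, x, z, rfl⟩)
      · exact .inr (.inr ⟨t :: u, z, rfl⟩)

@[simp] theorem wsign_plain (cs : List (PlanarTree n)) :
    wsign Letter.sign (plain cs) = wsign tsign cs := by
  induction cs with
  | nil => rfl
  | cons c cs ih => simp [ih, Letter.sign]

theorem wsign_forget {w : List (Letter n)} (h : ∀ c ∈ w, c.isOne = false) :
    wsign Letter.sign w = wsign tsign (forget w) := by
  induction w with
  | nil => rfl
  | cons c w ih =>
    match c with
    | .one => simp [Letter.isOne] at h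
    | .tree b t =>
      simp only [List.mem_cons, forall_eq_or_imp] at h
      rw [wsign_cons, forget_tree_cons, wsign_cons, ih h.2]
      rfl

/-- The operations of the free `A∞`-algebra on decorated words, where `𝟙` acts as a unit: an operation
on a word with a mark has a marked result. -/
def mu : List (Letter n) → List (ℤ × Letter n)
  | [.tree false t, .one] => [(-tsign t, .tree true t)]
  | [.one, .tree false t] => [(1, .tree true t)]
  | w => if w.any Letter.isOne then [] else
      (muT (forget w)).map fun p => (p.1, .tree (decide (weight w ≠ 0)) p.2)

theorem mu_of_not_one {w : List (Letter n)} (h : ∀ c ∈ w, c.isOne = false) :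
    mu w = (muT (forget w)).map fun p => (p.1, .tree (decide (weight w ≠ 0)) p.2) := by
  unfold mu
  split
  · simp [Letter.isOne] at h
  · simp [Letter.isOne] at h
  · rw [if_neg]
    simpa using h

theorem not_one_plain (cs : List (PlanarTree n)) : ∀ c ∈ plain cs, c.isOne = false := by
  simp [plain, Letter.isOne]

theorem not_one_marked (u : List (PlanarTree n)) (x : PlanarTree n) (z : List (PlanarTree n)) :
    ∀ c ∈ plain u ++ .tree true x :: plain z, c.isOne = false := by
  simp only [List.mem_append, List.mem_cons]
  rintro c (h | rfl | h)
  exacts [not_one_plain _ _ h, rfl, not_one_plain _ _ h]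

theorem sign_of_mem_mu (w : List (Letter n)) : ∀ p ∈ mu w, p.2.sign = - wsign Letter.sign w := by
  unfold mu
  split
  · simp [Letter.sign]
  · simp [Letter.sign]
  · split_ifs with h
    · simp
    · simp only [List.mem_map]
      rintro p ⟨q, hq, rfl⟩
      rw [wsign_forget (by simpa using h), ← tsign_of_mem_muT _ q hq]
      rfl

section Evaluation

variable {W : Type*} [AddCommGroup W]

theorem ev_map_snd {α β : Type*} (l : List (ℤ × α)) (f : α → β) (h : β → W) :
    ev (l.map fun p => (p.1, f p.2)) h = ev l fun t => h (f t) := by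
  simpa using ev_map l 1 f h

theorem ev_mu_plain (cs : List (PlanarTree n)) (h : Letter n → W) :
    ev (mu (plain cs)) h = ev (muT cs) fun t => h (.tree false t) := by
  rw [mu_of_not_one (not_one_plain cs), forget_plain, weight_plain]
  exact ev_map_snd _ _ _

theorem ev_mu_marked (u : List (PlanarTree n)) (x : PlanarTree n) (z : List (PlanarTree n))
    (h : Letter n → W) : ev (mu (plain u ++ .tree true x :: plain z)) h =
      ev (muT (u ++ x :: z)) fun t => h (.tree true t) := by
  rw [mu_of_not_one (not_one_marked u x z)]
  simpa using ev_map_snd (muT (u ++ x :: z)) (Letter.tree true) h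

/-- `𝟙` is a strict unit: it only enters products with one other letter. Such a product marks this
letter, and the two sides have opposite signs after the sign of the letter is taken into account. -/
theorem ev_mu_unit (u z : List (PlanarTree n)) (h : Letter n → W) :
    ev (mu (plain u ++ .one :: plain z)) h =
      (if u = [] then sgl (fun t => h (.tree true t)) z else 0) -
      (if z = [] then sgl (fun t => tsign t • h (.tree true t)) u else 0) := by
  match u, z with
  | [], [] => simp [mu, Letter.isOne]
  | [], [x] => simp [mu]
  | [], x :: y :: z => simp [mu, Letter.isOne]
  | [x], [] => simp [mu]
  | x :: y :: u, [] => simp [mu, Letter.isOne]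
  | [x], y :: z => simp [mu, Letter.isOne]
  | x :: y :: u, y' :: z => simp [mu, Letter.isOne]

theorem coder_mu_plain (g : List (Letter n) → W) (cs : List (PlanarTree n)) :
    coder Letter.sign mu g (plain cs) = coder tsign muT (fun y => g (plain y)) cs := by
  rw [coder_eq_tri, coder_eq_tri]
  refine (tri_map _ _ cs).trans (tri_congr fun u v z _ => ?_)
  change wsign _ (plain u) • ev (mu (plain v)) (fun c => g (plain u ++ c :: plain z)) = _
  rw [wsign_plain, ev_mu_plain]
  simp

end Evaluation

-- External vertices as operations on decorated words

/-- The mark that a decorated word describes. -/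
def markOf : List (Letter n) → Mark
  | [] => .edge 0
  | .one :: _ => .unit 0
  | .tree true _ :: _ => .edge 1
  | .tree false _ :: w =>
    match markOf w with
    | .edge 0 => .edge 0
    | .edge (j + 1) => .edge (j + 2)
    | .unit j => .unit (j + 1)

/-- The sign that moves the edge to `𝟙` to the front. -/
def unitMoveSign : List (Letter n) → ℤ
  | [] => 1
  | .one :: _ => 1
  | .tree true _ :: _ => 1
  | .tree false t :: w => if (markOf w).ones = 1 then tsign t * unitMoveSign w else 1

/-- The external vertex with label `i` that a decorated word describes. Decorated words give a
marked letter. -/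
def xi (i : Fin n) (w : List (Letter n)) : List (ℤ × Letter n) :=
  if weight w ≤ 1 then
    [(unitMoveSign w, .tree (decide (weight w ≠ 0)) (.ext i (markOf w) (forget w)))]
  else []

theorem xi_plain (i : Fin n) (cs : List (PlanarTree n)) :
    xi i (plain cs) = [(1, .tree false (.ext i (.edge 0) cs))] := by
  have h : markOf (plain cs) = .edge 0 := by
    induction cs with
    | nil => rfl
    | cons c cs ih => simp [markOf, ih]
  have h' : unitMoveSign (plain cs) = 1 := by
    cases cs with
    | nil => rfl
    | cons c cs =>
      simp only [plain_cons, markOf] at h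
      simp only [plain_cons, unitMoveSign]
      rw [if_neg]
      intro h2
      cases h3 : markOf (plain cs) with
      | edge j => simp [h3, Mark.ones] at h2
      | unit j => simp [h3] at h
  simp [xi, h, h']

theorem xi_marked (i : Fin n) (u : List (PlanarTree n)) (x : PlanarTree n)
    (z : List (PlanarTree n)) : xi i (plain u ++ .tree true x :: plain z) =
      [(1, .tree true (.ext i (.edge (u.length + 1)) (u ++ x :: z)))] := by
  have h : markOf (plain u ++ .tree true x :: plain z) = .edge (u.length + 1) := by
    induction u with
    | nil => rfl
    | cons c cs ih => simp [markOf, ih]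
  have h' : unitMoveSign (plain u ++ .tree true x :: plain z) = 1 := by
    cases u with
    | nil => rfl
    | cons c cs =>
      simp only [plain_cons, List.cons_append, markOf] at h
      simp only [plain_cons, List.cons_append, unitMoveSign]
      rw [if_neg]
      intro h2
      cases h3 : markOf (plain cs ++ .tree true x :: plain z) with
      | edge j => simp [h3, Mark.ones] at h2
      | unit j => simp [h3] at h
  simp [xi, h, h']

/-- In the canonical order the edge to `𝟙` precedes the edges of all children, whereas the letter
`𝟙` comes after those of `u`; this explains the sign. -/
theorem xi_unit (i : Fin n) (u z : List (PlanarTree n)) : xi i (plain u ++ .one :: plain z) =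
      [(wsign tsign u, .tree true (.ext i (.unit u.length) (u ++ z)))] := by
  have h : ∀ u, markOf (plain u ++ .one :: plain z) = .unit u.length := by
    intro u
    induction u with
    | nil => rfl
    | cons c cs ih => simp [markOf, ih]
  have h' : unitMoveSign (plain u ++ .one :: plain z) = wsign tsign u := by
    induction u with
    | nil => rfl
    | cons c cs ih => simp [unitMoveSign, ih, h, Mark.ones]
  simp [xi, h, h']

theorem sign_of_mem_xi (i : Fin n) (w : List (Letter n)) :
    ∀ p ∈ xi i w, p.2.sign = - wsign Letter.sign w := by
  by_cases hw : weight w ≤ 1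
  · obtain ⟨cs, rfl⟩ | ⟨u, x, z, rfl⟩ | ⟨u, z, rfl⟩ := weight_le_one_cases hw
    · simp [xi_plain, Letter.sign, Mark.ones]
    · simp [xi_marked, Letter.sign, Mark.ones]
    · simp [xi_unit, Letter.sign, Mark.ones]
  · simp [xi, hw]

section Evaluation

variable {W : Type*} [AddCommGroup W]

/-- The external vertex with the mark in the direction of the root. -/
def xiT (i : Fin n) (cs : List (PlanarTree n)) : List (ℤ × PlanarTree n) :=
  [(1, .ext i (.edge 0) cs)]

theorem coder_xi_plain (i : Fin n) (g : List (Letter n) → W) (cs : List (PlanarTree n)) :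
    coder Letter.sign (xi i) g (plain cs) = coder tsign (xiT i) (fun y => g (plain y)) cs := by
  rw [coder_eq_tri, coder_eq_tri]
  refine (tri_map _ _ cs).trans (tri_congr fun u v z _ => ?_)
  change wsign _ (plain u) • ev (xi i (plain v)) (fun c => g (plain u ++ c :: plain z)) = _
  rw [wsign_plain, xi_plain]
  simp [xiT]

end Evaluation

end

section

variable {n : ℕ} {W : Type*} [AddCommGroup W]

/-! ## The operations on words with a decoration -/

theorem cut_plain (F : List (Letter n) → List (Letter n) → W) (cs : List (PlanarTree n)) :
    cut F (plain cs) = cut (fun u v => F (plain u) (plain v)) cs := cut_map _ _ _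

theorem coder_mu_marked (g : List (Letter n) → W) (u : List (PlanarTree n)) (x : PlanarTree n)
    (z : List (PlanarTree n)) : coder Letter.sign mu g (plain u ++ .tree true x :: plain z) =
      coder tsign muT (fun y => g (plain y ++ .tree true x :: plain z)) u +
      cut (fun u₁ u₂ => cut (fun z₁ z₂ => wsign tsign u₁ • ev (muT (u₂ ++ x :: z₁)) fun t =>
        g (plain u₁ ++ .tree true t :: plain z₂)) z) u +
      (wsign tsign u * tsign x) •
        coder tsign muT (fun y => g (plain u ++ .tree true x :: plain y)) z := by
  rw [coder_append_cons, coder_mu_plain, coder_mu_plain, wsign_plain, cut_plain]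
  simp only [cut_plain, wsign_plain, ev_mu_marked]
  rfl

theorem coder_xi_marked (i : Fin n) (g : List (Letter n) → W) (u : List (PlanarTree n))
    (x : PlanarTree n) (z : List (PlanarTree n)) :
    coder Letter.sign (xi i) g (plain u ++ .tree true x :: plain z) =
      coder tsign (xiT i) (fun y => g (plain y ++ .tree true x :: plain z)) u +
      cut (fun u₁ u₂ => cut (fun z₁ z₂ => wsign tsign u₁ •
        g (plain u₁ ++ .tree true (.ext i (.edge (u₂.length + 1)) (u₂ ++ x :: z₁)) ::
          plain z₂)) z) u +
      (wsign tsign u * tsign x) •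
        coder tsign (xiT i) (fun y => g (plain u ++ .tree true x :: plain y)) z := by
  rw [coder_append_cons, coder_xi_plain, coder_xi_plain, wsign_plain, cut_plain]
  simp only [cut_plain, wsign_plain, xi_marked]
  simp only [ev_cons, ev_nil, one_smul, add_zero]
  rfl

theorem cut_sgl_head {L : Type*} (F : List L → W) (z : List L) :
    cut (fun z₁ z₂ => sgl (fun t => F (t :: z₂)) z₁) z = if z = [] then 0 else F z := by
  cases z with
  | nil => rfl
  | cons x z =>
    rw [cut_cons, sgl_nil, zero_add, if_neg (by simp), ← cut_left_nil (fun z => F (x :: z)) z]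
    refine cut_congr fun v y _ => ?_
    rcases v with _ | ⟨c, v⟩ <;> simp

theorem cut_sgl_last {L : Type*} (F : List L → W) (u : List L) :
    cut (fun u₁ u₂ => sgl (fun t => F (u₁ ++ [t])) u₂) u = if u = [] then 0 else F u := by
  induction u generalizing F with
  | nil => rfl
  | cons x u ih =>
    rw [cut_cons]
    have := ih fun y => F (x :: y)
    simp only [List.cons_append]
    rw [this]
    cases u <;> simp

/-- The middle terms are the products of `𝟙` with its right and left neighbour; all other operations
act on one side of `𝟙`. The argument `F` allows `g` on marked words to be supplied in a simplified
form. -/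
theorem coder_mu_unit (g : List (Letter n) → W) (F : List (PlanarTree n) → PlanarTree n →
      List (PlanarTree n) → W) (u z : List (PlanarTree n))
    (hF : ∀ u t z, F u t z = g (plain u ++ .tree true t :: plain z)) :
    coder Letter.sign mu g (plain u ++ .one :: plain z) =
      coder tsign muT (fun y => g (plain y ++ .one :: plain z)) u +
      (wsign tsign u • cut (fun z₁ z₂ => sgl (fun t => F u t z₂) z₁) z -
        cut (fun u₁ u₂ => sgl (fun t => (wsign tsign u₁ * tsign t) • F u₁ t z) u₂) u) -
      wsign tsign u • coder tsign muT (fun y => g (plain u ++ .one :: plain y)) z := by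
  rw [coder_append_cons, coder_mu_plain, coder_mu_plain, wsign_plain, cut_plain]
  simp only [cut_plain, wsign_plain, ev_mu_unit, ← hF]
  have h1 : Letter.sign (.one : Letter n) = -1 := rfl
  rw [h1, mul_neg_one, neg_smul, ← sub_eq_add_neg]
  congr 2
  have h2 : ∀ u₁ u₂ : List (PlanarTree n), cut (fun z₁ z₂ => wsign tsign u₁ •
        ((if u₂ = [] then sgl (fun t => F u₁ t z₂) z₁ else 0) -
          if z₁ = [] then sgl (fun t => tsign t • F u₁ t z₂) u₂ else 0)) z =
      (if u₂ = [] then wsign tsign u₁ • cut (fun z₁ z₂ => sgl (fun t => F u₁ t z₂) z₁) z else 0) +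
      (-1 : ℤ) • sgl (fun t => (wsign tsign u₁ * tsign t) • F u₁ t z) u₂ := by
    intro u₁ u₂
    have h3 : ∀ z₂, wsign tsign u₁ • sgl (fun t => tsign t • F u₁ t z₂) u₂ =
        sgl (fun t => (wsign tsign u₁ * tsign t) • F u₁ t z₂) u₂ := by
      intro z₂
      rcases u₂ with _ | ⟨a, _ | ⟨b, u₂⟩⟩ <;> simp [mul_smul]
    have e1 : cut (fun z₁ z₂ => wsign tsign u₁ •
        ((if u₂ = [] then sgl (fun t => F u₁ t z₂) z₁ else 0) -
          if z₁ = [] then sgl (fun t => tsign t • F u₁ t z₂) u₂ else 0)) z =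
        cut (fun z₁ z₂ => wsign tsign u₁ • if u₂ = [] then sgl (fun t => F u₁ t z₂) z₁ else 0) z +
        cut (fun z₁ z₂ => (-1 : ℤ) • if z₁ = [] then
          sgl (fun t => (wsign tsign u₁ * tsign t) • F u₁ t z₂) u₂ else 0) z := by
      rw [← cut_add]
      refine cut_congr fun v y _ => ?_
      rw [smul_sub, smul_ite, smul_ite, smul_ite, h3, smul_zero, smul_zero, neg_one_zsmul,
        sub_eq_add_neg]
      split_ifs <;> simp
    rw [e1, cut_zsmul, cut_zsmul, cut_left_nil (fun z₂ =>
      sgl (fun t => (wsign tsign u₁ * tsign t) • F u₁ t z₂) u₂) z]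
    by_cases hu : u₂ = [] <;> simp [hu]
  simp only [h2]
  rw [cut_add, cut_right_nil, cut_zsmul, neg_one_zsmul, sub_eq_add_neg]

theorem coder_xi_unit (i : Fin n) (g : List (Letter n) → W) (u z : List (PlanarTree n)) :
    coder Letter.sign (xi i) g (plain u ++ .one :: plain z) =
      coder tsign (xiT i) (fun y => g (plain y ++ .one :: plain z)) u +
      cut (fun u₁ u₂ => cut (fun z₁ z₂ => wsign tsign u •
        g (plain u₁ ++ .tree true (.ext i (.unit u₂.length) (u₂ ++ z₁)) :: plain z₂)) z) u -
      wsign tsign u • coder tsign (xiT i) (fun y => g (plain u ++ .one :: plain y)) z := by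
  rw [coder_append_cons, coder_xi_plain, coder_xi_plain, wsign_plain, cut_plain]
  have h1 : Letter.sign (.one : Letter n) = -1 := rfl
  rw [h1, mul_neg_one, neg_smul, ← sub_eq_add_neg]
  congr 2
  refine cut_congr fun u₁ u₂ h => ?_
  rw [cut_plain]
  refine cut_congr fun z₁ z₂ _ => ?_
  rw [xi_unit, ev_cons, ev_nil, add_zero, smul_smul, wsign_plain, ← h, wsign_append]

/-! ## The `A∞`-relations -/

/-- The differential squares to zero on `t`. -/
def SquareZero (W : Type*) [AddCommGroup W] (t : PlanarTree n) : Prop :=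
  ∀ h : PlanarTree n → W, ev (dTerms t) (fun t' => ev (dTerms t') h) = 0

theorem length_pos_of_mem_muT {v : List (PlanarTree n)} {p : ℤ × PlanarTree n}
    (hp : p ∈ muT v) : 1 ≤ v.length := by
  match v with
  | [] => simp [muT] at hp
  | [t] => simp
  | c :: c' :: cs => simp

theorem coder_muT_graft_singleton (h : PlanarTree n → W) {cs : List (PlanarTree n)}
    (hcs : cs.length < 2) : coder tsign muT (graft h) cs = 0 := by
  refine coder_eq_zero fun u v z hv p hp => ?_
  have := length_pos_of_mem_muT hp
  subst hv
  simp only [List.length_append] at hcs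
  rw [graft, if_neg]
  simp only [List.length_append, List.length_cons]
  omega

theorem graft_ev_dTerms (h : PlanarTree n → W) :
    graft (fun t => ev (dTerms t) h) = coder tsign muT (graft h) := by
  funext cs
  by_cases hcs : 2 ≤ cs.length
  · rw [graft, if_pos hcs, ev_dTerms_int h hcs]
  · rw [graft, if_neg hcs, coder_muT_graft_singleton h (by omega)]

/-- On at least two letters the terms cancel by the description of `d` at an internal vertex
(`graft_ev_dTerms`), as in a free A∞-algebra. On one letter the relation is `d² = 0`, and only there
is the hypothesis needed. -/
theorem muT_relation {cs : List (PlanarTree n)} (hcs : ∀ t ∈ cs, SquareZero W t)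
    (h : PlanarTree n → W) : coder tsign muT (fun y => ev (muT y) h) cs = 0 := by
  have h1 : (fun y => ev (muT y) h) = fun y => - sgl (fun t => ev (dTerms t) h) y + graft h y := by
    funext y; rw [ev_muT]
  rw [h1, coder_add, coder_neg]
  rw [coder_sgl, ev_muT, ← graft_ev_dTerms]
  match cs, hcs with
  | [], _ => simp
  | [t], hcs => simp [hcs t (by simp) h]
  | c :: c' :: cs, _ => simp

/-- A mark is carried along by every operation, so the marked case is `muT_relation` for the
underlying trees. If `𝟙` occurs, each term contains a product with `𝟙`: multiplying before or after
operating on the other letters gives opposite signs, and on words with letters on both sides of `𝟙`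
its right and left products cancel. -/
theorem mu_relation {w : List (Letter n)} (hw : weight w ≤ 1)
    (hg : ∀ t ∈ forget w, SquareZero W t) (h : Letter n → W) :
    coder Letter.sign mu (fun y => ev (mu y) h) w = 0 := by
  obtain ⟨cs, rfl⟩ | ⟨u, x, z, rfl⟩ | ⟨u, z, rfl⟩ := weight_le_one_cases hw
  · rw [coder_mu_plain]
    simp only [ev_mu_plain]
    exact muT_relation (by simpa using hg) _
  · rw [coder_mu_marked]
    simp only [ev_mu_marked]
    rw [← muT_relation (cs := u ++ x :: z) (by simpa using hg) fun t => h (.tree true t),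
      coder_append_cons]
  · rw [coder_mu_unit _ (fun u t z => ev (muT (u ++ t :: z)) fun t => h (.tree true t)) _ _
      fun u t z => (ev_mu_marked u t z h).symm]
    have h1 := cut_sgl_head (fun y => ev (muT (u ++ y)) fun t => h (.tree true t)) z
    have h2 : cut (fun u₁ u₂ => sgl (fun t => (wsign tsign u₁ * tsign t) •
        ev (muT (u₁ ++ t :: z)) fun t => h (.tree true t)) u₂) u =
        if u = [] then 0 else wsign tsign u • ev (muT (u ++ z)) fun t => h (.tree true t) := by
      rw [← cut_sgl_last (fun u => wsign tsign u • ev (muT (u ++ z)) fun t => h (.tree true t))]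
      simp
    have h3 : ∀ k : PlanarTree n → W, coder tsign muT (fun y => if y = [] then (0 : W) else
        sgl k y) u = ev (muT u) k := by
      intro k
      rw [← coder_sgl tsign]
      refine coder_congr fun a v b _ p _ => ?_
      simp
    have h4 : coder tsign muT (fun y => ev (mu (plain y ++ .one :: plain z)) h) u =
        if z = [] then wsign tsign u • ev (muT u) (fun t => h (.tree true t)) else 0 := by
      simp only [ev_mu_unit]
      have : coder tsign muT (fun y => (if y = [] then sgl (fun t => h (.tree true t)) z else 0) -
          if z = [] then sgl (fun t => tsign t • h (.tree true t)) y else 0) u =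
          coder tsign muT (fun y => - if z = [] then sgl (fun t => tsign t • h (.tree true t)) y
            else 0) u := by
        refine coder_congr fun a v b _ p _ => ?_
        simp
      rw [this, coder_neg]
      by_cases hz : z = []
      · simp only [hz, if_true]
        have := coder_sgl tsign muT (fun t => tsign t • h (.tree true t)) u
        rw [show (fun y => sgl (fun t => tsign t • h (.tree true t)) y) =
          sgl (fun t => tsign t • h (.tree true t)) from rfl, this, ← ev_zsmul, ← ev_neg]
        refine ev_congr fun p hp => ?_
        rw [tsign_of_mem_muT u p hp, neg_smul, neg_neg]
      · simp [hz]
    have h5 : coder tsign muT (fun y => ev (mu (plain u ++ .one :: plain y)) h) z =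
        if u = [] then ev (muT z) (fun t => h (.tree true t)) else 0 := by
      simp only [ev_mu_unit]
      have : coder tsign muT (fun y => (if u = [] then sgl (fun t => h (.tree true t)) y else 0) -
          if y = [] then sgl (fun t => tsign t • h (.tree true t)) u else 0) z =
          coder tsign muT (fun y => if u = [] then sgl (fun t => h (.tree true t)) y
            else 0) z := by
        refine coder_congr fun a v b _ p _ => ?_
        simp
      rw [this]
      by_cases hu : u = []
      · simp only [hu, if_true]
        exact coder_sgl tsign muT _ z
      · simp [hu]
    rw [h1, h2, h4, h5]
    by_cases hu : u = [] <;> by_cases hz : z = [] <;> simp [hu, hz, muT]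

/-! ## The differential of an external vertex -/

theorem ev_toList {α β : Type*} (o : Option α) (f : α → ℤ × β) (h : β → W) :
    ev (o.toList.map f) h = o.elim 0 fun a => (f a).1 • h (f a).2 := by
  cases o <;> simp

/-- In the terms with the new internal vertex nearer to the root, the edges of `u` are passed by the
new edge and, if there is one, by the edge to `𝟙`; two passages cancel, hence the sign `1` in the
second case. -/
theorem ev_dTerms_ext (h : PlanarTree n → W) (i : Fin n) (m : Mark) (cs : List (PlanarTree n)) :
    ev (dTerms (.ext i m cs)) h = ev (turnMark i m cs) h +
      tri (fun u v z => (m.splitBelow u.length v.length).elim 0 fun m' =>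
        (sgn m.ones * wsign tsign u) • graft (fun t => h (.ext i m' (u ++ t :: z))) v) cs +
      tri (fun u v z => (m.splitAbove u.length v.length).elim 0 fun m' =>
        (if m.ones = 0 then wsign tsign u else 1) • graft h (u ++ .ext i m' v :: z)) cs +
      sgn m.ones • ev (dTermsList cs) fun y => h (.ext i m y) := by
  rw [dTerms, ev_append, ev_append, ev_append, ev_map _ _ (fun y => PlanarTree.ext i m y)]
  congr 2
  · congr 1
    rw [splitExtBelow, ev_intervals]
    refine tri_congr fun u v z hw => ?_
    subst hw
    simp only [decide_eq_true_eq, ev_toList]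
    by_cases h2 : 2 ≤ v.length
    · rw [if_pos h2]
      cases m.splitBelow u.length v.length <;>
        simp [graft, h2, wsign_tsign, sgn_add, ← List.drop_drop]
    · rw [if_neg h2]
      cases m.splitBelow u.length v.length <;> simp [graft, h2]
  · rw [splitExtAbove, ev_intervals]
    refine tri_congr fun u v z hw => ?_
    subst hw
    have hs : (if m.ones = 0 then wsign tsign u else 1) = sgn ((1 + m.ones) * numEdgesList u) := by
      cases m with
      | edge j => simp [Mark.ones, wsign_tsign]
      | unit j => simp [Mark.ones, sgn, pow_mul]
    rw [hs]
    simp only [decide_eq_true_eq, ev_toList, graft, List.length_append, List.length_cons]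
    by_cases h2 : v.length < u.length + (v.length + z.length)
    · have h3 : 2 ≤ u.length + (z.length + 1) := by omega
      rw [if_pos h2]
      simp only [if_pos h3]
      cases m.splitAbove u.length v.length <;> simp [← List.drop_drop]
    · have h3 : ¬ 2 ≤ u.length + (z.length + 1) := by omega
      rw [if_neg h2]
      simp only [if_neg h3]
      cases m.splitAbove u.length v.length <;> simp

theorem ev_dTermsList_append (u z : List (PlanarTree n)) (g : List (PlanarTree n) → W) :
    ev (dTermsList (u ++ z)) g = ev (dTermsList u) (fun y => g (y ++ z)) +
      wsign tsign u • ev (dTermsList z) fun y => g (u ++ y) := by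
  induction u generalizing g with
  | nil => simp [dTermsList]
  | cons c u ih =>
    have h1 : ∀ w, (fun p : ℤ × PlanarTree n => (-p.1, p.2 :: w)) =
        fun p => (-1 * p.1, p.2 :: w) := by simp
    rw [List.cons_append, dTermsList, dTermsList, ev_append, ev_append, h1, h1,
      ev_map _ (-1) (fun t => t :: (u ++ z)), ev_map _ (-1) (fun t => t :: u),
      ev_map _ _ (fun t => c :: t), ev_map _ _ (fun t => c :: t), ih, smul_add, smul_smul,
      wsign_cons, tsign, add_assoc]
    rfl

theorem ev_dTermsList_congr {u : List (PlanarTree n)} {g g' : List (PlanarTree n) → W}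
    (H : ∀ y, y.length = u.length → g y = g' y) : ev (dTermsList u) g = ev (dTermsList u) g' := by
  refine ev_congr fun p hp => H _ ?_
  obtain ⟨a, c, b, rfl, q, -, hq⟩ := mem_dTermsList hp
  simp [hq]

/-- The differential of a letter. -/
def dL : Letter n → List (ℤ × Letter n)
  | .tree b t => (dTerms t).map fun p => (p.1, .tree b p.2)
  | .one => []

/-- The operations of arity at least two. -/
def nu (h : Letter n → W) (y : List (Letter n)) : W :=
  ev (mu y) h + sgl (fun c => ev (dL c) h) y

theorem nu_plain (h : Letter n → W) (cs : List (PlanarTree n)) :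
    nu h (plain cs) = graft (fun t => h (.tree false t)) cs := by
  rw [nu, ev_mu_plain, ev_muT]
  rcases cs with _ | ⟨x, _ | ⟨y, cs⟩⟩ <;> simp [dL, ev_map_snd]

theorem nu_marked (h : Letter n → W) (u : List (PlanarTree n)) (x : PlanarTree n)
    (z : List (PlanarTree n)) : nu h (plain u ++ .tree true x :: plain z) =
      graft (fun t => h (.tree true t)) (u ++ x :: z) := by
  rw [nu, ev_mu_marked, ev_muT]
  rcases u with _ | ⟨a, _ | ⟨b, u⟩⟩ <;> rcases z with _ | ⟨c, z⟩ <;> simp [dL, ev_map_snd]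

theorem nu_unit (h : Letter n → W) (u z : List (PlanarTree n)) :
    nu h (plain u ++ .one :: plain z) =
      (if u = [] then sgl (fun t => h (.tree true t)) z else 0) -
      (if z = [] then sgl (fun t => tsign t • h (.tree true t)) u else 0) := by
  rw [nu, ev_mu_unit, sgl_append_cons]
  simp [dL]

theorem ev_mu_eq (h : Letter n → W) :
    (fun y => ev (mu y) h) = fun y => nu h y + -1 • sgl (fun c => ev (dL c) h) y := by
  funext y
  rw [nu]
  simp

/-- If the internal vertex is split off above, the external vertex keeps a subword and is grafted
among the remaining children, a `ξ`-term. Splittings below and differentials of children form the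
coderivation of `μ` on the word of children. -/
theorem ev_dL_ext_plain (i : Fin n) (h : PlanarTree n → W) (cs : List (PlanarTree n)) :
    ev (dTerms (.ext i (.edge 0) cs)) h = coder tsign (xiT i) (graft h) cs +
      coder tsign muT (fun y => h (.ext i (.edge 0) y)) cs := by
  rw [ev_dTerms_ext, coder_muT, coder_eq_tri, turnMark, ev_nil, zero_add, add_comm (tri _ _),
    add_assoc]
  congr 1
  · refine tri_congr fun u v z _ => ?_
    simp [Mark.splitAbove, Mark.ones, xiT]
  · rw [add_comm]
    simp only [Mark.ones, sgn_zero, one_smul, one_mul]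
    congr 1
    refine tri_congr fun u v z _ => ?_
    simp [Mark.splitBelow, graft]

/-- The two groups are as for a root-marked vertex, but each is distributed according to the
position of the subword relative to the marked child `x`. Only subwords that contain `x` affect
which letter carries the mark. -/
theorem ev_dL_ext_marked (i : Fin n) (h : PlanarTree n → W) (u : List (PlanarTree n))
    (x : PlanarTree n) (z : List (PlanarTree n)) :
    ev (dTerms (.ext i (.edge (u.length + 1)) (u ++ x :: z))) h =
      (coder tsign (xiT i) (fun y => graft h (y ++ x :: z)) u +
      cut (fun u₁ u₂ => cut (fun z₁ z₂ => wsign tsign u₁ •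
        graft h (u₁ ++ .ext i (.edge (u₂.length + 1)) (u₂ ++ x :: z₁) :: z₂)) z) u +
      (wsign tsign u * tsign x) • coder tsign (xiT i) (fun y => graft h (u ++ x :: y)) z) +
      (coder tsign muT (fun y => h (.ext i (.edge (y.length + 1)) (y ++ x :: z))) u +
      cut (fun u₁ u₂ => cut (fun z₁ z₂ => wsign tsign u₁ • ev (muT (u₂ ++ x :: z₁)) fun t =>
        h (.ext i (.edge (u₁.length + 1)) (u₁ ++ t :: z₂))) z) u +
      (wsign tsign u * tsign x) •
        coder tsign muT (fun y => h (.ext i (.edge (u.length + 1)) (u ++ x :: y))) z) := by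
  rw [ev_dTerms_ext, turnMark, ev_nil, zero_add, ev_dTermsList, coder_append_cons]
  simp only [Mark.ones, sgn_zero, one_smul, one_mul, if_true]
  rw [add_comm (tri _ _), add_assoc]
  congr 1
  · rw [tri_append_cons]
    congr 1
    · congr 1
      · rw [coder_eq_tri]
        refine tri_congr fun a v b hab => ?_
        have : ¬ (a.length < u.length + 1 ∧ u.length + 1 ≤ a.length + v.length) := by
          rw [← hab]; simp only [List.length_append]; omega
        rw [Mark.splitAbove, if_neg this]
        simp [xiT]
      · refine cut_congr fun u₁ u₂ hu => cut_congr fun z₁ z₂ hz => ?_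
        have h1 : u₁.length < u.length + 1 ∧ u.length + 1 ≤
            u₁.length + (u₂ ++ x :: z₁).length := by
          rw [← hu]; simp only [List.length_append, List.length_cons]; omega
        have h2 : u.length + 1 - u₁.length = u₂.length + 1 := by
          rw [← hu]; simp only [List.length_append]; omega
        rw [Mark.splitAbove, if_pos h1, h2]
        rfl
    · rw [coder_eq_tri, ← tri_zsmul]
      refine tri_congr fun a v b hab => ?_
      have : ¬ ((u ++ x :: a).length < u.length + 1 ∧ u.length + 1 ≤
          (u ++ x :: a).length + v.length) := by
        simp only [List.length_append, List.length_cons]; omega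
      rw [Mark.splitAbove, if_neg this]
      simp [xiT, mul_smul]
  · rw [tri_append_cons, coder_muT, coder_muT, ← ev_dTermsList, ← ev_dTermsList]
    have e1 : ev (dTermsList u) (fun y => h (.ext i (.edge (u.length + 1)) (y ++ x :: z))) =
        ev (dTermsList u) fun y => h (.ext i (.edge (y.length + 1)) (y ++ x :: z)) :=
      ev_dTermsList_congr fun y hy => by rw [hy]
    have e2 : cut (fun u₁ u₂ => cut (fun z₁ z₂ => wsign tsign u₁ •
          ev (muT (u₂ ++ x :: z₁)) fun t => h (.ext i (.edge (u₁.length + 1)) (u₁ ++ t :: z₂))) z) u =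
        cut (fun u₁ u₂ => cut (fun z₁ z₂ => wsign tsign u₁ •
          ev (dLetter (u₂ ++ x :: z₁)) fun t => h (.ext i (.edge (u.length + 1)) (u₁ ++ t :: z₂))) z) u +
        cut (fun u₁ u₂ => cut (fun z₁ z₂ => wsign tsign u₁ • graft (fun t =>
          h (.ext i (.edge (u₁.length + 1)) (u₁ ++ t :: z₂))) (u₂ ++ x :: z₁)) z) u := by
      rw [← cut_add]
      refine cut_congr fun u₁ u₂ hu => ?_
      rw [← cut_add]
      refine cut_congr fun z₁ z₂ hz => ?_
      rw [← smul_add, ev_muT, ev_dLetter]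
      rcases u₂ with _ | ⟨a, u₂⟩
      · rw [List.append_nil] at hu
        subst hu
        rfl
      · rcases u₂ with _ | ⟨b, u₂⟩ <;> simp
    rw [e1, e2]
    -- For a subword to the left of the marked child the mark stays on this child, whose number
    -- drops because `v.length` edges are replaced by one.
    have e3 : tri (fun a v b => (Mark.splitBelow a.length v.length (.edge (u.length + 1))).elim 0
          fun m' => wsign tsign a • graft (fun t => h (.ext i m' (a ++ t :: (b ++ x :: z)))) v) u =
        tri (fun a v b => if 2 ≤ v.length then wsign tsign a •
          h (.ext i (.edge ((a ++ PlanarTree.int v :: b).length + 1))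
            (a ++ PlanarTree.int v :: b ++ x :: z)) else 0) u := by
      refine tri_congr fun a v b hab => ?_
      have h1 : ¬ u.length + 1 ≤ a.length := by
        rw [← hab]; simp only [List.length_append]; omega
      have h2 : ¬ u.length + 1 ≤ a.length + v.length := by
        rw [← hab]; simp only [List.length_append]; omega
      have h3 : u.length + 1 + 1 - v.length = (a ++ PlanarTree.int v :: b).length + 1 := by
        rw [← hab]; simp only [List.length_append, List.length_cons]; omega
      rw [Mark.splitBelow, if_neg h1, if_neg h2, h3]
      by_cases h2 : 2 ≤ v.length <;> simp [graft, h2]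
    -- If the marked child is taken over by the internal vertex, the mark moves to the new edge.
    have e4 : cut (fun u₁ u₂ => cut (fun z₁ z₂ =>
          (Mark.splitBelow u₁.length (u₂ ++ x :: z₁).length (.edge (u.length + 1))).elim 0
          fun m' => wsign tsign u₁ • graft (fun t => h (.ext i m' (u₁ ++ t :: z₂)))
            (u₂ ++ x :: z₁)) z) u =
        cut (fun u₁ u₂ => cut (fun z₁ z₂ => wsign tsign u₁ • graft (fun t =>
          h (.ext i (.edge (u₁.length + 1)) (u₁ ++ t :: z₂))) (u₂ ++ x :: z₁)) z) u := by
      refine cut_congr fun u₁ u₂ hu => cut_congr fun z₁ z₂ hz => ?_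
      have h1 : ¬ u.length + 1 ≤ u₁.length := by
        rw [← hu]; simp only [List.length_append]; omega
      have h2 : u.length + 1 ≤ u₁.length + (u₂ ++ x :: z₁).length := by
        rw [← hu]; simp only [List.length_append, List.length_cons]; omega
      rw [Mark.splitBelow, if_neg h1, if_pos h2]
      rfl
    have e5 : tri (fun a v b => (Mark.splitBelow (u ++ x :: a).length v.length
          (.edge (u.length + 1))).elim 0 fun m' => wsign tsign (u ++ x :: a) •
          graft (fun t => h (.ext i m' (u ++ x :: a ++ t :: b))) v) z =
        (wsign tsign u * tsign x) • tri (fun a v b => if 2 ≤ v.length then wsign tsign a •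
          h (.ext i (.edge (u.length + 1)) (u ++ x :: (a ++ PlanarTree.int v :: b))) else 0) z := by
      rw [← tri_zsmul]
      refine tri_congr fun a v b hab => ?_
      have h1 : u.length + 1 ≤ (u ++ x :: a).length := by
        simp only [List.length_append, List.length_cons]; omega
      rw [Mark.splitBelow, if_pos h1]
      by_cases h2 : 2 ≤ v.length <;> simp [graft, h2, mul_smul]
    rw [e3, e4, e5, smul_add]
    abel

/-- Serves `splitBelow` with `𝟙` in the corner between `u` and `z`: splittings strictly across this
corner are zero. The overcounted crossing terms with an empty half then cancel the corrections in
`tri_append`. -/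
theorem tri_append_of_not_across {L : Type*} {F : List L → List L → List L → W} {u z : List L}
    (h0 : ∀ a b, F a [] b = 0)
    (hF : ∀ a v b, a.length < u.length → u.length < a.length + v.length → F a v b = 0) :
    tri F (u ++ z) = tri (fun a v b => F a v (b ++ z)) u + tri (fun a v b => F (u ++ a) v b) z := by
  have h := tri_append F u z
  have h1 : cut (fun u₁ u₂ => cut (fun z₁ z₂ => F u₁ (u₂ ++ z₁) z₂) z) u =
      cut (fun a b => F a b z) u + cut (fun a b => F u a b) z := by
    have e : cut (fun u₁ u₂ => cut (fun z₁ z₂ => F u₁ (u₂ ++ z₁) z₂) z) u =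
        cut (fun u₁ u₂ => cut (fun z₁ z₂ => if z₁ = [] then F u₁ u₂ z₂ else 0) z) u +
        cut (fun u₁ u₂ => if u₂ = [] then cut (fun z₁ z₂ => F u₁ z₁ z₂) z else 0) u := by
      rw [← cut_add]
      refine cut_congr fun u₁ u₂ hu => ?_
      by_cases hu2 : u₂ = []
      · rw [if_pos hu2, ← cut_add]
        refine cut_congr fun z₁ z₂ _ => ?_
        by_cases hz : z₁ = [] <;> simp [hu2, hz, h0]
      · rw [if_neg hu2, add_zero]
        refine cut_congr fun z₁ z₂ _ => ?_
        by_cases hz : z₁ = []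
        · simp [hz]
        · rw [if_neg hz]
          have := List.length_pos_iff.2 hu2
          have := List.length_pos_iff.2 hz
          refine hF _ _ _ ?_ ?_ <;> simp only [← hu, List.length_append] <;> omega
    rw [e]
    simp only [cut_left_nil, cut_right_nil]
  rw [h1] at h
  have h2 : ∀ A B C D E : W, A + B + C = D + (B + C) + E → A = D + E := by
    intro A B C D E h
    refine add_right_cancel (b := B + C) ?_
    rw [← add_assoc, h]
    abel
  exact h2 _ _ _ _ _ h

/-- Serves `splitAbove` with `𝟙` in the corner between `u` and `z`: the vertex must keep a range of
edges that reaches this corner, otherwise `𝟙` would be taken away from it. Of the one-sided terms in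
`tri_append` only those touching the seam survive, and they are the corrections. -/
theorem tri_append_of_across {L : Type*} {F : List L → List L → List L → W} {u z : List L}
    (hF : ∀ a v b, u.length < a.length ∨ a.length + v.length < u.length → F a v b = 0) :
    tri F (u ++ z) = cut (fun u₁ u₂ => cut (fun z₁ z₂ => F u₁ (u₂ ++ z₁) z₂) z) u := by
  have h := tri_append F u z
  have h1 : tri (fun a v b => F a v (b ++ z)) u = cut (fun a b => F a b z) u := by
    rw [tri]
    refine cut_congr fun a y hy => ?_
    rw [← cut_right_nil (fun y => F a y z) y]
    refine cut_congr fun v b hb => ?_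
    by_cases hb' : b = []
    · simp [hb']
    · rw [if_neg hb', hF]
      have := List.length_pos_iff.2 hb'
      right
      simp only [← hy, ← hb, List.length_append]
      omega
  have h2 : tri (fun a v b => F (u ++ a) v b) z = cut (fun a b => F u a b) z := by
    rw [tri, ← cut_left_nil (fun y => cut (fun v b => F u v b) y) z]
    refine cut_congr fun a y hy => ?_
    by_cases ha : a = []
    · simp [ha]
    · rw [if_neg ha]
      refine cut_eq_zero fun v b _ => hF _ _ _ (.inl ?_)
      have := List.length_pos_iff.2 ha
      simp only [List.length_append]
      omega
  rw [h1, h2] at h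
  have h3 : ∀ A B C D : W, A + B + C = B + D + C → A = D := by
    intro A B C D h
    rw [add_comm A B] at h
    exact add_left_cancel (add_right_cancel h)
  exact h3 _ _ _ _ h

/-- The factor in front is the sign in `xi_unit`. The first group will be matched with `ξ` followed
by `μ`, the second with `μ` followed by `ξ`. The two marks from `turnMark` are divided among them: a
mark towards the root comes from multiplying the finished vertex by `𝟙`, a mark on a child from
multiplying this child by `𝟙`. -/
theorem ev_dL_ext_unit (i : Fin n) (h : PlanarTree n → W) (u z : List (PlanarTree n)) :
    wsign tsign u • ev (dTerms (.ext i (.unit u.length) (u ++ z))) h =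
      ((if z = [] then wsign tsign u • h (.ext i (.edge 0) u) else 0) +
      cut (fun u₁ u₂ => cut (fun z₁ z₂ => wsign tsign u •
        graft h (u₁ ++ .ext i (.unit u₂.length) (u₂ ++ z₁) :: z₂)) z) u -
      wsign tsign u • (if u = [] then h (.ext i (.edge 0) z) else 0)) +
      (coder tsign muT (fun y => wsign tsign y • h (.ext i (.unit y.length) (y ++ z))) u +
      (wsign tsign u • (if z = [] then 0 else h (.ext i (.edge (u.length + 1)) (u ++ z))) -
        (if u = [] then 0 else wsign tsign u • h (.ext i (.edge u.length) (u ++ z)))) -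
      wsign tsign u •
        coder tsign muT (fun y => wsign tsign u • h (.ext i (.unit u.length) (u ++ y))) z) := by
  rw [ev_dTerms_ext, ev_dTermsList_append, tri_append_of_not_across, tri_append_of_across]
  rotate_left
  · intro a v b h1
    rw [Mark.splitAbove, if_neg (by omega), Option.elim_none]
  · intro a b
    cases Mark.splitBelow _ _ _ <;> simp [graft]
  · intro a v b h1 h2
    rw [Mark.splitBelow, if_neg (by omega), if_pos (by omega), Option.elim_none]
  simp only [Mark.ones, sgn_one, one_ne_zero, if_false, one_smul]
  -- If no child follows the corner, the cyclically next edge is the one to the root, edge `0`.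
  have e1 : ev (turnMark i (.unit u.length) (u ++ z)) h =
      (if z = [] then h (.ext i (.edge 0) u) else h (.ext i (.edge (u.length + 1)) (u ++ z))) -
      h (.ext i (.edge u.length) (u ++ z)) := by
    by_cases hz : z = []
    · simp [turnMark, hz, sub_eq_add_neg]
    · have : 0 < z.length := List.length_pos_iff.2 hz
      simp [turnMark, hz, sub_eq_add_neg]
  have e2 : cut (fun u₁ u₂ => cut (fun z₁ z₂ =>
      (Mark.splitAbove u₁.length (u₂ ++ z₁).length (.unit u.length)).elim 0 fun m' =>
        graft h (u₁ ++ .ext i m' (u₂ ++ z₁) :: z₂)) z) u =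
      cut (fun u₁ u₂ => cut (fun z₁ z₂ =>
        graft h (u₁ ++ .ext i (.unit u₂.length) (u₂ ++ z₁) :: z₂)) z) u := by
    refine cut_congr fun u₁ u₂ hu => cut_congr fun z₁ z₂ _ => ?_
    have h1 : u₁.length ≤ u.length ∧ u.length ≤ u₁.length + (u₂ ++ z₁).length := by
      simp only [← hu, List.length_append]; omega
    have h2 : u.length - u₁.length = u₂.length := by
      simp only [← hu, List.length_append]; omega
    rw [Mark.splitAbove, if_pos h1, h2]
    rfl
  have e3 : tri (fun a v b => (Mark.splitBelow a.length v.length (.unit u.length)).elim 0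
        fun m' => (-1 * wsign tsign a) • graft (fun t => h (.ext i m' (a ++ t :: (b ++ z)))) v) u =
      wsign tsign u • tri (fun a v b => if 2 ≤ v.length then wsign tsign a •
        (wsign tsign (a ++ PlanarTree.int v :: b) •
          h (.ext i (.unit (a ++ PlanarTree.int v :: b).length) (a ++ PlanarTree.int v :: b ++ z)))
          else 0) u := by
    rw [← tri_zsmul]
    refine tri_congr fun a v b hab => ?_
    by_cases hv : 2 ≤ v.length
    · have h1 : ¬ u.length ≤ a.length := by
        rw [← hab]; simp only [List.length_append]; omega
      have h2 : ¬ u.length < a.length + v.length := by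
        rw [← hab]; simp only [List.length_append]; omega
      have h3 : u.length + 1 - v.length = (a ++ PlanarTree.int v :: b).length := by
        rw [← hab]; simp only [List.length_append, List.length_cons]; omega
      rw [Mark.splitBelow, if_neg h1, if_neg h2, h3, if_pos hv, Option.elim_some, graft, if_pos hv,
        smul_smul, smul_smul, ← hab]
      congr 1
      -- Grafting `v` to an internal vertex reverses the sign of the word `u`, which turns the sign
      -- of the splitting into the sign of the coderivation.
      · simp only [wsign_append, wsign_cons, tsign_int]
        have ha := wsign_mul_self tsign_mul_self a
        have hv := wsign_mul_self tsign_mul_self v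
        have hb := wsign_mul_self tsign_mul_self b
        linear_combination wsign tsign a * (wsign tsign v ^ 2 * wsign tsign b ^ 2 * ha +
          wsign tsign b ^ 2 * hv + hb)
      · simp
    · rw [if_neg hv, smul_zero]
      cases Mark.splitBelow _ _ _ <;> simp [graft, hv]
  have e4 : tri (fun a v b => (Mark.splitBelow (u ++ a).length v.length (.unit u.length)).elim 0
        fun m' => (-1 * wsign tsign (u ++ a)) • graft (fun t => h (.ext i m' (u ++ a ++ t :: b))) v) z =
      -wsign tsign u • tri (fun a v b => if 2 ≤ v.length then wsign tsign a •
        h (.ext i (.unit u.length) (u ++ (a ++ PlanarTree.int v :: b))) else 0) z := by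
    rw [← tri_zsmul]
    refine tri_congr fun a v b hab => ?_
    have h1 : u.length ≤ (u ++ a).length := by simp
    rw [Mark.splitBelow, if_pos h1]
    by_cases hv : 2 ≤ v.length <;> simp [graft, hv, mul_smul]
  -- Every term of the differential on `u` has the opposite word sign.
  have e5 : ev (dTermsList u) (fun y => wsign tsign y • h (.ext i (.unit y.length) (y ++ z))) =
      -wsign tsign u • ev (dTermsList u) fun y => h (.ext i (.unit u.length) (y ++ z)) := by
    rw [← ev_zsmul]
    refine ev_congr fun p hp => ?_
    obtain ⟨a, c, b, rfl, q, hq, hp⟩ := mem_dTermsList hp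
    rw [hp]
    simp [tsign_of_mem_dTerms c q hq]
  rw [e1, e2, e3, e4, coder_zsmul, coder_muT, coder_muT, e5]
  simp only [cut_zsmul]
  have hσ := wsign_mul_self tsign_mul_self u
  generalize (ev (dTermsList z) _ : W) = A
  generalize (ev (dTermsList u) _ : W) = B
  generalize (tri _ u : W) = C
  generalize (tri _ z : W) = D
  generalize (cut _ u : W) = E
  by_cases hu : u = []
  · subst hu
    by_cases hz : z = [] <;> simp [hz] <;> abel
  · by_cases hz : z = [] <;> simp [hu, hz, smul_add, smul_sub, smul_smul, hσ] <;> abel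

/-! ## The differential squares to zero -/

/-- If the new vertex does not contain `𝟙`, a nonzero product with `𝟙` requires that it takes all
letters on one side while the other side is empty. The result is a root-marked vertex as a marked
letter, and these are the extreme terms. -/
theorem coder_xi_nu_unit (i : Fin n) (h : Letter n → W) (u z : List (PlanarTree n)) :
    coder Letter.sign (xi i) (nu h) (plain u ++ .one :: plain z) =
      (if z = [] then wsign tsign u • h (.tree true (.ext i (.edge 0) u)) else 0) +
      cut (fun u₁ u₂ => cut (fun z₁ z₂ => wsign tsign u • graft (fun t => h (.tree true t))
        (u₁ ++ .ext i (.unit u₂.length) (u₂ ++ z₁) :: z₂)) z) u -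
      wsign tsign u • (if u = [] then h (.tree true (.ext i (.edge 0) z)) else 0) := by
  have h3 : coder tsign (xiT i) (fun y => nu h (plain y ++ .one :: plain z)) u =
      if z = [] then wsign tsign u • h (.tree true (.ext i (.edge 0) u)) else 0 := by
    have : coder tsign (xiT i) (fun y => nu h (plain y ++ .one :: plain z)) u =
        coder tsign (xiT i) (if z = [] then sgl (fun t => - (tsign t • h (.tree true t)))
          else fun _ => 0) u := by
      refine coder_congr fun a v b _ p _ => ?_
      rw [nu_unit, if_neg (by simp), zero_sub]
      by_cases hz : z = []
      · rw [if_pos hz, if_pos hz, sgl_append_cons, sgl_append_cons]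
        split_ifs <;> simp
      · simp [hz]
    rw [this]
    by_cases hz : z = []
    · rw [if_pos hz, if_pos hz, coder_sgl]
      simp [xiT, Mark.ones]
    · simp [hz]
  have h4 : coder tsign (xiT i) (fun y => nu h (plain u ++ .one :: plain y)) z =
      if u = [] then h (.tree true (.ext i (.edge 0) z)) else 0 := by
    have : coder tsign (xiT i) (fun y => nu h (plain u ++ .one :: plain y)) z =
        coder tsign (xiT i) (if u = [] then sgl (fun t => h (.tree true t))
          else fun _ => 0) z := by
      refine coder_congr fun a v b _ p _ => ?_
      rw [nu_unit, if_neg (c := a ++ p.2 :: b = []) (by simp), sub_zero]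
      split_ifs <;> rfl
    rw [this]
    by_cases hu : u = []
    · rw [if_pos hu, if_pos hu, coder_sgl]
      simp [xiT]
    · simp [hu]
  rw [coder_xi_unit, h3, h4]
  simp only [nu_marked]

/-- `μ` on the single letter `ξ_i(w)` is minus the differential of an external vertex. The other
terms are exactly the splittings, the differentials of children and the turned marks, by the three
formulas for `d` above. Nothing about `d²` enters, which makes the induction for `d² = 0` possible.
-/
theorem xi_relation (i : Fin n) {w : List (Letter n)} (hw : weight w ≤ 1) (h : Letter n → W) :
    coder Letter.sign (xi i) (fun y => ev (mu y) h) w +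
      coder Letter.sign mu (fun y => ev (xi i y) h) w = 0 := by
  rw [ev_mu_eq, coder_add, coder_zsmul, coder_sgl]
  obtain ⟨cs, rfl⟩ | ⟨u, x, z, rfl⟩ | ⟨u, z, rfl⟩ := weight_le_one_cases hw
  · rw [coder_xi_plain, coder_mu_plain, xi_plain]
    simp only [nu_plain, xi_plain]
    simp only [ev_cons, ev_nil, one_smul, add_zero, dL]
    rw [ev_map_snd, ev_dL_ext_plain]
    simp only [neg_one_zsmul]
    abel
  · rw [coder_xi_marked, coder_mu_marked, xi_marked]
    simp only [nu_marked, xi_marked]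
    simp only [ev_cons, ev_nil, one_smul, add_zero, dL]
    rw [ev_map_snd, ev_dL_ext_marked]
    simp only [neg_one_zsmul]
    abel
  · rw [coder_xi_nu_unit, coder_mu_unit _ (fun u t z => h (.tree true (.ext i (.edge (u.length + 1))
      (u ++ t :: z)))) _ _ (fun u t z => by rw [xi_marked]; simp), xi_unit]
    have h1 := cut_sgl_head (fun y => h (.tree true (.ext i (.edge (u.length + 1)) (u ++ y)))) z
    have h2 := cut_sgl_last (fun u => wsign tsign u •
      h (.tree true (.ext i (.edge u.length) (u ++ z)))) u
    simp only [wsign_append, wsign_cons, wsign_nil, mul_one, List.append_assoc, List.cons_append,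
      List.nil_append, List.length_append, List.length_cons, List.length_nil, zero_add] at h2
    rw [h1, h2]
    simp only [xi_unit]
    simp only [ev_cons, ev_nil, add_zero, dL]
    rw [ev_map_snd, ev_dL_ext_unit]
    simp only [neg_one_zsmul]
    abel

theorem weight_tree_decide (w : List (Letter n)) (t : PlanarTree n) (z : List (Letter n)) :
    weight (.tree (decide (weight w ≠ 0)) t :: z) ≤ weight w + weight z := by
  by_cases h : weight w = 0
  · simp [h]
  · simp only [ne_eq, h, not_false_eq_true, decide_true, weight_true_cons]
    omega

/-- Operations do not create decorations, so the words with at most one decoration are closed under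
all coderivations in use. -/
theorem weight_le_of_mem_mu {w : List (Letter n)} {p : ℤ × Letter n} (hp : p ∈ mu w)
    (z : List (Letter n)) : weight (p.2 :: z) ≤ weight w + weight z := by
  unfold mu at hp
  split at hp
  · simp only [List.mem_singleton] at hp
    subst hp
    simp [add_comm]
  · simp only [List.mem_singleton] at hp
    subst hp
    simp [add_comm]
  · split_ifs at hp
    · simp at hp
    · simp only [List.mem_map] at hp
      obtain ⟨q, -, rfl⟩ := hp
      exact weight_tree_decide _ _ _

theorem weight_le_of_mem_xi {i : Fin n} {w : List (Letter n)} {p : ℤ × Letter n}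
    (hp : p ∈ xi i w) (z : List (Letter n)) : weight (p.2 :: z) ≤ weight w + weight z := by
  rw [xi] at hp
  split_ifs at hp
  · simp only [List.mem_singleton] at hp
    subst hp
    exact weight_tree_decide _ _ _
  · simp at hp

theorem coder_mu_congr {g g' : List (Letter n) → W} {w : List (Letter n)} (hw : weight w ≤ 1)
    (H : ∀ y, weight y ≤ 1 → g y = g' y) :
    coder Letter.sign mu g w = coder Letter.sign mu g' w := by
  refine coder_congr fun u v z h p hp => H _ ?_
  have := weight_le_of_mem_mu hp z
  rw [← h] at hw
  simp only [weight_append] at *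
  omega

theorem mu_xi_anticomm (i : Fin n) {w : List (Letter n)} (hw : weight w ≤ 1)
    (g : List (Letter n) → W) : coder Letter.sign (xi i) (coder Letter.sign mu g) w +
      coder Letter.sign mu (coder Letter.sign (xi i) g) w = 0 := by
  refine coder_anticomm Letter.sign_mul_self sign_of_mem_mu (sign_of_mem_xi i) w ?_ g
  intro u v z h k
  refine xi_relation i ?_ k
  rw [← h] at hw
  simp only [weight_append] at hw
  omega

/-- Two sign changes: an operator that anticommutes with `μ` commutes with `μ²`. -/
theorem xi_mu_mu (i : Fin n) {w : List (Letter n)} (hw : weight w ≤ 1)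
    (g : List (Letter n) → W) :
    coder Letter.sign (xi i) (coder Letter.sign mu (coder Letter.sign mu g)) w =
      coder Letter.sign mu (coder Letter.sign mu (coder Letter.sign (xi i) g)) w := by
  rw [eq_neg_of_add_eq_zero_left (mu_xi_anticomm i hw (coder Letter.sign mu g)),
    coder_mu_congr (g' := fun y => - coder Letter.sign mu (coder Letter.sign (xi i) g) y) hw
      fun y hy => eq_neg_of_add_eq_zero_left (mu_xi_anticomm i hy g), coder_neg, neg_neg]

theorem mu_sq {w : List (Letter n)} (hw : weight w ≤ 1) (hg : ∀ t ∈ forget w, SquareZero W t)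
    (g : List (Letter n) → W) : coder Letter.sign mu (coder Letter.sign mu g) w = 0 := by
  refine coder_sq Letter.sign_mul_self sign_of_mem_mu w ?_ g
  intro u v z h k
  rw [← h] at hw hg
  refine mu_relation ?_ ?_ k
  · simp only [weight_append] at hw
    omega
  · exact fun t ht => hg t (by simp [ht])

theorem ev_mu_tree (b : Bool) (t : PlanarTree n) (h : Letter n → W) :
    ev (mu [.tree b t]) h = - ev (dTerms t) fun t' => h (.tree b t') := by
  cases b
  · have := ev_mu_plain [t] h
    rw [plain_cons, plain_nil] at this
    rw [this, muT, ev_dLetter, sgl_singleton]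
  · have := ev_mu_marked [] t [] h
    simp only [plain_nil, List.nil_append] at this
    rw [this, muT, ev_dLetter, sgl_singleton]

theorem coder_mu_tree (g : List (Letter n) → W) (b : Bool) (t : PlanarTree n) :
    coder Letter.sign mu g [.tree b t] = - ev (dTerms t) fun t' => g [.tree b t'] := by
  have h : mu ([] : List (Letter n)) = [] := by simp [mu, muT, forget]
  rw [coder_cons, coder_nil, pre, cut_cons, pre, cut_nil, cut_nil, ev_mu_tree, h]
  simp

theorem xi_eq_singleton (i : Fin n) {w : List (Letter n)} (hw : weight w ≤ 1) :
    ∃ a b t, xi i w = [(a, .tree b t)] ∧ a * a = 1 := by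
  have hs (u : List (PlanarTree n)) := wsign_mul_self tsign_mul_self u
  obtain ⟨cs, rfl⟩ | ⟨u, x, z, rfl⟩ | ⟨u, z, rfl⟩ := weight_le_one_cases hw
  · exact ⟨_, _, _, xi_plain i cs, one_mul 1⟩
  · exact ⟨_, _, _, xi_marked i u x z, one_mul 1⟩
  · exact ⟨_, _, _, xi_unit i u z, hs u⟩

theorem eq_zero_of_sign_smul {a : ℤ} (ha : a * a = 1) {x : W} (h : a • x = 0) : x = 0 := by
  rw [← one_smul ℤ x, ← ha, mul_smul, h, smul_zero]

/-- If an operator annihilates the words that arise by inserting an external vertex, except possibly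
the one in which the vertex takes all letters, then it annihilates also this one. -/
theorem annihilate_of_coder_xi {i : Fin n} {w : List (Letter n)} (hw : weight w ≤ 1)
    (g : List (Letter n) → W) (h : coder Letter.sign (xi i) g w = 0)
    (H : ∀ u v z, u ++ (v ++ z) = w → v.length < w.length → ∀ p ∈ xi i v,
      g (u ++ p.2 :: z) = 0) : ∀ p ∈ xi i w, g [p.2] = 0 := by
  have h1 : coder Letter.sign (xi i) g w = ev (xi i w) fun c => g [c] := by
    rw [coder_eq_tri, ← tri_full (fun v => ev (xi i v) fun c => g [c]) w]
    refine tri_congr fun u v z huvz => ?_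
    by_cases hu : u = [] ∧ z = []
    · simp [hu.1, hu.2]
    · rw [if_neg hu, ev_congr (h' := fun _ => 0), ev_zero, smul_zero]
      refine H u v z huvz ?_
      rw [← huvz]
      simp only [List.length_append]
      rw [not_and_or] at hu
      rcases hu with hu | hu <;> have := List.length_pos_iff.2 hu <;> omega
  obtain ⟨a, b, t, hx, ha⟩ := xi_eq_singleton i hw
  rw [h1, hx, ev_cons, ev_nil, add_zero] at h
  rw [hx]
  simpa using eq_zero_of_sign_smul ha h

/-- Induction over the length of `w`. Since `ξ_i` commutes with `μ²`, which annihilates `w`, the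
insertions of the vertex into `w` sum to something annihilated by `μ²`; all of them except `ξ_i(w)`
are known to be annihilated already. -/
theorem squareZero_of_mem_xi (i : Fin n) {w : List (Letter n)} (hw : weight w ≤ 1)
    (hg : ∀ t ∈ forget w, SquareZero W t) : ∀ p ∈ xi i w, ∀ t ∈ forget [p.2], SquareZero W t := by
  induction hl : w.length using Nat.strong_induction_on generalizing w with
  | _ l ih =>
  subst hl
  intro p hp t ht h
  -- The test function reads only words of one letter and evaluates `h` on its tree, so that `μ²` on
  -- a letter becomes `d²`.
  have key : ∀ p ∈ xi i w, coder Letter.sign mu (coder Letter.sign mu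
      (sgl fun c => sgl h (forget [c]))) [p.2] = 0 := by
    refine annihilate_of_coder_xi hw _ ?_ ?_
    · rw [xi_mu_mu i hw, mu_sq hw hg]
    · intro u v z huvz hv q hq
      rw [← huvz] at hw hg
      simp only [weight_append] at hw
      refine mu_sq ?_ ?_ _
      · have := weight_le_of_mem_xi hq z
        simp only [weight_append]
        omega
      · intro t' ht'
        have : u ++ q.2 :: z = u ++ ([q.2] ++ z) := rfl
        rw [this] at ht'
        simp only [forget_append, List.mem_append] at ht' hg
        rcases ht' with ht' | ht' | ht'
        · exact hg t' (.inl ht')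
        -- The inserted vertex carries the word `v`, which is shorter than `w`.
        · exact ih v.length hv (by omega) (fun t'' h'' => hg t'' (.inr (.inl h''))) rfl q hq t' ht'
        · exact hg t' (.inr (.inr ht'))
  obtain ⟨a, b, t', hx, ha⟩ := xi_eq_singleton i hw
  have := key p hp
  rw [hx, List.mem_singleton] at hp
  subst hp
  simp only [forget_tree_cons, forget_nil, List.mem_singleton] at ht
  subst ht
  rw [coder_mu_tree] at this
  simp only [coder_mu_tree] at this
  rw [ev_neg, neg_neg] at this
  simpa using this

theorem squareZero_int {cs : List (PlanarTree n)} (hcs : 2 ≤ cs.length)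
    (hg : ∀ t ∈ cs, SquareZero W t) : SquareZero W (.int cs) := by
  intro h
  rw [ev_dTerms_int _ hcs, graft_ev_dTerms]
  refine coder_sq tsign_mul_self tsign_of_mem_muT cs ?_ _
  intro u v z huvz k
  refine muT_relation (fun t ht => hg t ?_) k
  rw [← huvz]
  simp [ht]

/-- A well-formed external vertex is described by a decorated word. -/
theorem exists_xi_eq (i : Fin n) {m : Mark} {cs : List (PlanarTree n)} (hm : m.InRange cs.length) :
    ∃ w, weight w ≤ 1 ∧ forget w = cs ∧ ∃ a b, xi i w = [(a, .tree b (.ext i m cs))] := by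
  cases m with
  | edge j =>
    cases j with
    | zero => exact ⟨plain cs, by simp, by simp, _, _, xi_plain i cs⟩
    | succ j =>
      simp only [Mark.InRange] at hm
      have h := List.take_append_drop j cs
      rw [List.drop_eq_getElem_cons (by omega)] at h
      refine ⟨plain (cs.take j) ++ .tree true cs[j] :: plain (cs.drop (j + 1)), by simp, by simp,
        1, true, ?_⟩
      rw [xi_marked, List.length_take, min_eq_left (by omega), h]
  | unit j =>
    simp only [Mark.InRange] at hm
    refine ⟨plain (cs.take j) ++ .one :: plain (cs.drop j), by simp, by simp,
        wsign tsign (cs.take j), true, ?_⟩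
    rw [xi_unit, List.length_take, min_eq_left hm, List.take_append_drop]

theorem squareZero_of_wellFormed {t : PlanarTree n} (ht : WellFormed t) : SquareZero W t := by
  induction t using PlanarTree.induction with
  | ext i m cs ih =>
    simp only [WellFormed, wellFormedList_iff] at ht
    obtain ⟨w, hw, rfl, a, b, hx⟩ := exists_xi_eq i ht.1
    refine squareZero_of_mem_xi i hw (fun t h => ih t h (ht.2 t h)) _ (by rw [hx]; simp; rfl) _
      (by simp)
  | int cs ih =>
    simp only [WellFormed, wellFormedList_iff] at ht
    exact squareZero_int ht.1 fun t h => ih t h (ht.2 t h)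

/-! ## Inserting the edge to `𝟙` at a vertex -/

mutual
/-- The signed list of the trees that arise by placing an edge to `𝟙` in some corner of a vertex with
label `i` that is marked in the direction of the root; the new edge comes first. -/
def unitTerms (i : Fin n) : PlanarTree n → List (ℤ × PlanarTree n)
  | .ext j m cs =>
      (match m with
        | .edge 0 => if j = i then (List.range (cs.length + 1)).map fun l => (1, .ext j (.unit l) cs)
            else []
        | _ => []) ++
      (unitTermsList i cs).map fun p => (sgn m.ones * p.1, .ext j m p.2)
  | .int cs => (unitTermsList i cs).map fun p => (p.1, .int p.2)
/-- `unitTerms` for a forest that is grafted to a vertex. -/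
def unitTermsList (i : Fin n) : List (PlanarTree n) → List (ℤ × List (PlanarTree n))
  | [] => []
  | c :: cs =>
      (unitTerms i c).map (fun p => (-p.1, p.2 :: cs)) ++
        (unitTermsList i cs).map fun p => (sgn (1 + numEdges c) * p.1, c :: p.2)
end

theorem mem_unitTermsList {i : Fin n} {cs : List (PlanarTree n)} {p : ℤ × List (PlanarTree n)}
    (hp : p ∈ unitTermsList i cs) :
    ∃ u c z, cs = u ++ c :: z ∧ ∃ q ∈ unitTerms i c, p.2 = u ++ q.2 :: z := by
  induction cs generalizing p with
  | nil => simp [unitTermsList] at hp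
  | cons c cs ih =>
    simp only [unitTermsList, List.mem_append, List.mem_map] at hp
    rcases hp with ⟨q, hq, rfl⟩ | ⟨q, hq, rfl⟩
    · exact ⟨[], c, cs, rfl, q, hq, rfl⟩
    · obtain ⟨u, c', z, rfl, r, hr, hqr⟩ := ih hq
      exact ⟨c :: u, c', z, rfl, r, hr, by simp [hqr]⟩

/-- A relation holds between a tree and the trees with a new edge to `𝟙` if it holds for insertions
at the root vertex and is compatible with grafting. -/
theorem unitTerms_induction {R : PlanarTree n → PlanarTree n → Prop} (i : Fin n)
    (insert : ∀ l cs, l ≤ cs.length → R (.ext i (.edge 0) cs) (.ext i (.unit l) cs))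
    (ext : ∀ i m u c c' z, R c c' → R (.ext i m (u ++ c :: z)) (.ext i m (u ++ c' :: z)))
    (int : ∀ u c c' z, R c c' → R (.int (u ++ c :: z)) (.int (u ++ c' :: z)))
    (t : PlanarTree n) : ∀ p ∈ unitTerms i t, R t p.2 := by
  induction t using PlanarTree.induction with
  | ext j m cs ih =>
    intro p hp
    simp only [unitTerms, List.mem_append, List.mem_map] at hp
    rcases hp with hp | ⟨q, hq, rfl⟩
    · split at hp
      · split_ifs at hp with hj
        · subst hj
          simp only [List.mem_map, List.mem_range] at hp
          obtain ⟨l, hl, rfl⟩ := hp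
          exact insert l cs (by omega)
        · simp at hp
      · simp at hp
    · obtain ⟨u, c, z, rfl, r, hr, hq⟩ := mem_unitTermsList hq
      dsimp only
      rw [hq]
      exact ext _ _ _ _ _ _ (ih c (by simp) r hr)
  | int cs ih =>
    intro p hp
    simp only [unitTerms, List.mem_map] at hp
    obtain ⟨q, hq, rfl⟩ := hp
    obtain ⟨u, c, z, rfl, r, hr, hq⟩ := mem_unitTermsList hq
    dsimp only
    rw [hq]
    exact int _ _ _ _ (ih c (by simp) r hr)

theorem tsign_of_mem_unitTerms (i : Fin n) (t : PlanarTree n) :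
    ∀ p ∈ unitTerms i t, tsign p.2 = - tsign t := by
  refine unitTerms_induction (R := fun t t' => tsign t' = - tsign t) i ?_ ?_ ?_ t
  · intro l cs _
    simp [Mark.ones]
  · intro i m u c c' z h
    simp [h]
  · intro u c c' z h
    simp [h]

/-- Inserting an edge to `𝟙` in a word of length one. -/
def unitLetterT (i : Fin n) : List (PlanarTree n) → List (ℤ × PlanarTree n)
  | [t] => (unitTerms i t).map fun p => (-1 * p.1, p.2)
  | _ => []

/-- Inserting an edge to `𝟙` in a decorated word of length one. -/
def unitLetter (i : Fin n) : List (Letter n) → List (ℤ × Letter n)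
  | [.tree b t] => (unitTerms i t).map fun p => (-1 * p.1, .tree b p.2)
  | _ => []

/-- If only single letters are replaced, the coderivation is a signed derivation for concatenation.
-/
theorem coder_cons_of_letter {L : Type*} (s : L → ℤ) {φ : List L → List (ℤ × L)}
    (h0 : φ [] = []) (h2 : ∀ a b v, φ (a :: b :: v) = []) (g : List L → W) (c : L) (w : List L) :
    coder s φ g (c :: w) = ev (φ [c]) (fun c' => g (c' :: w)) +
      s c • coder s φ (fun y => g (c :: y)) w := by
  rw [coder_cons, pre, cut_cons, h0, ev_nil, zero_add,
    ← cut_left_nil (fun y => ev (φ [c]) fun c' => g (c' :: y)) w]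
  congr 1
  refine cut_congr fun v z _ => ?_
  cases v <;> simp [h2]

theorem coder_append_of_letter {L : Type*} (s : L → ℤ) {φ : List L → List (ℤ × L)}
    (h0 : φ [] = []) (h2 : ∀ a b v, φ (a :: b :: v) = []) (g : List L → W) (u z : List L) :
    coder s φ g (u ++ z) = coder s φ (fun y => g (y ++ z)) u +
      wsign s u • coder s φ (fun y => g (u ++ y)) z := by
  induction u generalizing g with
  | nil => simp [coder_nil, pre, h0]
  | cons c u ih =>
    rw [List.cons_append, coder_cons_of_letter s h0 h2, coder_cons_of_letter s h0 h2, ih, smul_add,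
      smul_smul, wsign_cons, add_assoc]
    rfl

theorem ev_unitLetterT (i : Fin n) (v : List (PlanarTree n)) (h : PlanarTree n → W) :
    ev (unitLetterT i v) h = - sgl (fun t => ev (unitTerms i t) h) v := by
  match v with
  | [] => simp [unitLetterT]
  | [t] => rw [unitLetterT, ev_map _ (-1) (fun x => x)]; simp
  | c :: c' :: cs => simp [unitLetterT]

theorem ev_unitLetter_tree (i : Fin n) (b : Bool) (t : PlanarTree n) (h : Letter n → W) :
    ev (unitLetter i [.tree b t]) h = - ev (unitTerms i t) fun t' => h (.tree b t') := by
  rw [unitLetter, ev_map _ (-1) (fun x => Letter.tree b x)]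
  simp

/-- Inserting an edge to `𝟙` at a letter. -/
def unitL (i : Fin n) : Letter n → List (ℤ × Letter n)
  | .tree b t => (unitTerms i t).map fun p => (p.1, .tree b p.2)
  | .one => []

theorem ev_unitLetter (i : Fin n) (v : List (Letter n)) (h : Letter n → W) :
    ev (unitLetter i v) h = (-1 : ℤ) • sgl (fun c => ev (unitL i c) h) v := by
  match v with
  | [] => simp [unitLetter]
  | [.tree b t] => rw [ev_unitLetter_tree]; simp [unitL, ev_map_snd]
  | [.one] => simp [unitLetter, unitL]
  | c :: c' :: cs => simp [unitLetter]

theorem tsign_of_mem_unitLetterT (i : Fin n) (v : List (PlanarTree n)) :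
    ∀ p ∈ unitLetterT i v, tsign p.2 = - wsign tsign v := by
  match v with
  | [] => simp [unitLetterT]
  | [t] =>
    simp only [unitLetterT, List.mem_map]
    rintro p ⟨q, hq, rfl⟩
    simpa using tsign_of_mem_unitTerms i t q hq
  | c :: c' :: cs => simp [unitLetterT]

theorem sign_of_mem_unitLetter (i : Fin n) (v : List (Letter n)) :
    ∀ p ∈ unitLetter i v, p.2.sign = - wsign Letter.sign v := by
  match v with
  | [] => simp [unitLetter]
  | [.tree b t] =>
    simp only [unitLetter, List.mem_map]
    rintro p ⟨q, hq, rfl⟩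
    simpa [Letter.sign] using tsign_of_mem_unitTerms i t q hq
  | [.one] => simp [unitLetter]
  | c :: c' :: cs => simp [unitLetter]

theorem ev_unitTermsList (i : Fin n) (cs : List (PlanarTree n)) (g : List (PlanarTree n) → W) :
    ev (unitTermsList i cs) g = coder tsign (unitLetterT i) g cs := by
  induction cs generalizing g with
  | nil => simp [unitTermsList, coder_nil, pre, unitLetterT]
  | cons c cs ih =>
    have h1 : (fun p : ℤ × PlanarTree n => (-p.1, p.2 :: cs)) = fun p => (-1 * p.1, p.2 :: cs) := by
      simp
    rw [unitTermsList, ev_append, h1, ev_map _ (-1) (fun t => t :: cs),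
      ev_map _ _ (fun t => c :: t), ih, coder_cons_of_letter _ rfl (fun _ _ _ => rfl),
      ev_unitLetterT]
    simp [tsign]

theorem coder_unitLetter_plain (i : Fin n) (g : List (Letter n) → W) (cs : List (PlanarTree n)) :
    coder Letter.sign (unitLetter i) g (plain cs) =
      coder tsign (unitLetterT i) (fun y => g (plain y)) cs := by
  induction cs generalizing g with
  | nil => simp [coder_nil, pre, unitLetterT, unitLetter]
  | cons c cs ih =>
    rw [plain_cons, coder_cons_of_letter _ rfl (fun _ _ _ => by simp [unitLetter]),
      coder_cons_of_letter _ rfl (fun _ _ _ => rfl), ih, ev_unitLetter_tree, ev_unitLetterT]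
    rfl

theorem coder_unitLetter_special (i : Fin n) (g : List (Letter n) → W) (u : List (PlanarTree n))
    (c : Letter n) (z : List (PlanarTree n)) :
    coder Letter.sign (unitLetter i) g (plain u ++ c :: plain z) =
      coder tsign (unitLetterT i) (fun y => g (plain y ++ c :: plain z)) u +
      wsign tsign u • (ev (unitLetter i [c]) (fun c' => g (plain u ++ c' :: plain z)) +
        c.sign • coder tsign (unitLetterT i) (fun y => g (plain u ++ c :: plain y)) z) := by
  rw [coder_append_of_letter _ rfl (fun _ _ _ => by simp [unitLetter]),
    coder_cons_of_letter _ rfl (fun _ _ _ => by simp [unitLetter]), coder_unitLetter_plain,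
    coder_unitLetter_plain, wsign_plain]

theorem coder_unitLetterT_append_cons (i : Fin n) (g : List (PlanarTree n) → W)
    (u : List (PlanarTree n)) (x : PlanarTree n) (z : List (PlanarTree n)) :
    coder tsign (unitLetterT i) g (u ++ x :: z) =
      coder tsign (unitLetterT i) (fun y => g (y ++ x :: z)) u +
      wsign tsign u • (ev (unitLetterT i [x]) (fun c' => g (u ++ c' :: z)) +
        tsign x • coder tsign (unitLetterT i) (fun y => g (u ++ x :: y)) z) := by
  rw [coder_append_of_letter _ rfl (fun _ _ _ => rfl),
    coder_cons_of_letter _ rfl (fun _ _ _ => rfl)]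

/-! ## Inserting the edge to `𝟙` anticommutes with the differential -/

/-- Inserting an edge to `𝟙` at the vertex `i` anticommutes with the differential on `t`. -/
def UnitAnticomm (W : Type*) [AddCommGroup W] (i : Fin n) (t : PlanarTree n) : Prop :=
  ∀ h : PlanarTree n → W, ev (dTerms t) (fun t' => ev (unitTerms i t') h) +
    ev (unitTerms i t) (fun t' => ev (dTerms t') h) = 0

theorem coder_unitLetterT_graft_of_lt (i : Fin n) (h : PlanarTree n → W) {cs : List (PlanarTree n)}
    (hcs : cs.length < 2) : coder tsign (unitLetterT i) (graft h) cs = 0 := by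
  match cs, hcs with
  | [], _ => simp [coder_nil, pre, unitLetterT]
  | [t], _ =>
    rw [coder_cons_of_letter _ rfl (fun _ _ _ => rfl), coder_nil]
    simp [graft, pre, unitLetterT]

theorem graft_ev_unitTerms (i : Fin n) (h : PlanarTree n → W) :
    graft (fun t => ev (unitTerms i t) h) = coder tsign (unitLetterT i) (graft h) := by
  funext cs
  by_cases hcs : 2 ≤ cs.length
  · rw [graft, if_pos hcs, unitTerms, ev_map_snd, ← ev_unitTermsList]
    refine ev_congr fun p hp => ?_
    obtain ⟨u, c, z, rfl, q, -, hq⟩ := mem_unitTermsList hp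
    rw [graft, if_pos]
    rw [hq]
    simpa using hcs
  · rw [graft, if_neg hcs, coder_unitLetterT_graft_of_lt i h (by omega)]

/-- The insertion passes through a graft to an internal vertex, so words of length at least two give
nothing. On one letter the relation is the hypothesis. -/
theorem muT_unitLetterT_relation (i : Fin n) {cs : List (PlanarTree n)}
    (hcs : ∀ t ∈ cs, UnitAnticomm W i t) (h : PlanarTree n → W) :
    coder tsign (unitLetterT i) (fun y => ev (muT y) h) cs +
      coder tsign muT (fun y => ev (unitLetterT i y) h) cs = 0 := by
  simp only [ev_unitLetterT, ev_muT]
  rw [coder_add, coder_neg, coder_neg, coder_sgl, coder_sgl, ev_muT, graft_ev_unitTerms,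
    ev_unitLetterT]
  match cs, hcs with
  | [], _ => simp
  | [t], hcs =>
    have := hcs t (by simp) h
    rw [coder_unitLetterT_graft_of_lt i h (by simp)]
    simpa [add_comm] using this
  | c :: c' :: cs, _ => simp

/-- A mark is not affected by an insertion elsewhere, which reduces the first cases to
`muT_unitLetterT_relation`. A product with `𝟙` merely marks the other letter; inserting before or
after this product differs by the sign of an odd operation. -/
theorem mu_unitLetter_relation (i : Fin n) {w : List (Letter n)} (hw : weight w ≤ 1)
    (hg : ∀ t ∈ forget w, UnitAnticomm W i t) (h : Letter n → W) :
    coder Letter.sign (unitLetter i) (fun y => ev (mu y) h) w +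
      coder Letter.sign mu (fun y => ev (unitLetter i y) h) w = 0 := by
  obtain ⟨cs, rfl⟩ | ⟨u, x, z, rfl⟩ | ⟨u, z, rfl⟩ := weight_le_one_cases hw
  · have := muT_unitLetterT_relation i (cs := cs) (by simpa using hg) fun t => h (.tree false t)
    rw [← this, coder_unitLetter_plain, coder_mu_plain]
    simp only [ev_mu_plain]
    congr 2
    funext y
    rw [ev_unitLetter, ev_unitLetterT]
    rcases y with _ | ⟨a, _ | ⟨b, y⟩⟩ <;> simp [unitL, ev_map_snd]
  · have := muT_unitLetterT_relation i (cs := u ++ x :: z) (by simpa using hg)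
      fun t => h (.tree true t)
    rw [← this, coder_unitLetter_special, coder_unitLetterT_append_cons]
    simp only [ev_mu_marked, ev_unitLetter_tree, ev_unitLetterT, sgl_singleton]
    congr 1
    simp only [ev_unitLetter]
    rw [coder_zsmul, coder_neg, coder_sgl, coder_sgl, ev_mu_marked]
    simp [unitL, ev_map_snd]
  · rw [coder_unitLetter_special]
    simp only [ev_unitLetter]
    rw [coder_zsmul, coder_sgl, ev_mu_unit]
    have h1 : Letter.sign (.one : Letter n) = -1 := rfl
    have h2 : coder tsign (unitLetterT i) (fun y => ev (mu (plain y ++ .one :: plain z)) h) u =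
        if z = [] then wsign tsign u • ev (unitLetterT i u) (fun t => h (.tree true t)) else 0 := by
      have : coder tsign (unitLetterT i) (fun y => ev (mu (plain y ++ .one :: plain z)) h) u =
          coder tsign (unitLetterT i) (if z = [] then sgl (fun t => - (tsign t • h (.tree true t)))
            else fun _ => 0) u := by
        refine coder_congr fun a v b _ p _ => ?_
        rw [ev_mu_unit, if_neg (by simp), zero_sub]
        by_cases hz : z = []
        · rw [if_pos hz, if_pos hz, sgl_append_cons, sgl_append_cons]
          split_ifs <;> simp
        · simp [hz]
      rw [this]
      by_cases hz : z = []
      · rw [if_pos hz, if_pos hz, coder_sgl, ← ev_zsmul]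
        refine ev_congr fun p hp => ?_
        rw [tsign_of_mem_unitLetterT i u p hp, neg_smul, neg_neg]
      · simp [hz]
    have h3 : coder tsign (unitLetterT i) (fun y => ev (mu (plain u ++ .one :: plain y)) h) z =
        if u = [] then ev (unitLetterT i z) (fun t => h (.tree true t)) else 0 := by
      have : coder tsign (unitLetterT i) (fun y => ev (mu (plain u ++ .one :: plain y)) h) z =
          coder tsign (unitLetterT i) (if u = [] then sgl (fun t => h (.tree true t))
            else fun _ => 0) z := by
        refine coder_congr fun a v b _ p _ => ?_
        rw [ev_mu_unit, if_neg (c := a ++ p.2 :: b = []) (by simp), sub_zero]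
        split_ifs <;> rfl
      rw [this]
      by_cases hu : u = []
      · rw [if_pos hu, if_pos hu, coder_sgl]
      · simp [hu]
    rw [h1, h2, h3, ev_unitLetterT, ev_unitLetterT]
    have h4 : ∀ y : List (PlanarTree n), sgl (fun t => ev (unitTerms i t) fun t' =>
        h (.tree true t')) y = sgl (fun t => ev (unitL i (.tree true t)) h) y := by
      intro y
      simp only [unitL, ev_map_snd]
    have h5 : ∀ y : List (PlanarTree n), sgl (fun t => tsign t • ev (unitL i (.tree true t)) h) y =
        wsign tsign y • sgl (fun t => ev (unitTerms i t) fun t' => h (.tree true t')) y := by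
      intro y
      rcases y with _ | ⟨a, _ | ⟨b, y⟩⟩ <;> simp [unitL, ev_map_snd]
    rw [← h4, h5]
    by_cases hu : u = [] <;> by_cases hz : z = [] <;>
      simp [hu, hz, unitL, smul_smul]

theorem ev_unitTerms_ext_of_ne {i j : Fin n} (hij : j ≠ i) (m : Mark) (cs : List (PlanarTree n))
    (h : PlanarTree n → W) : ev (unitTerms i (.ext j m cs)) h =
      sgn m.ones • coder tsign (unitLetterT i) (fun y => h (.ext j m y)) cs := by
  have : unitTerms i (.ext j m cs) =
      (unitTermsList i cs).map fun p => (sgn m.ones * p.1, .ext j m p.2) := by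
    rcases m with (_ | k) | k <;> simp [unitTerms, hij]
  rw [this, ev_map _ _ (fun y => PlanarTree.ext j m y), ev_unitTermsList]

/-- Insertion into a word keeps its length and reverses its sign. This lets mark positions and signs
of the varying word be replaced by those of `u`. -/
theorem coder_unitLetterT_congr {i : Fin n} {g g' : List (PlanarTree n) → W}
    {u : List (PlanarTree n)}
    (H : ∀ y, y.length = u.length → wsign tsign y = - wsign tsign u → g y = g' y) :
    coder tsign (unitLetterT i) g u = coder tsign (unitLetterT i) g' u := by
  rw [← ev_unitTermsList, ← ev_unitTermsList]
  refine ev_congr fun p hp => ?_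
  obtain ⟨a, c, b, rfl, q, hq, hp⟩ := mem_unitTermsList hp
  rw [hp]
  exact H _ (by simp) (by simp [tsign_of_mem_unitTerms i c q hq])

/-- As `j ≠ i`, nothing is inserted at the vertex that `ξ_j` creates, so the insertion takes place
among its children, before or after the vertex is formed. -/
theorem xi_unitLetter_relation {i j : Fin n} (hij : j ≠ i) {w : List (Letter n)}
    (hw : weight w ≤ 1) (h : Letter n → W) :
    coder Letter.sign (xi j) (fun y => ev (unitLetter i y) h) w +
      coder Letter.sign (unitLetter i) (fun y => ev (xi j y) h) w = 0 := by
  simp only [ev_unitLetter]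
  rw [coder_zsmul, coder_sgl, neg_one_zsmul, neg_add_eq_zero]
  obtain ⟨cs, rfl⟩ | ⟨u, x, z, rfl⟩ | ⟨u, z, rfl⟩ := weight_le_one_cases hw
  · rw [coder_unitLetter_plain, xi_plain]
    simp only [xi_plain]
    simp [unitL, ev_map_snd, ev_unitTerms_ext_of_ne hij, Mark.ones]
  · rw [coder_unitLetter_special, xi_marked]
    simp only [ev_cons, ev_nil, one_smul, add_zero, unitL, ev_map_snd,
      ev_unitTerms_ext_of_ne hij, Mark.ones, sgn_zero, ev_unitLetter_tree, xi_marked]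
    rw [coder_unitLetterT_append_cons, ev_unitLetterT, sgl_singleton]
    congr 1
    exact coder_unitLetterT_congr fun y hy _ => by rw [hy]
  · rw [coder_unitLetter_special, xi_unit]
    have h1 : Letter.sign (.one : Letter n) = -1 := rfl
    simp only [ev_cons, ev_nil, add_zero, unitL, ev_map_snd,
      ev_unitTerms_ext_of_ne hij, Mark.ones, sgn_one, xi_unit, h1, unitLetter, zero_add]
    rw [coder_append_of_letter _ rfl (fun _ _ _ => rfl), coder_unitLetterT_congr (u := u)
      (g := fun y => wsign tsign y • h (.tree true (.ext j (.unit y.length) (y ++ z))))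
      (g' := fun y => (-wsign tsign u) • h (.tree true (.ext j (.unit u.length) (y ++ z))))
      fun y hy hs => by rw [hy, hs], coder_zsmul, coder_zsmul]
    have hσ := wsign_mul_self tsign_mul_self u
    simp [smul_add, smul_smul, hσ]

theorem cut_neg {L : Type*} (g : List L → List L → W) (w : List L) :
    cut (fun u v => - g u v) w = - cut g w := by
  have := cut_zsmul (-1) g w
  simpa using this

theorem unitAnticomm_int (i : Fin n) {cs : List (PlanarTree n)} (hcs : 2 ≤ cs.length)
    (hg : ∀ t ∈ cs, UnitAnticomm W i t) : UnitAnticomm W i (.int cs) := by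
  intro h
  have h1 : ∀ k : PlanarTree n → W, ev (unitTerms i (.int cs)) k =
      coder tsign (unitLetterT i) (graft k) cs := by
    intro k
    rw [← graft_ev_unitTerms, graft, if_pos hcs]
  rw [ev_dTerms_int _ hcs, h1, graft_ev_unitTerms, graft_ev_dTerms, add_comm]
  refine coder_anticomm tsign_mul_self tsign_of_mem_muT (tsign_of_mem_unitLetterT i) cs ?_ _
  intro u v z huvz k
  refine muT_unitLetterT_relation i (fun t ht => hg t ?_) k
  rw [← huvz]
  simp [ht]

theorem weight_of_mem_unitLetter {i : Fin n} {w : List (Letter n)} {p : ℤ × Letter n}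
    (hp : p ∈ unitLetter i w) (z : List (Letter n)) :
    weight (p.2 :: z) = weight w + weight z := by
  match w with
  | [] => simp [unitLetter] at hp
  | [.tree b t] =>
    simp only [unitLetter, List.mem_map] at hp
    obtain ⟨q, -, rfl⟩ := hp
    cases b <;> simp [add_comm]
  | [.one] => simp [unitLetter] at hp
  | c :: c' :: cs => simp [unitLetter] at hp

theorem coder_unitLetter_congr {i : Fin n} {g g' : List (Letter n) → W} {w : List (Letter n)}
    (hw : weight w ≤ 1) (H : ∀ y, weight y ≤ 1 → g y = g' y) :
    coder Letter.sign (unitLetter i) g w = coder Letter.sign (unitLetter i) g' w := by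
  refine coder_congr fun u v z h p hp => H _ ?_
  have := weight_of_mem_unitLetter hp z
  rw [← h] at hw
  simp only [weight_append] at *
  omega

theorem mu_unitLetter_anticomm (i : Fin n) {w : List (Letter n)} (hw : weight w ≤ 1)
    (hg : ∀ t ∈ forget w, UnitAnticomm W i t) (g : List (Letter n) → W) :
    coder Letter.sign (unitLetter i) (coder Letter.sign mu g) w +
      coder Letter.sign mu (coder Letter.sign (unitLetter i) g) w = 0 := by
  refine coder_anticomm Letter.sign_mul_self sign_of_mem_mu (sign_of_mem_unitLetter i) w ?_ g
  intro u v z h k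
  rw [← h] at hw hg
  refine mu_unitLetter_relation i ?_ ?_ k
  · simp only [weight_append] at hw
    omega
  · exact fun t ht => hg t (by simp [ht])

theorem xi_unitLetter_anticomm {i j : Fin n} (hij : j ≠ i) {w : List (Letter n)}
    (hw : weight w ≤ 1) (g : List (Letter n) → W) :
    coder Letter.sign (xi j) (coder Letter.sign (unitLetter i) g) w +
      coder Letter.sign (unitLetter i) (coder Letter.sign (xi j) g) w = 0 := by
  refine coder_anticomm Letter.sign_mul_self (sign_of_mem_unitLetter i) (sign_of_mem_xi j) w ?_ g
  intro u v z h k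
  refine xi_unitLetter_relation hij ?_ k
  rw [← h] at hw
  simp only [weight_append] at hw
  omega

theorem coder_unitLetter_tree (i : Fin n) (g : List (Letter n) → W) (b : Bool)
    (t : PlanarTree n) : coder Letter.sign (unitLetter i) g [.tree b t] =
      - ev (unitTerms i t) fun t' => g [.tree b t'] := by
  rw [coder_cons_of_letter _ rfl (fun _ _ _ => by simp [unitLetter]), ev_unitLetter_tree]
  simp [coder_nil, pre, unitLetter]

/-- The argument for `d² = 0` once more, with `μ²` replaced by the anticommutator of `μ` and the
insertion at `i`: `ξ_j` anticommutes with both and hence commutes with their anticommutator. -/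
theorem unitAnticomm_of_mem_xi {i j : Fin n} (hij : j ≠ i) {w : List (Letter n)}
    (hw : weight w ≤ 1) (hg : ∀ t ∈ forget w, UnitAnticomm W i t) :
    ∀ p ∈ xi j w, ∀ t ∈ forget [p.2], UnitAnticomm W i t := by
  induction hl : w.length using Nat.strong_induction_on generalizing w with
  | _ l ih =>
  subst hl
  intro p hp t ht h
  -- The anticommutator, evaluated on the tree of a single letter.
  set G : List (Letter n) → W := fun y => coder Letter.sign (unitLetter i) (coder Letter.sign mu
      (sgl fun c => sgl h (forget [c]))) y + coder Letter.sign mu (coder Letter.sign (unitLetter i)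
      (sgl fun c => sgl h (forget [c]))) y with hG
  have key : ∀ p ∈ xi j w, G [p.2] = 0 := by
    refine annihilate_of_coder_xi hw G ?_ ?_
    · have h1 : ∀ g : List (Letter n) → W,
          coder Letter.sign (xi j) (coder Letter.sign (unitLetter i) (coder Letter.sign mu g)) w =
          coder Letter.sign (unitLetter i) (coder Letter.sign mu (coder Letter.sign (xi j) g)) w := by
        intro g
        rw [eq_neg_of_add_eq_zero_left (xi_unitLetter_anticomm hij hw (coder Letter.sign mu g)),
          coder_unitLetter_congr (g' := fun y => - coder Letter.sign mu (coder Letter.sign (xi j) g) y)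
            hw fun y hy => eq_neg_of_add_eq_zero_left (mu_xi_anticomm j hy g), coder_neg, neg_neg]
      have h2 : ∀ g : List (Letter n) → W,
          coder Letter.sign (xi j) (coder Letter.sign mu (coder Letter.sign (unitLetter i) g)) w =
          coder Letter.sign mu (coder Letter.sign (unitLetter i) (coder Letter.sign (xi j) g)) w := by
        intro g
        rw [eq_neg_of_add_eq_zero_left (mu_xi_anticomm j hw (coder Letter.sign (unitLetter i) g)),
          coder_mu_congr (g' := fun y => - coder Letter.sign (unitLetter i)
            (coder Letter.sign (xi j) g) y) hw fun y hy => eq_neg_of_add_eq_zero_left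
            (xi_unitLetter_anticomm hij hy g), coder_neg, neg_neg]
      rw [hG, coder_add, h1, h2, mu_unitLetter_anticomm i hw hg]
    · intro u v z huvz hv q hq
      rw [← huvz] at hw hg
      simp only [weight_append] at hw
      refine mu_unitLetter_anticomm i ?_ ?_ _
      · have := weight_le_of_mem_xi hq z
        simp only [weight_append]
        omega
      · intro t' ht'
        have : u ++ q.2 :: z = u ++ ([q.2] ++ z) := rfl
        rw [this] at ht'
        simp only [forget_append, List.mem_append] at ht' hg
        rcases ht' with ht' | ht' | ht'
        · exact hg t' (.inl ht')
        · exact ih v.length hv (by omega) (fun t'' h'' => hg t'' (.inr (.inl h''))) rfl q hq t' ht'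
        · exact hg t' (.inr (.inr ht'))
  obtain ⟨a, b, t', hx, ha⟩ := xi_eq_singleton j hw
  have := key p hp
  rw [hx, List.mem_singleton] at hp
  subst hp
  simp only [forget_tree_cons, forget_nil, List.mem_singleton] at ht
  subst ht
  simp only [coder_mu_tree, coder_unitLetter_tree, hG] at this
  rw [ev_neg, neg_neg, ev_neg, neg_neg, add_comm] at this
  simpa using this

/-! ### Inserting the edge at the root vertex -/

/-- The insertion of the letter `𝟙` into a word. -/
def insertOne : List (Letter n) → List (ℤ × Letter n)
  | [] => [(1, .one)]
  | _ => []

theorem sign_of_mem_insertOne (v : List (Letter n)) :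
    ∀ p ∈ insertOne v, p.2.sign = - wsign Letter.sign v := by
  cases v <;> simp [insertOne, Letter.sign]

theorem coder_insertOne_plain (g : List (Letter n) → W) (cs : List (PlanarTree n)) :
    coder Letter.sign insertOne g (plain cs) =
      cut (fun u z => wsign tsign u • g (plain u ++ .one :: plain z)) cs := by
  rw [coder, cut_plain]
  refine cut_congr fun u y _ => ?_
  rw [cut_plain, wsign_plain, ← cut_left_nil (fun y => wsign tsign u • g (plain u ++ .one :: plain y)) y]
  refine cut_congr fun v z _ => ?_
  cases v <;> simp [insertOne]

theorem mu_insertOne_relation (cs : List (PlanarTree n)) (h : Letter n → W) :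
    coder Letter.sign insertOne (fun y => ev (mu y) h) (plain cs) +
      coder Letter.sign mu (fun y => ev (insertOne y) h) (plain cs) = 0 := by
  have h1 : coder Letter.sign mu (fun y => ev (insertOne y) h) (plain cs) = 0 := by
    refine coder_eq_zero fun u v z _ p _ => ?_
    rcases u with _ | ⟨a, u⟩ <;> simp [insertOne]
  rw [h1, add_zero, coder_insertOne_plain]
  simp only [ev_mu_unit]
  have h2 : ∀ u z : List (PlanarTree n), wsign tsign u •
      ((if u = [] then sgl (fun t => h (.tree true t)) z else 0) -
        if z = [] then sgl (fun t => tsign t • h (.tree true t)) u else 0) =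
      (if u = [] then sgl (fun t => h (.tree true t)) z else 0) + (-1 : ℤ) •
        if z = [] then sgl (fun t => h (.tree true t)) u else 0 := by
    intro u z
    have h3 : wsign tsign u • sgl (fun t => tsign t • h (.tree true t)) u =
        sgl (fun t => h (.tree true t)) u := by
      rcases u with _ | ⟨a, _ | ⟨b, u⟩⟩ <;> simp [smul_smul, tsign_mul_self]
    rw [smul_sub, neg_one_zsmul, ← sub_eq_add_neg]
    congr 1
    · by_cases hu : u = [] <;> simp [hu]
    · by_cases hz : z = [] <;> simp [hz, h3]
  simp only [h2]
  rw [cut_add, cut_zsmul, cut_left_nil, cut_right_nil]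
  simp

theorem mu_insertOne_anticomm (cs : List (PlanarTree n)) (g : List (Letter n) → W) :
    coder Letter.sign insertOne (coder Letter.sign mu g) (plain cs) +
      coder Letter.sign mu (coder Letter.sign insertOne g) (plain cs) = 0 := by
  refine coder_anticomm Letter.sign_mul_self sign_of_mem_mu sign_of_mem_insertOne _ ?_ g
  intro u v z h k
  have hv : weight v = 0 := by
    have := congrArg weight h
    simp only [weight_append, weight_plain] at this
    omega
  obtain ⟨cs', rfl⟩ := eq_plain_of_weight hv
  exact mu_insertOne_relation cs' k

/-- The sum over all corners of the root vertex of the insertions of the edge to `𝟙`. -/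
def corners (i : Fin n) (h : PlanarTree n → W) (cs : List (PlanarTree n)) : W :=
  cut (fun u z => h (.ext i (.unit u.length) (u ++ z))) cs

theorem ev_unitTerms_ext_self (i : Fin n) (cs : List (PlanarTree n)) (h : PlanarTree n → W) :
    ev (unitTerms i (.ext i (.edge 0) cs)) h = corners i h cs +
      coder tsign (unitLetterT i) (fun y => h (.ext i (.edge 0) y)) cs := by
  rw [unitTerms, ev_append, ev_map _ _ (fun y => PlanarTree.ext i (.edge 0) y), ev_unitTermsList]
  simp only [if_true, Mark.ones, sgn_zero, one_smul]
  congr 1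
  rw [corners, cut_congr (g' := fun u z => h (.ext i (.unit u.length) cs)) (fun u z hu => by rw [hu]),
    ← cut_eq_sum_range, ev, List.map_map]
  refine congrArg List.sum (List.map_congr_left fun l hl => ?_)
  have hl' : l ≤ cs.length := by simpa [Nat.lt_succ_iff] using hl
  simp [hl']

/-- The differential commutes with the insertion of the edge to `𝟙` at a vertex whose children are
not affected. -/
theorem corners_ev_dTerms (i : Fin n) (h : PlanarTree n → W) (cs : List (PlanarTree n)) :
    corners i (fun t => ev (dTerms t) h) cs + coder tsign muT (corners i h) cs =
      tri (fun u v z => cut (fun a b =>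
        graft h (u ++ .ext i (.unit a.length) (a ++ b) :: z)) v) cs := by
  -- A vertex connected to `𝟙` is a marked letter, so it suffices to read marked letters.
  set k : Letter n → W := fun c => match c with
    | .tree true t => h t
    | _ => 0 with hk
  have hσ (u : List (PlanarTree n)) := wsign_mul_self tsign_mul_self u
  -- Summing over corners means inserting `𝟙` anywhere in the word and then forming the vertex; the
  -- two signs of the letters before `𝟙` cancel.
  have h1 : ∀ y, coder Letter.sign insertOne (coder Letter.sign (xi i) (sgl k)) (plain y) =
      corners i h y := by
    intro y
    rw [coder_insertOne_plain, corners]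
    refine cut_congr fun u z _ => ?_
    rw [coder_sgl, xi_unit, ev_cons, ev_nil, add_zero, smul_smul, hσ, one_smul]
  -- `μ` moves past `ξ_i` and past the insertion of `𝟙`, with two sign changes.
  have h2 : coder Letter.sign insertOne (coder Letter.sign (xi i) (coder Letter.sign mu (sgl k)))
      (plain cs) = coder tsign muT (corners i h) cs := by
    have e1 : coder Letter.sign insertOne (coder Letter.sign (xi i)
        (coder Letter.sign mu (sgl k))) (plain cs) =
        coder Letter.sign insertOne (fun y => - coder Letter.sign mu
          (coder Letter.sign (xi i) (sgl k)) y) (plain cs) := by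
      rw [coder_insertOne_plain, coder_insertOne_plain]
      refine cut_congr fun u z _ => ?_
      rw [eq_neg_of_add_eq_zero_left (mu_xi_anticomm i (by simp) (sgl k))]
    rw [e1, coder_neg, eq_neg_of_add_eq_zero_left (mu_insertOne_anticomm cs
      (coder Letter.sign (xi i) (sgl k))), neg_neg, coder_mu_plain]
    simp only [h1]
  rw [← h2, coder_insertOne_plain]
  -- The same expression is now computed with `μ` acting last, on the words that contain the
  -- finished vertex.
  have h3 : ∀ u z : List (PlanarTree n), wsign tsign u •
      coder Letter.sign (xi i) (coder Letter.sign mu (sgl k)) (plain u ++ .one :: plain z) =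
      (if z = [] then h (.ext i (.edge 0) u) else 0) - (if u = [] then h (.ext i (.edge 0) z) else 0)
      + (cut (fun u₁ u₂ => cut (fun z₁ z₂ =>
          graft h (u₁ ++ .ext i (.unit u₂.length) (u₂ ++ z₁) :: z₂)) z) u -
        ev (dTerms (.ext i (.unit u.length) (u ++ z))) h) := by
    intro u z
    have e1 : (coder Letter.sign mu (sgl k)) = fun y => ev (mu y) k := by
      funext y; rw [coder_sgl]
    rw [e1, ev_mu_eq, coder_add, coder_zsmul, coder_sgl, coder_xi_nu_unit, xi_unit, ev_cons, ev_nil,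
      add_zero, dL, ev_map_snd]
    simp only [hk, cut_zsmul]
    by_cases hu : u = []
    · by_cases hz : z = [] <;> simp [hu, hz] <;> abel
    · by_cases hz : z = [] <;> simp [hu, hz, smul_add, smul_smul, hσ] <;> abel
  simp only [h3, sub_eq_add_neg]
  -- The products of the finished vertex with `𝟙` contribute only at the two ends of the word, with
  -- opposite signs and the same root-marked vertex: the cyclic sum of differences of marks closes
  -- up.
  rw [cut_add, cut_add, cut_add, cut_neg, cut_neg, cut_left_nil, cut_right_nil,
    ← cut_assoc (fun u₁ u₂ z => cut (fun z₁ z₂ =>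
      graft h (u₁ ++ .ext i (.unit u₂.length) (u₂ ++ z₁) :: z₂)) z) cs]
  simp only [cut_assoc (fun u₂ z₁ z₂ => graft h (_ ++ .ext i (.unit u₂.length) (u₂ ++ z₁) :: z₂))]
  rw [tri, corners]
  abel

theorem mem_labelsList {i : Fin n} {cs : List (PlanarTree n)} :
    i ∈ labelsList cs ↔ ∃ c ∈ cs, i ∈ labels c := by
  induction cs with
  | nil => simp [labelsList]
  | cons c cs ih => simp [labelsList, ih]

theorem unitTermsList_eq_nil {i : Fin n} {cs : List (PlanarTree n)}
    (h : ∀ c ∈ cs, unitTerms i c = []) : unitTermsList i cs = [] := by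
  induction cs with
  | nil => rfl
  | cons c cs ih =>
    rw [unitTermsList, h c (by simp), ih fun c hc => h c (by simp [hc])]
    rfl

theorem unitTerms_eq_nil {i : Fin n} {t : PlanarTree n} (h : i ∉ labels t) :
    unitTerms i t = [] := by
  induction t using PlanarTree.induction with
  | ext j m cs ih =>
    simp only [labels, List.mem_cons, not_or, mem_labelsList, not_exists, not_and] at h
    have h' := unitTermsList_eq_nil fun c hc => ih c hc (h.2 c hc)
    rcases m with (_ | k) | k <;> simp [unitTerms, h', Ne.symm h.1]
  | int cs ih =>
    simp only [labels, mem_labelsList, not_exists, not_and] at h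
    rw [unitTerms, unitTermsList_eq_nil fun c hc => ih c hc (h c hc)]
    rfl

theorem coder_unitLetterT_eq_zero {i : Fin n} {cs : List (PlanarTree n)} (h : i ∉ labelsList cs)
    (g : List (PlanarTree n) → W) : coder tsign (unitLetterT i) g cs = 0 := by
  refine coder_eq_zero fun u v z huvz p hp => ?_
  rcases v with _ | ⟨t, _ | ⟨t', v⟩⟩
  · simp [unitLetterT] at hp
  · have : i ∉ labels t := fun h' => h (mem_labelsList.2 ⟨t, by simp [← huvz], h'⟩)
    simp [unitLetterT, unitTerms_eq_nil this] at hp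
  · simp [unitLetterT] at hp

theorem labelsList_perm_of_mem_muT (v : List (PlanarTree n)) :
    ∀ p ∈ muT v, (labels p.2).Perm (labelsList v) := by
  match v with
  | [] => simp [muT]
  | [t] =>
    simp only [muT, dLetter, List.mem_map]
    rintro p ⟨q, hq, rfl⟩
    simpa [labelsList] using labels_perm_of_mem_dTerms t q hq
  | c :: c' :: cs => simp [muT, labels]

theorem coder_unitLetterT_ext_self {i : Fin n} {u v z : List (PlanarTree n)}
    (hu : i ∉ labelsList u) (hv : i ∉ labelsList v) (hz : i ∉ labelsList z)
    (g : List (PlanarTree n) → W) :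
    coder tsign (unitLetterT i) g (u ++ .ext i (.edge 0) v :: z) =
      - wsign tsign u • corners i (fun t => g (u ++ t :: z)) v := by
  rw [coder_append_of_letter _ rfl (fun _ _ _ => rfl), coder_cons_of_letter _ rfl
    (fun _ _ _ => rfl), coder_unitLetterT_eq_zero hu, coder_unitLetterT_eq_zero hz, ev_unitLetterT,
    sgl_singleton, ev_unitTerms_ext_self, coder_unitLetterT_eq_zero hv]
  simp

/-- Since `i` does not occur among the children, every insertion is at the corners of this vertex.
In the splittings above it, the vertex keeps a subword `v` and the insertion runs over the corners
of `v`; this is the right side of `corners_ev_dTerms`, whose left side gives the other terms. -/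
theorem unitAnticomm_ext_self {i : Fin n} {cs : List (PlanarTree n)} (hcs : i ∉ labelsList cs) :
    UnitAnticomm W i (.ext i (.edge 0) cs) := by
  intro k
  rw [ev_dL_ext_plain, ev_unitTerms_ext_self, coder_unitLetterT_eq_zero hcs, add_zero,
    graft_ev_unitTerms]
  have h1 : coder tsign (xiT i) (coder tsign (unitLetterT i) (graft k)) cs =
      - tri (fun u v z => cut (fun a b =>
        graft k (u ++ .ext i (.unit a.length) (a ++ b) :: z)) v) cs := by
    rw [coder_eq_tri, ← tri_neg]
    refine tri_congr fun u v z huvz => ?_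
    subst huvz
    simp only [labelsList_append, List.mem_append, not_or] at hcs
    rw [xiT, ev_cons, ev_nil, add_zero, one_smul,
      coder_unitLetterT_ext_self hcs.1 hcs.2.1 hcs.2.2, neg_smul, smul_neg, smul_smul,
      wsign_mul_self tsign_mul_self, one_smul, corners]
  have h2 : coder tsign muT (fun y => ev (unitTerms i (.ext i (.edge 0) y)) k) cs =
      coder tsign muT (corners i k) cs := by
    refine coder_congr fun u v z huvz p hp => ?_
    rw [ev_unitTerms_ext_self, coder_unitLetterT_eq_zero, add_zero]
    subst huvz
    rw [labelsList_append, labelsList, List.mem_append, List.mem_append,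
      (labelsList_perm_of_mem_muT v p hp).mem_iff]
    simpa [labelsList_append] using hcs
  rw [h1, h2, ← corners_ev_dTerms]
  abel

theorem count_labelsList_le {i : Fin n} {c : PlanarTree n} {cs : List (PlanarTree n)} (hc : c ∈ cs) :
    (labels c).count i ≤ (labelsList cs).count i := by
  obtain ⟨u, z, rfl⟩ := List.append_of_mem hc
  rw [labelsList_append, labelsList, List.count_append, List.count_append]
  omega

/-- `i ∉ S` forces a root mark at `i`, as the case of the vertex `i` requires, and the bound on the
count keeps `i` away from its children. -/
theorem unitAnticomm_of_wellFormed {i : Fin n} {S : Finset (Fin n)} (hi : i ∉ S) {t : PlanarTree n}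
    (ht : WellFormed t) (hS : RootMarkedOff S t) (hl : (labels t).count i ≤ 1) :
    UnitAnticomm W i t := by
  induction t using PlanarTree.induction with
  | ext j m cs ih =>
    simp only [WellFormed, wellFormedList_iff, RootMarkedOff, rootMarkedOffList_iff] at ht hS
    rw [labels] at hl
    by_cases hij : j = i
    · subst hij
      rw [hS.1 hi]
      refine unitAnticomm_ext_self ?_
      rw [← List.count_eq_zero]
      simpa using hl
    · rw [List.count_cons_of_ne hij] at hl
      obtain ⟨w, hw, rfl, a, b, hx⟩ := exists_xi_eq j ht.1
      refine unitAnticomm_of_mem_xi hij hw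
        (fun t h => ih t h (ht.2 t h) (hS.2 t h) ((count_labelsList_le h).trans hl)) _
        (by rw [hx]; simp; rfl) _ (by simp)
  | int cs ih =>
    simp only [WellFormed, wellFormedList_iff, RootMarkedOff, rootMarkedOffList_iff] at ht hS
    exact unitAnticomm_int i ht.1
      fun t h => ih t h (ht.2 t h) (hS t h) ((count_labelsList_le h).trans hl)

/-! ### Trees with a hole -/

/-- Planar rooted trees one leaf of which is a hole. -/
inductive Context (n : ℕ) : Type
  | hole : Context n
  | ext (i : Fin n) (m : Mark) (u : List (PlanarTree n)) (C : Context n)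
      (z : List (PlanarTree n)) : Context n
  | int (u : List (PlanarTree n)) (C : Context n) (z : List (PlanarTree n)) : Context n

/-- Filling the hole. -/
def Context.plug : Context n → PlanarTree n → PlanarTree n
  | .hole, t => t
  | .ext i m u C z, t => .ext i m (u ++ C.plug t :: z)
  | .int u C z, t => .int (u ++ C.plug t :: z)

/-- The label `i` does not occur. -/
def Context.Avoids (i : Fin n) : Context n → Prop
  | .hole => True
  | .ext j _ u C z => j ≠ i ∧ i ∉ labelsList u ∧ C.Avoids i ∧ i ∉ labelsList z
  | .int u C z => i ∉ labelsList u ∧ C.Avoids i ∧ i ∉ labelsList z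

/-- The sign of moving an odd element past the edges that precede the hole. -/
def Context.sign : Context n → ℤ
  | .hole => 1
  | .ext _ m u C _ => sgn m.ones * (- wsign tsign u * C.sign)
  | .int u C _ => - wsign tsign u * C.sign

theorem Context.sign_mul_self (C : Context n) : C.sign * C.sign = 1 := by
  induction C with
  | hole => rfl
  | ext i m u C z ih =>
    have h1 := sgn_mul_self m.ones
    have h2 := wsign_mul_self tsign_mul_self u
    rw [Context.sign]
    linear_combination (wsign tsign u * wsign tsign u * C.sign * C.sign) * h1 +
      (C.sign * C.sign) * h2 + ih
  | int u C z ih =>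
    have h2 := wsign_mul_self tsign_mul_self u
    rw [Context.sign]
    linear_combination (C.sign * C.sign) * h2 + ih

theorem Context.mem_labels_plug (C : Context n) {i : Fin n} {t : PlanarTree n} (h : i ∈ labels t) :
    i ∈ labels (C.plug t) := by
  induction C with
  | hole => exact h
  | ext j m u C z ih => simp [plug, labels, labelsList_append, labelsList, ih]
  | int u C z ih => simp [plug, labels, labelsList_append, labelsList, ih]

theorem exists_plug_of_mem_labels {i : Fin n} {t : PlanarTree n} (ht : (labels t).count i = 1) :
    ∃ C m cs, C.Avoids i ∧ i ∉ labelsList cs ∧ t = Context.plug C (.ext i m cs) := by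
  have key : ∀ cs : List (PlanarTree n), (labelsList cs).count i = 1 → ∃ u c z, cs = u ++ c :: z ∧
      i ∉ labelsList u ∧ (labels c).count i = 1 ∧ i ∉ labelsList z := by
    intro cs hcs
    obtain ⟨c, hc, hi⟩ := mem_labelsList.1 (List.count_pos_iff.1 (by omega : 0 < (labelsList cs).count i))
    obtain ⟨u, z, rfl⟩ := List.append_of_mem hc
    rw [labelsList_append, labelsList, List.count_append, List.count_append] at hcs
    have := List.count_pos_iff.2 hi
    exact ⟨u, c, z, rfl, List.count_eq_zero.1 (by omega), by omega, List.count_eq_zero.1 (by omega)⟩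
  induction t using PlanarTree.induction with
  | ext j m cs ih =>
    rw [labels] at ht
    by_cases hj : j = i
    · subst hj
      refine ⟨.hole, m, cs, trivial, ?_, rfl⟩
      rw [← List.count_eq_zero]
      simpa using ht
    · rw [List.count_cons_of_ne hj] at ht
      obtain ⟨u, c, z, rfl, hu, hc, hz⟩ := key cs ht
      obtain ⟨C, m', cs, hC, hcs, rfl⟩ := ih c (by simp) hc
      exact ⟨.ext j m u C z, m', cs, ⟨hj, hu, hC, hz⟩, hcs, rfl⟩
  | int cs ih =>
    rw [labels] at ht
    obtain ⟨u, c, z, rfl, hu, hc, hz⟩ := key cs ht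
    obtain ⟨C, m', cs, hC, hcs, rfl⟩ := ih c (by simp) hc
    exact ⟨.int u C z, m', cs, ⟨hu, hC, hz⟩, hcs, rfl⟩

/-- The label `i` locates the distinguished entry: it is the first one in which `i` occurs. -/
theorem append_cons_inj_of_mem {i : Fin n} {u z u' z' : List (PlanarTree n)} {c c' : PlanarTree n}
    (h : u ++ c :: z = u' ++ c' :: z') (hc : i ∈ labels c) (hc' : i ∈ labels c')
    (hu : i ∉ labelsList u) (hu' : i ∉ labelsList u') : u = u' ∧ c = c' ∧ z = z' := by
  induction u generalizing u' with
  | nil =>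
    cases u' with
    | nil => simpa using h
    | cons b u' =>
      simp only [List.nil_append, List.cons_append, List.cons.injEq] at h
      exact absurd (mem_labelsList.2 ⟨c, by simp [h.1], hc⟩) hu'
  | cons a u ih =>
    cases u' with
    | nil =>
      simp only [List.nil_append, List.cons_append, List.cons.injEq] at h
      exact absurd (mem_labelsList.2 ⟨c', by simp [h.1], hc'⟩) hu
    | cons b u' =>
      simp only [List.cons_append, List.cons.injEq] at h
      simp only [labelsList, List.mem_append, not_or] at hu hu'
      obtain ⟨rfl, rfl, rfl⟩ := ih h.2 hu.2 hu'.2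
      simp [h.1]

/-- As the hole carries the only vertex labelled `i`, the label determines the path to it. This
makes it possible to define operators on basis trees by the mark at `i`. -/
theorem Context.plug_injective {i : Fin n} {C C' : Context n} (hC : C.Avoids i) (hC' : C'.Avoids i)
    {m m' : Mark} {cs cs' : List (PlanarTree n)}
    (h : C.plug (.ext i m cs) = C'.plug (.ext i m' cs')) : C = C' ∧ m = m' ∧ cs = cs' := by
  have hi : ∀ (C : Context n) m cs, i ∈ labels (C.plug (.ext i m cs)) := fun C m cs =>
    C.mem_labels_plug (by simp [labels])
  induction C generalizing C' with
  | hole =>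
    cases C' with
    | hole => simpa [plug] using h
    | ext j m u C z =>
      simp only [plug, PlanarTree.ext.injEq] at h
      exact absurd h.1.symm hC'.1
    | int u C z => simp [plug] at h
  | ext j m u C z ih =>
    cases C' with
    | hole =>
      simp only [plug, PlanarTree.ext.injEq] at h
      exact absurd h.1 hC.1
    | ext j' m' u' C' z' =>
      simp only [plug, PlanarTree.ext.injEq] at h
      obtain ⟨rfl, rfl, h⟩ := h
      obtain ⟨rfl, h₂, rfl⟩ := append_cons_inj_of_mem h (hi _ _ _) (hi _ _ _) hC.2.1 hC'.2.1
      obtain ⟨rfl, h₃⟩ := ih hC.2.2.1 hC'.2.2.1 h₂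
      exact ⟨rfl, h₃⟩
    | int u C z => simp [plug] at h
  | int u C z ih =>
    cases C' with
    | hole => simp [plug] at h
    | ext j' m' u' C' z' => simp [plug] at h
    | int u' C' z' =>
      simp only [plug, PlanarTree.int.injEq] at h
      obtain ⟨rfl, h₂, rfl⟩ := append_cons_inj_of_mem h (hi _ _ _) (hi _ _ _) hC.1 hC'.1
      obtain ⟨rfl, h₃⟩ := ih hC.2.1 hC'.2.1 h₂
      exact ⟨rfl, h₃⟩

theorem coder_unitLetterT_plug {i : Fin n} {u z : List (PlanarTree n)} (hu : i ∉ labelsList u)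
    (hz : i ∉ labelsList z) (t : PlanarTree n) (g : List (PlanarTree n) → W) :
    coder tsign (unitLetterT i) g (u ++ t :: z) =
      (- wsign tsign u) • ev (unitTerms i t) fun t' => g (u ++ t' :: z) := by
  rw [coder_append_of_letter _ rfl (fun _ _ _ => rfl), coder_cons_of_letter _ rfl
    (fun _ _ _ => rfl), coder_unitLetterT_eq_zero hu, coder_unitLetterT_eq_zero hz, ev_unitLetterT,
    sgl_singleton]
  simp

theorem ev_unitTerms_plug {i : Fin n} {C : Context n} (hC : C.Avoids i) (t : PlanarTree n)
    (h : PlanarTree n → W) : ev (unitTerms i (C.plug t)) h =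
      C.sign • ev (unitTerms i t) fun t' => h (C.plug t') := by
  induction C generalizing h with
  | hole => simp [Context.plug, Context.sign]
  | ext j m u C z ih =>
    rw [Context.plug, ev_unitTerms_ext_of_ne hC.1, coder_unitLetterT_plug hC.2.1 hC.2.2.2,
      ih hC.2.2.1, smul_smul, smul_smul, Context.sign, mul_assoc]
    rfl
  | int u C z ih =>
    rw [Context.plug, unitTerms, ev_map_snd, ev_unitTermsList, coder_unitLetterT_plug hC.1 hC.2.2,
      ih hC.2.1, smul_smul, Context.sign]
    rfl

theorem ev_unitTerms_plug_ext {i : Fin n} {C : Context n} (hC : C.Avoids i)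
    {cs : List (PlanarTree n)} (hcs : i ∉ labelsList cs) (h : PlanarTree n → W) :
    ev (unitTerms i (C.plug (.ext i (.edge 0) cs))) h =
      C.sign • ∑ l ∈ Finset.range (cs.length + 1), h (C.plug (.ext i (.unit l) cs)) := by
  rw [ev_unitTerms_plug hC, ev_unitTerms_ext_self, coder_unitLetterT_eq_zero hcs, add_zero, corners,
    cut_congr (g' := fun u z => h (C.plug (.ext i (.unit u.length) cs))) (fun u z hu => by rw [hu]),
    ← cut_eq_sum_range]
  congr 1
  change _ = ((List.range (cs.length + 1)).map _).sum
  refine congrArg List.sum (List.map_congr_left fun l hl => ?_)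
  have hl' : l ≤ cs.length := by simpa [Nat.lt_succ_iff] using hl
  simp [hl']

/-! ### The part of the differential that removes an edge to `𝟙` -/

/-- The external vertex with label `i` is connected to `𝟙`. -/
def Unital (i : Fin n) (t : PlanarTree n) : Prop := (i : WithBot (Fin n)) ∈ edgeWord t

theorem mem_edgeWordList {i : Fin n} {cs : List (PlanarTree n)} :
    (i : WithBot (Fin n)) ∈ edgeWordList cs ↔ ∃ c ∈ cs, Unital i c := by
  induction cs with
  | nil => simp [edgeWordList]
  | cons c cs ih => simp [edgeWordList, ih, Unital]

theorem unital_int {i : Fin n} {cs : List (PlanarTree n)} :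
    Unital i (.int cs) ↔ ∃ c ∈ cs, Unital i c := by
  rw [Unital, edgeWord, mem_edgeWordList]

theorem unital_ext {i j : Fin n} {m : Mark} {cs : List (PlanarTree n)} :
    Unital i (.ext j m cs) ↔ (j = i ∧ m.ones = 1) ∨ ∃ c ∈ cs, Unital i c := by
  cases m <;> simp [Unital, edgeWord, mem_edgeWordList, Mark.ones, eq_comm]

theorem ev_eq_zero {L : Type*} {l : List (ℤ × L)} {h : L → W} (H : ∀ p ∈ l, h p.2 = 0) :
    ev l h = 0 := by
  rw [ev_congr (h' := fun _ => 0) H, ev_zero]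

theorem ev_dTermsList_of_unital {i : Fin n} {u : List (PlanarTree n)} {t : PlanarTree n}
    {z : List (PlanarTree n)} (ht : Unital i t) {g : List (PlanarTree n) → W}
    (hg : ∀ cs, (∃ c ∈ cs, Unital i c) → g cs = 0) :
    ev (dTermsList (u ++ t :: z)) g =
      (- wsign tsign u) • ev (dTerms t) fun t' => g (u ++ t' :: z) := by
  have h1 : ∀ (p : ℤ × PlanarTree n), (-p.1, p.2 :: z) = (-1 * p.1, p.2 :: z) := by simp
  rw [ev_dTermsList_append, dTermsList, ev_append]
  simp only [h1]
  rw [ev_map _ (-1) (fun t => t :: z), ev_map _ _ (fun y => t :: y),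
    ev_eq_zero (l := dTermsList u) (h := fun y => g (y ++ t :: z))
      fun p _ => hg _ ⟨t, by simp, ht⟩,
    ev_eq_zero (l := dTermsList z) (h := fun y => g (u ++ t :: y))
      fun p _ => hg _ ⟨t, by simp, ht⟩]
  simp

/-- Splittings and differentials of children keep the edge from `i` to `𝟙`, and `h` ignores such
trees. Only `turnMark` remains. -/
theorem ev_dTerms_ext_unit {i : Fin n} {h : PlanarTree n → W} (hh : ∀ t, Unital i t → h t = 0)
    (j : ℕ) (cs : List (PlanarTree n)) : ev (dTerms (.ext i (.unit j) cs)) h =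
      h (.ext i (.edge (if j = cs.length then 0 else j + 1)) cs) - h (.ext i (.edge j) cs) := by
  rw [ev_dTerms_ext, tri_eq_zero, tri_eq_zero,
    ev_eq_zero (l := dTermsList cs) (h := fun y => h (.ext i (.unit j) y))
      fun p _ => hh _ (unital_ext.2 (.inl ⟨rfl, rfl⟩))]
  · simp [turnMark, sub_eq_add_neg]
  · intro u v z _
    cases hm : (Mark.unit j).splitAbove u.length v.length with
    | none => rfl
    | some m' =>
      simp only [Option.elim_some, graft]
      rw [hh _ (unital_int.2 ⟨.ext i m' v, by simp,
        unital_ext.2 (.inl ⟨rfl, Mark.ones_splitAbove hm⟩)⟩)]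
      simp
  · intro u v z _
    cases hm : (Mark.unit j).splitBelow u.length v.length with
    | none => rfl
    | some m' =>
      simp only [Option.elim_some, graft]
      rw [hh _ (unital_ext.2 (.inl ⟨rfl, Mark.ones_splitBelow hm⟩))]
      simp

/-- A term that does not act inside the plugged tree keeps its edge from `i` to `𝟙` and is ignored
by `h`. The sign moves the new edge past the edges before the hole. -/
theorem ev_dTerms_plug {i : Fin n} {h : PlanarTree n → W} (hh : ∀ t, Unital i t → h t = 0)
    (C : Context n) {t : PlanarTree n} (ht : Unital i t) : ev (dTerms (C.plug t)) h =
      C.sign • ev (dTerms t) fun t' => h (C.plug t') := by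
  have hC : ∀ C : Context n, Unital i (C.plug t) := by
    intro C
    induction C with
    | hole => exact ht
    | ext j m u C z ih => exact unital_ext.2 (.inr ⟨_, by simp, ih⟩)
    | int u C z ih => exact unital_int.2 ⟨_, by simp, ih⟩
  induction C generalizing h with
  | hole => simp [Context.plug, Context.sign]
  | ext j m u C z ih =>
    have hcs : ∃ c ∈ u ++ C.plug t :: z, Unital i c := ⟨_, by simp, hC C⟩
    have hih := ih (h := fun t' => h (.ext j m (u ++ t' :: z)))
      fun t ht => hh _ (unital_ext.2 (.inr ⟨_, by simp, ht⟩))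
    rw [Context.plug, ev_dTerms_ext, ev_dTermsList_of_unital (hC C)
      (fun cs hcs => hh _ (unital_ext.2 (.inr hcs))), tri_eq_zero, tri_eq_zero, ev_eq_zero, hih,
      Context.sign, smul_smul, smul_smul, mul_assoc]
    · simp [Context.plug]
    · intro p hp
      cases m with
      | edge j => simp [turnMark] at hp
      | unit j =>
        simp only [turnMark, List.mem_cons, List.not_mem_nil, or_false] at hp
        rcases hp with rfl | rfl <;> exact hh _ (unital_ext.2 (.inr hcs))
    · intro u' v z' huvz
      rw [← huvz] at hcs
      obtain ⟨c, hc, hi⟩ := hcs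
      cases m.splitAbove u'.length v.length with
      | none => rfl
      | some m' =>
        have : ∃ c ∈ u' ++ PlanarTree.ext j m' v :: z', Unital i c := by
          simp only [List.mem_append] at hc
          rcases hc with hc | hc | hc
          · exact ⟨c, by simp [hc], hi⟩
          · exact ⟨.ext j m' v, by simp, unital_ext.2 (.inr ⟨c, hc, hi⟩)⟩
          · exact ⟨c, by simp [hc], hi⟩
        simp [graft, hh _ (unital_int.2 this)]
    · intro u' v z' huvz
      rw [← huvz] at hcs
      obtain ⟨c, hc, hi⟩ := hcs
      cases m.splitBelow u'.length v.length with
      | none => rfl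
      | some m' =>
        have : ∃ c ∈ u' ++ PlanarTree.int v :: z', Unital i c := by
          simp only [List.mem_append] at hc
          rcases hc with hc | hc | hc
          · exact ⟨c, by simp [hc], hi⟩
          · exact ⟨.int v, by simp, unital_int.2 ⟨c, hc, hi⟩⟩
          · exact ⟨c, by simp [hc], hi⟩
        simp [graft, hh _ (unital_ext.2 (.inr this))]
  | int u C z ih =>
    have hcs : ∃ c ∈ u ++ C.plug t :: z, Unital i c := ⟨_, by simp, hC C⟩
    have hih := ih (h := fun t' => h (.int (u ++ t' :: z)))
      fun t ht => hh _ (unital_int.2 ⟨_, by simp, ht⟩)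
    rw [Context.plug, dTerms, ev_append, ev_map_snd, ev_dTermsList_of_unital (hC C)
      (fun cs hcs => hh _ (unital_int.2 hcs)), ev_eq_zero, hih, zero_add, Context.sign, smul_smul]
    · rfl
    · intro p hp
      simp only [splitInt, List.mem_filter, List.mem_map, decide_eq_true_eq] at hp
      obtain ⟨q, ⟨hq, -⟩, rfl⟩ := hp
      obtain ⟨u', v, z', huvz, -, -, h3, h4, h5⟩ := exists_of_mem_intervals hq
      dsimp only
      rw [h3, h4, h5]
      rw [huvz] at hcs
      obtain ⟨c, hc, hi⟩ := hcs
      refine hh _ (unital_int.2 ?_)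
      simp only [List.mem_append] at hc
      rcases hc with hc | hc | hc
      · exact ⟨c, by simp [hc], hi⟩
      · exact ⟨.int v, by simp, unital_int.2 ⟨c, hc, hi⟩⟩
      · exact ⟨c, by simp [hc], hi⟩

end

section

variable {n : ℕ}

/-! ### The subcomplexes with prescribed root-marked vertices -/

/-- A cyclic braces tree of the given degree, all of whose external vertices with label outside `S`
are marked in the direction of the root. -/
def Admissible (S : Finset (Fin n)) (p : ℤ) (t : PlanarTree n) : Prop :=
  IsCyclicBracesTree t ∧ RootMarkedOff S t ∧ degree t = p

theorem Admissible.mono {S S' : Finset (Fin n)} (h : S ⊆ S') {p : ℤ} {t : PlanarTree n}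
    (ht : Admissible S p t) : Admissible S' p t := ⟨ht.1, ht.2.1.mono h, ht.2.2⟩

theorem Admissible.of_mem_dTerms {S : Finset (Fin n)} {p : ℤ} {t : PlanarTree n}
    (ht : Admissible S p t) : ∀ q ∈ dTerms t, Admissible S (p + 1) q.2 := fun q hq =>
  ⟨⟨wellFormed_of_mem_dTerms t q hq ht.1.1,
    fun i => by rw [(labels_perm_of_mem_dTerms t q hq).count_eq, ht.1.2 i]⟩,
    rootMarkedOff_of_mem_dTerms S t q hq ht.2.1, by rw [degree_of_mem_dTerms t q hq, ht.2.2]⟩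

theorem labels_of_mem_unitTerms (i : Fin n) (t : PlanarTree n) :
    ∀ p ∈ unitTerms i t, labels p.2 = labels t := by
  refine unitTerms_induction (R := fun t t' => labels t' = labels t) i ?_ ?_ ?_ t
  · intro l cs _
    simp [labels]
  · intro i m u c c' z h
    simp [labels, labelsList_append, labelsList, h]
  · intro u c c' z h
    simp [labels, labelsList_append, labelsList, h]

theorem degree_of_mem_unitTerms (i : Fin n) (t : PlanarTree n) :
    ∀ p ∈ unitTerms i t, degree p.2 = degree t - 1 := by
  refine unitTerms_induction (R := fun t t' => degree t' = degree t - 1) i ?_ ?_ ?_ t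
  · intro l cs _
    simp [degree, numEdges, numInt, Mark.ones]
    ring
  · intro i m u c c' z h
    simp only [degree, numEdges, numInt, numEdgesList_append, numIntList_append, numEdgesList,
      numIntList, Nat.cast_add] at h ⊢
    linarith
  · intro u c c' z h
    simp only [degree, numEdges, numInt, numEdgesList_append, numIntList_append, numEdgesList,
      numIntList, Nat.cast_add] at h ⊢
    linarith

theorem wellFormed_of_mem_unitTerms (i : Fin n) (t : PlanarTree n) :
    ∀ p ∈ unitTerms i t, WellFormed t → WellFormed p.2 := by
  refine unitTerms_induction (R := fun t t' => WellFormed t → WellFormed t') i ?_ ?_ ?_ t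
  · intro l cs hl h
    exact ⟨hl, h.2⟩
  · intro i m u c c' z h
    simp only [WellFormed, wellFormedList_iff, List.mem_append, List.mem_cons, List.length_append,
      List.length_cons]
    rintro ⟨h1, h2⟩
    refine ⟨h1, ?_⟩
    rintro c (hc | rfl | hc)
    · exact h2 _ (.inl hc)
    · exact h (h2 _ (.inr (.inl rfl)))
    · exact h2 _ (.inr (.inr hc))
  · intro u c c' z h
    simp only [WellFormed, wellFormedList_iff, List.mem_append, List.mem_cons, List.length_append,
      List.length_cons]
    rintro ⟨h1, h2⟩
    refine ⟨h1, ?_⟩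
    rintro c (hc | rfl | hc)
    · exact h2 _ (.inl hc)
    · exact h (h2 _ (.inr (.inl rfl)))
    · exact h2 _ (.inr (.inr hc))

theorem rootMarkedOff_of_mem_unitTerms (i : Fin n) (S : Finset (Fin n)) (t : PlanarTree n) :
    RootMarkedOff S t → ∀ p ∈ unitTerms i t, RootMarkedOff (insert i S) p.2 := by
  intro ht
  induction t using PlanarTree.induction with
  | ext j m cs ih =>
    simp only [RootMarkedOff, rootMarkedOffList_iff] at ht
    intro p hp
    simp only [unitTerms, List.mem_append, List.mem_map] at hp
    rcases hp with hp | ⟨q, hq, rfl⟩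
    · split at hp
      · split_ifs at hp with hj
        · subst hj
          simp only [List.mem_map, List.mem_range] at hp
          obtain ⟨l, hl, rfl⟩ := hp
          simp only [RootMarkedOff, rootMarkedOffList_iff]
          exact ⟨by simp, fun c hc => (ht.2 c hc).mono (Finset.subset_insert _ _)⟩
        · simp at hp
      · simp at hp
    · obtain ⟨u, c, z, rfl, r, hr, hq⟩ := mem_unitTermsList hq
      dsimp only
      rw [hq]
      simp only [RootMarkedOff, rootMarkedOffList_iff, List.mem_append, List.mem_cons]
      refine ⟨fun h => ht.1 fun h' => h (Finset.mem_insert_of_mem h'), ?_⟩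
      rintro c' (hc | rfl | hc)
      · exact (ht.2 _ (by simp [hc])).mono (Finset.subset_insert _ _)
      · exact ih c (by simp) (ht.2 _ (by simp)) r hr
      · exact (ht.2 _ (by simp [hc])).mono (Finset.subset_insert _ _)
  | int cs ih =>
    simp only [RootMarkedOff, rootMarkedOffList_iff] at ht
    intro p hp
    simp only [unitTerms, List.mem_map] at hp
    obtain ⟨q, hq, rfl⟩ := hp
    obtain ⟨u, c, z, rfl, r, hr, hq⟩ := mem_unitTermsList hq
    dsimp only
    rw [hq]
    simp only [RootMarkedOff, rootMarkedOffList_iff, List.mem_append, List.mem_cons]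
    rintro c' (hc | rfl | hc)
    · exact (ht _ (by simp [hc])).mono (Finset.subset_insert _ _)
    · exact ih c (by simp) (ht _ (by simp)) r hr
    · exact (ht _ (by simp [hc])).mono (Finset.subset_insert _ _)

theorem Admissible.of_mem_unitTerms {S : Finset (Fin n)} {p : ℤ} {t : PlanarTree n}
    (ht : Admissible S p t) {i : Fin n} :
    ∀ q ∈ unitTerms i t, Admissible (insert i S) (p - 1) q.2 := fun q hq =>
  ⟨⟨wellFormed_of_mem_unitTerms i t q hq ht.1.1,
    fun j => by rw [labels_of_mem_unitTerms i t q hq, ht.1.2 j]⟩,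
    rootMarkedOff_of_mem_unitTerms i S t ht.2.1 q hq,
    by rw [degree_of_mem_unitTerms i t q hq, ht.2.2]⟩

theorem RootMarkedOff.of_insert {i : Fin n} {S : Finset (Fin n)} {t : PlanarTree n}
    (ht : RootMarkedOff (insert i S) t) (hi : i ∉ labels t) : RootMarkedOff S t := by
  induction t using PlanarTree.induction with
  | ext j m cs ih =>
    simp only [RootMarkedOff, rootMarkedOffList_iff, labels, List.mem_cons, not_or, mem_labelsList,
      not_exists, not_and] at ht hi ⊢
    refine ⟨fun h => ht.1 ?_, fun c hc => ih c hc (ht.2 c hc) (hi.2 c hc)⟩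
    simpa [h] using Ne.symm hi.1
  | int cs ih =>
    simp only [RootMarkedOff, rootMarkedOffList_iff, labels, mem_labelsList,
      not_exists, not_and] at ht hi ⊢
    exact fun c hc => ih c hc (ht c hc) (hi c hc)

theorem not_unital_of_rootMarkedOff {i : Fin n} {S : Finset (Fin n)} (hi : i ∉ S)
    {t : PlanarTree n} (ht : RootMarkedOff S t) : ¬ Unital i t := by
  induction t using PlanarTree.induction with
  | ext j m cs ih =>
    simp only [RootMarkedOff, rootMarkedOffList_iff] at ht
    rw [unital_ext]
    rintro (⟨rfl, hm⟩ | ⟨c, hc, h⟩)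
    · simp [ht.1 hi, Mark.ones] at hm
    · exact ih c hc (ht.2 c hc) h
  | int cs ih =>
    simp only [RootMarkedOff, rootMarkedOffList_iff] at ht
    rw [unital_int]
    rintro ⟨c, hc, h⟩
    exact ih c hc (ht c hc) h

/-! ### Changing the mark at a vertex -/

/-- The trees with a distinguished vertex with label `i`, without the mark of this vertex. -/
abbrev Vertex (i : Fin n) : Type :=
  {x : Context n × List (PlanarTree n) // x.1.Avoids i ∧ i ∉ labelsList x.2}

variable {i : Fin n}

/-- The number of children. -/
def Vertex.arity (D : Vertex i) : ℕ := D.1.2.length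

/-- The sign of moving an odd element past the edges that precede the vertex. -/
def Vertex.sign (D : Vertex i) : ℤ := D.1.1.sign

/-- The tree with the given mark at the distinguished vertex. -/
def Vertex.tree (D : Vertex i) (m : Mark) : PlanarTree n := D.1.1.plug (.ext i m D.1.2)

theorem Vertex.sign_mul_self (D : Vertex i) : D.sign * D.sign = 1 := D.1.1.sign_mul_self

theorem Vertex.tree_injective :
    Function.Injective fun x : Vertex i × Mark => x.1.tree x.2 := by
  rintro ⟨⟨⟨C, cs⟩, h⟩, m⟩ ⟨⟨⟨C', cs'⟩, h'⟩, m'⟩ hx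
  obtain ⟨h1, h2, h3⟩ := Context.plug_injective h.1 h'.1 hx
  dsimp only at h1 h2 h3
  subst h1 h2 h3
  rfl

theorem exists_vertex {t : PlanarTree n} (ht : IsCyclicBracesTree t) (i : Fin n) :
    ∃ (D : Vertex i) (m : Mark), t = D.tree m := by
  obtain ⟨C, m, cs, hC, hcs, rfl⟩ := exists_plug_of_mem_labels (ht.2 i)
  exact ⟨⟨(C, cs), hC, hcs⟩, m, rfl⟩

theorem Vertex.unital_tree (D : Vertex i) (m : Mark) : Unital i (D.tree m) ↔ m.ones = 1 := by
  have key : ∀ cs : List (PlanarTree n), i ∉ labelsList cs → ∀ c ∈ cs, ¬ Unital i c := by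
    have key' : ∀ t : PlanarTree n, Unital i t → i ∈ labels t := by
      intro t ht
      induction t using PlanarTree.induction with
      | ext j m cs ih =>
        rw [labels, List.mem_cons, mem_labelsList]
        rcases unital_ext.1 ht with h | ⟨c, hc, h⟩
        · exact .inl h.1.symm
        · exact .inr ⟨c, hc, ih c hc h⟩
      | int cs ih =>
        obtain ⟨c, hc, h⟩ := unital_int.1 ht
        exact mem_labelsList.2 ⟨c, hc, ih c hc h⟩
    exact fun cs hcs c hc h => hcs (mem_labelsList.2 ⟨c, hc, key' c h⟩)
  obtain ⟨⟨C, cs⟩, hC, hcs⟩ := D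
  dsimp only at hC hcs
  dsimp only [Vertex.tree]
  induction C with
  | hole =>
    rw [Context.plug, unital_ext]
    have := key cs hcs
    simp only [true_and, or_iff_left_iff_imp]
    rintro ⟨c, hc, h⟩
    exact absurd h (this c hc)
  | ext j m' u C z ih =>
    rw [Context.plug, unital_ext, ← (show Unital i (C.plug (.ext i m cs)) ↔ m.ones = 1 from ih hC.2.2.1)]
    constructor
    · rintro (h | ⟨c, hc, h⟩)
      · exact absurd h.1 hC.1
      · simp only [List.mem_append, List.mem_cons] at hc
        rcases hc with hc | rfl | hc
        · exact absurd h (key u hC.2.1 c hc)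
        · exact h
        · exact absurd h (key z hC.2.2.2 c hc)
    · exact fun h => .inr ⟨_, by simp, h⟩
  | int u C z ih =>
    rw [Context.plug, unital_int, ← (show Unital i (C.plug (.ext i m cs)) ↔ m.ones = 1 from ih hC.2.1)]
    constructor
    · rintro ⟨c, hc, h⟩
      simp only [List.mem_append, List.mem_cons] at hc
      rcases hc with hc | rfl | hc
      · exact absurd h (key u hC.1 c hc)
      · exact h
      · exact absurd h (key z hC.2.2 c hc)
    · exact fun h => ⟨_, by simp, h⟩

theorem Vertex.labels_tree (D : Vertex i) (m m' : Mark) : labels (D.tree m) = labels (D.tree m') := by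
  obtain ⟨⟨C, cs⟩, hD⟩ := D
  dsimp only [Vertex.tree]
  clear hD
  induction C with
  | hole => rfl
  | ext j m' u C z ih => simp [Context.plug, labels, labelsList_append, labelsList, ih]
  | int u C z ih => simp [Context.plug, labels, labelsList_append, labelsList, ih]

theorem Vertex.degree_tree (D : Vertex i) (m m' : Mark) :
    degree (D.tree m) + m.ones = degree (D.tree m') + m'.ones := by
  obtain ⟨⟨C, cs⟩, hD⟩ := D
  dsimp only [Vertex.tree, degree]
  clear hD
  induction C with
  | hole => simp [Context.plug, numEdges, numInt]; ring
  | ext j m' u C z ih =>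
    simp [Context.plug, numEdges, numInt, numEdgesList_append, numIntList_append, numEdgesList,
      numIntList]
    linarith
  | int u C z ih =>
    simp [Context.plug, numEdges, numInt, numEdgesList_append, numIntList_append, numEdgesList,
      numIntList]
    linarith

theorem Vertex.wellFormed_tree (D : Vertex i) {m : Mark} (h : WellFormed (D.tree m)) (m' : Mark) :
    WellFormed (D.tree m') ↔ m'.InRange D.arity := by
  obtain ⟨⟨C, cs⟩, hD⟩ := D
  dsimp only [Vertex.tree, Vertex.arity] at h ⊢
  clear hD
  induction C with
  | hole => simp [Context.plug, WellFormed, h.2]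
  | ext j m u C z ih =>
    simp only [Context.plug, WellFormed, wellFormedList_iff, List.mem_append, List.mem_cons,
      List.length_append, List.length_cons] at *
    rw [← ih (h.2 _ (.inr (.inl rfl)))]
    refine ⟨fun h' => h'.2 _ (.inr (.inl rfl)), fun h' => ⟨h.1, ?_⟩⟩
    rintro c (hc | rfl | hc)
    · exact h.2 _ (.inl hc)
    · exact h'
    · exact h.2 _ (.inr (.inr hc))
  | int u C z ih =>
    simp only [Context.plug, WellFormed, wellFormedList_iff, List.mem_append, List.mem_cons,
      List.length_append, List.length_cons] at *
    rw [← ih (h.2 _ (.inr (.inl rfl)))]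
    refine ⟨fun h' => h'.2 _ (.inr (.inl rfl)), fun h' => ⟨h.1, ?_⟩⟩
    rintro c (hc | rfl | hc)
    · exact h.2 _ (.inl hc)
    · exact h'
    · exact h.2 _ (.inr (.inr hc))

theorem Vertex.rootMarkedOff_tree {S : Finset (Fin n)} (D : Vertex i) {m : Mark}
    (h : RootMarkedOff (insert i S) (D.tree m)) {m' : Mark} {S' : Finset (Fin n)} (hS : S ⊆ S')
    (hm : i ∈ S' ∨ m' = .edge 0) : RootMarkedOff S' (D.tree m') := by
  have key : ∀ cs : List (PlanarTree n), i ∉ labelsList cs →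
      (∀ c ∈ cs, RootMarkedOff (insert i S) c) → ∀ c ∈ cs, RootMarkedOff S' c :=
    fun cs hcs h c hc => ((h c hc).of_insert
      fun h' => hcs (mem_labelsList.2 ⟨c, hc, h'⟩)).mono hS
  obtain ⟨⟨C, cs⟩, hC, hcs⟩ := D
  dsimp only [Vertex.tree] at *
  induction C with
  | hole =>
    simp only [Context.plug, RootMarkedOff, rootMarkedOffList_iff] at *
    exact ⟨fun hi => hm.resolve_left hi, key cs hcs h.2⟩
  | ext j m u C z ih =>
    simp only [Context.plug, RootMarkedOff, rootMarkedOffList_iff, List.mem_append,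
      List.mem_cons] at *
    refine ⟨fun hj => h.1 fun hj' => ?_, ?_⟩
    · rcases Finset.mem_insert.1 hj' with h' | h'
      · exact hC.1 h'
      · exact hj (hS h')
    rintro c (hc | rfl | hc)
    · exact key u hC.2.1 (fun c hc => h.2 c (.inl hc)) c hc
    · exact ih hC.2.2.1 hcs (h.2 _ (.inr (.inl rfl)))
    · exact key z hC.2.2.2 (fun c hc => h.2 c (.inr (.inr hc))) c hc
  | int u C z ih =>
    simp only [Context.plug, RootMarkedOff, rootMarkedOffList_iff, List.mem_append,
      List.mem_cons] at *
    rintro c (hc | rfl | hc)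
    · exact key u hC.1 (fun c hc => h c (.inl hc)) c hc
    · exact ih hC.2.1 hcs (h _ (.inr (.inl rfl)))
    · exact key z hC.2.2 (fun c hc => h c (.inr (.inr hc))) c hc

theorem Vertex.admissible_tree {S : Finset (Fin n)} {p : ℤ} (D : Vertex i) {m : Mark}
    (h : Admissible (insert i S) p (D.tree m)) {m' : Mark} (hm : m'.InRange D.arity)
    {S' : Finset (Fin n)} (hS : S ⊆ S') (hi : i ∈ S' ∨ m' = .edge 0) :
    Admissible S' (p + m.ones - m'.ones) (D.tree m') := by
  refine ⟨⟨(D.wellFormed_tree h.1.1 m').2 hm, fun j => ?_⟩, D.rootMarkedOff_tree h.2.1 hS hi, ?_⟩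
  · rw [D.labels_tree m' m, h.1.2 j]
  · have := D.degree_tree m m'
    rw [h.2.2] at this
    linarith

end

/-! ### Linear operators on trees -/

section Linear

variable {n : ℕ} {K : Type*} [Field K] {N : Type*} [AddCommGroup N] [Module K N]

theorem ofTerms_eq_ev (L : List (ℤ × PlanarTree n)) :
    ofTerms K L = ev L fun t => Finsupp.single t (1 : K) := by
  rw [ofTerms, ev]
  congr 2
  funext p
  simp

theorem map_ev {M L : Type*} [AddCommGroup M] [Module K M] (φ : M →ₗ[K] N) (l : List (ℤ × L))
    (h : L → M) : φ (ev l h) = ev l fun t => φ (h t) := by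
  induction l with
  | nil => simp
  | cons p l ih => simp [ih]

theorem map_dTree_single (φ : (PlanarTree n →₀ K) →ₗ[K] N) (t : PlanarTree n) :
    φ (dTree K n (Finsupp.single t 1)) = ev (dTerms t) fun t' => φ (Finsupp.single t' 1) := by
  rw [dTree, Finsupp.linearCombination_single, one_smul, ofTerms_eq_ev, map_ev]

theorem dTree_single (t : PlanarTree n) :
    dTree K n (Finsupp.single t 1) = ev (dTerms t) fun t' => Finsupp.single t' 1 :=
  map_dTree_single (LinearMap.id : (PlanarTree n →₀ K) →ₗ[K] _) t

theorem ev_mem {L : Type*} {P : Submodule K N} {l : List (ℤ × L)} {h : L → N}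
    (H : ∀ p ∈ l, h p.2 ∈ P) : ev l h ∈ P := by
  induction l with
  | nil => simp
  | cons p l ih =>
    rw [ev_cons]
    exact P.add_mem (zsmul_mem (H p (by simp)) _) (ih fun q hq => H q (by simp [hq]))

theorem mem_of_mem_supported {α : Type*} {s : Set α} (φ : (α →₀ K) →ₗ[K] N) {P : Submodule K N}
    (H : ∀ t ∈ s, φ (Finsupp.single t 1) ∈ P) {x : α →₀ K} (hx : x ∈ Finsupp.supported K K s) :
    φ x ∈ P := by
  have : Finsupp.supported K K s ≤ P.comap φ := by
    rw [Finsupp.supported_eq_span_single, Submodule.span_le]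
    rintro - ⟨t, ht, rfl⟩
    exact H t ht
  exact this hx

theorem eq_of_mem_supported {α : Type*} {s : Set α} (φ ψ : (α →₀ K) →ₗ[K] N)
    (H : ∀ t ∈ s, φ (Finsupp.single t 1) = ψ (Finsupp.single t 1)) {x : α →₀ K}
    (hx : x ∈ Finsupp.supported K K s) : φ x = ψ x := by
  have := mem_of_mem_supported (φ - ψ) (P := ⊥) (s := s)
    (fun t ht => by simp [H t ht]) hx
  simpa [sub_eq_zero] using this

variable (K)

/-- The span of the trees of degree `p` whose vertices with label outside `S` are root-marked. -/
def subcomplex (S : Finset (Fin n)) (p : ℤ) : Submodule K (PlanarTree n →₀ K) :=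
  Finsupp.supported K K {t | Admissible S p t}

variable {K}

theorem single_mem_subcomplex {S : Finset (Fin n)} {p : ℤ} {t : PlanarTree n}
    (ht : Admissible S p t) : Finsupp.single t (1 : K) ∈ subcomplex K S p :=
  Finsupp.single_mem_supported K 1 ht

theorem subcomplex_mono {S S' : Finset (Fin n)} (h : S ⊆ S') (p : ℤ) :
    subcomplex K S p ≤ subcomplex K S' p := Finsupp.supported_mono fun _ ht => ht.mono h

theorem dTree_mem {S : Finset (Fin n)} {p : ℤ} {x : PlanarTree n →₀ K}
    (hx : x ∈ subcomplex K S p) : dTree K n x ∈ subcomplex K S (p + 1) := by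
  refine mem_of_mem_supported _ (fun t ht => ?_) hx
  rw [dTree_single]
  exact ev_mem fun q hq => single_mem_subcomplex (ht.of_mem_dTerms q hq)

theorem dTree_dTree {S : Finset (Fin n)} {p : ℤ} {x : PlanarTree n →₀ K}
    (hx : x ∈ subcomplex K S p) : dTree K n (dTree K n x) = 0 := by
  refine eq_of_mem_supported (dTree K n ∘ₗ dTree K n) 0 (fun t ht => ?_) hx
  rw [LinearMap.comp_apply, map_dTree_single]
  simp only [dTree_single]
  exact squareZero_of_wellFormed ht.1.1 _

/-! ### The operator that inserts an edge to `𝟙` -/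

/-- The sum over all ways of inserting an edge to `𝟙` at the vertex with label `i`, where the new
edge is put last. -/
noncomputable def unitMap (i : Fin n) : (PlanarTree n →₀ K) →ₗ[K] (PlanarTree n →₀ K) :=
  Finsupp.linearCombination K fun t => sgn (numEdges t) • ofTerms K (unitTerms i t)

theorem map_unitMap_single (φ : (PlanarTree n →₀ K) →ₗ[K] N) (i : Fin n) (t : PlanarTree n) :
    φ (unitMap i (Finsupp.single t 1)) =
      sgn (numEdges t) • ev (unitTerms i t) fun t' => φ (Finsupp.single t' 1) := by
  rw [unitMap, Finsupp.linearCombination_single, one_smul, ofTerms_eq_ev, map_zsmul, map_ev]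

theorem unitMap_single (i : Fin n) (t : PlanarTree n) :
    unitMap i (Finsupp.single t (1 : K)) =
      sgn (numEdges t) • ev (unitTerms i t) fun t' => Finsupp.single t' 1 :=
  map_unitMap_single (LinearMap.id : (PlanarTree n →₀ K) →ₗ[K] _) i t

theorem unitMap_mem {S : Finset (Fin n)} {p : ℤ} {x : PlanarTree n →₀ K}
    (hx : x ∈ subcomplex K S p) (i : Fin n) :
    unitMap i x ∈ subcomplex K (insert i S) (p - 1) := by
  refine mem_of_mem_supported _ (fun t ht => ?_) hx
  rw [unitMap_single]
  exact zsmul_mem (ev_mem fun q hq => single_mem_subcomplex (ht.of_mem_unitTerms q hq)) _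

/-- With the new edge in front, insertion and `d` anticommute. Moving it to the end multiplies by
the parity of the number of edges, which `d` changes, so the operators commute. -/
theorem unitMap_dTree {S : Finset (Fin n)} {p : ℤ} {x : PlanarTree n →₀ K}
    (hx : x ∈ subcomplex K S p) {i : Fin n} (hi : i ∉ S) :
    unitMap i (dTree K n x) = dTree K n (unitMap i x) := by
  refine eq_of_mem_supported (unitMap i ∘ₗ dTree K n) (dTree K n ∘ₗ unitMap i) (fun t ht => ?_) hx
  rw [LinearMap.comp_apply, LinearMap.comp_apply, map_dTree_single, map_unitMap_single]
  simp only [unitMap_single, dTree_single]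
  have h1 : ∀ q ∈ dTerms t, sgn (numEdges q.2) = - sgn (numEdges t) := by
    intro q hq
    have := tsign_of_mem_dTerms t q hq
    simp only [tsign, sgn_add, sgn_one] at this
    linarith
  rw [ev_congr (h' := fun t' => (- sgn (numEdges t)) • ev (unitTerms i t')
    fun t => Finsupp.single t (1 : K)) fun q hq => by rw [h1 q hq], ev_zsmul, neg_smul, ← smul_neg]
  congr 1
  exact neg_eq_of_add_eq_zero_right
    (unitAnticomm_of_wellFormed hi ht.1.1 ht.2.1 (ht.1.2 i).le _)

/-! ### The contraction -/

variable {i : Fin n}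

theorem Vertex.unitTerms_tree (D : Vertex i) {W : Type*} [AddCommGroup W] (h : PlanarTree n → W) :
    ev (unitTerms i (D.tree (.edge 0))) h =
      D.sign • ∑ l ∈ Finset.range (D.arity + 1), h (D.tree (.unit l)) :=
  ev_unitTerms_plug_ext D.2.1 D.2.2 h

/-- The boundary map of a circle whose 0-cells are the edges and whose 1-cells are the corners of
the vertex; corner `D.arity` leads back to edge `0`. -/
theorem Vertex.dTerms_tree (D : Vertex i) {W : Type*} [AddCommGroup W] {h : PlanarTree n → W}
    (hh : ∀ t, Unital i t → h t = 0) (j : ℕ) : ev (dTerms (D.tree (.unit j))) h =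
      D.sign • (h (D.tree (.edge (if j = D.arity then 0 else j + 1))) - h (D.tree (.edge j))) := by
  have h1 : ∀ t, Unital i t → h (D.1.1.plug t) = 0 := by
    intro t ht
    refine hh _ ?_
    generalize D.1.1 = C
    induction C with
    | hole => exact ht
    | ext j m u C z ih => exact unital_ext.2 (.inr ⟨_, by simp, ih⟩)
    | int u C z ih => exact unital_int.2 ⟨_, by simp, ih⟩
  rw [Vertex.tree, ev_dTerms_plug hh D.1.1 (unital_ext.2 (.inl ⟨rfl, rfl⟩)),
    ev_dTerms_ext_unit (h := fun t' => h (D.1.1.plug t')) h1]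
  rfl

variable (i) in
/-- A contracting homotopy for the passage from edges to `𝟙` to marks at edges. -/
noncomputable def turnHomotopy : (PlanarTree n →₀ K) →ₗ[K] (PlanarTree n →₀ K) :=
  -- Trees without exactly one vertex labelled `i` are sent to the default value `0`.
  Finsupp.linearCombination K (Function.extend (fun x : Vertex i × Mark => x.1.tree x.2)
    (fun x => match x.2 with
      -- The path on the circle from edge `0` to edge `j` through the corners `0, …, j - 1`.
      | .edge j => x.1.sign • ∑ l ∈ Finset.range j, Finsupp.single (x.1.tree (.unit l)) (1 : K)
      | .unit _ => 0) 0)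

variable (i) in
/-- A left inverse of the insertion of edges to `𝟙`. -/
noncomputable def lastUnit : (PlanarTree n →₀ K) →ₗ[K] (PlanarTree n →₀ K) :=
  Finsupp.linearCombination K (Function.extend (fun x : Vertex i × Mark => x.1.tree x.2)
    (fun x => match x.2 with
      | .edge _ => 0
      -- No path of `turnHomotopy` at an admissible mark uses the last corner, so its coefficient
      -- detects the multiple of the full circle. The signs invert those in `unitMap_tree`.
      | .unit j => if j = x.1.arity then (sgn (numEdges (x.1.tree (.edge 0))) * x.1.sign) •
          Finsupp.single (x.1.tree (.edge 0)) (1 : K) else 0) 0)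

variable (i) in
/-- The projection onto the trees in which the vertex `i` is marked at an edge. -/
noncomputable def nonunital : (PlanarTree n →₀ K) →ₗ[K] (PlanarTree n →₀ K) :=
  open Classical in
  Finsupp.linearCombination K fun t => if Unital i t then 0 else Finsupp.single t 1

theorem turnHomotopy_edge (D : Vertex i) (j : ℕ) :
    turnHomotopy i (Finsupp.single (D.tree (.edge j)) (1 : K)) =
      D.sign • ∑ l ∈ Finset.range j, Finsupp.single (D.tree (.unit l)) 1 := by
  rw [turnHomotopy, Finsupp.linearCombination_single, one_smul]
  exact Vertex.tree_injective.extend_apply _ _ (D, Mark.edge j)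

theorem turnHomotopy_unit (D : Vertex i) (j : ℕ) :
    turnHomotopy i (Finsupp.single (D.tree (.unit j)) (1 : K)) = 0 := by
  rw [turnHomotopy, Finsupp.linearCombination_single, one_smul]
  exact Vertex.tree_injective.extend_apply _ _ (D, Mark.unit j)

theorem lastUnit_edge (D : Vertex i) (j : ℕ) :
    lastUnit i (Finsupp.single (D.tree (.edge j)) (1 : K)) = 0 := by
  rw [lastUnit, Finsupp.linearCombination_single, one_smul]
  exact Vertex.tree_injective.extend_apply _ _ (D, Mark.edge j)

theorem lastUnit_unit (D : Vertex i) (j : ℕ) :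
    lastUnit i (Finsupp.single (D.tree (.unit j)) (1 : K)) = if j = D.arity then
      (sgn (numEdges (D.tree (.edge 0))) * D.sign) • Finsupp.single (D.tree (.edge 0)) 1 else 0 := by
  rw [lastUnit, Finsupp.linearCombination_single, one_smul]
  exact Vertex.tree_injective.extend_apply _ _ (D, Mark.unit j)

theorem nonunital_of_unital {t : PlanarTree n} (ht : Unital i t) :
    nonunital i (Finsupp.single t (1 : K)) = 0 := by
  simp [nonunital, ht]

theorem nonunital_of_not_unital {t : PlanarTree n} (ht : ¬ Unital i t) :
    nonunital i (Finsupp.single t (1 : K)) = Finsupp.single t 1 := by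
  simp [nonunital, ht]

theorem nonunital_edge (D : Vertex i) (j : ℕ) :
    nonunital i (Finsupp.single (D.tree (.edge j)) (1 : K)) = Finsupp.single (D.tree (.edge j)) 1 :=
  nonunital_of_not_unital (by rw [D.unital_tree]; simp [Mark.ones])

theorem nonunital_unit (D : Vertex i) (j : ℕ) :
    nonunital i (Finsupp.single (D.tree (.unit j)) (1 : K)) = 0 :=
  nonunital_of_unital (by rw [D.unital_tree]; simp [Mark.ones])

theorem unitMap_tree (D : Vertex i) : unitMap i (Finsupp.single (D.tree (.edge 0)) (1 : K)) =
    (sgn (numEdges (D.tree (.edge 0))) * D.sign) •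
      ∑ l ∈ Finset.range (D.arity + 1), Finsupp.single (D.tree (.unit l)) 1 := by
  rw [unitMap_single, D.unitTerms_tree, smul_smul]

theorem nonunital_dTree_unit (D : Vertex i) (j : ℕ) :
    nonunital i (dTree K n (Finsupp.single (D.tree (.unit j)) 1)) =
      D.sign • (Finsupp.single (D.tree (.edge (if j = D.arity then 0 else j + 1))) 1 -
        Finsupp.single (D.tree (.edge j)) 1) := by
  rw [map_dTree_single, D.dTerms_tree fun t ht => nonunital_of_unital ht, nonunital_edge,
    nonunital_edge]

end Linear

-- Adding one label to the set of unrestricted vertices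

section Contraction

variable {n : ℕ} {K : Type*} [Field K] {i : Fin n} {S : Finset (Fin n)} {p : ℤ}
  {x y : PlanarTree n →₀ K}

theorem Admissible.exists_tree {t : PlanarTree n} (ht : Admissible S p t) (i : Fin n) :
    ∃ (D : Vertex i) (m : Mark), t = D.tree m ∧ m.InRange D.arity := by
  obtain ⟨D, m, rfl⟩ := exists_vertex ht.1 i
  exact ⟨D, m, rfl, (D.wellFormed_tree ht.1.1 m).1 ht.1.1⟩

theorem Admissible.exists_tree_of_notMem {t : PlanarTree n} (ht : Admissible S p t) (hi : i ∉ S) :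
    ∃ D : Vertex i, t = D.tree (.edge 0) := by
  obtain ⟨D, m, rfl, -⟩ := ht.exists_tree i
  refine ⟨D, ?_⟩
  obtain ⟨⟨C, cs⟩, h⟩ := D
  have := ht.2.1
  dsimp only [Vertex.tree] at this ⊢
  suffices m = .edge 0 by rw [this]
  clear ht h
  induction C with
  | hole =>
    simp only [Context.plug, RootMarkedOff] at this
    exact this.1 hi
  | ext j m' u C z ih =>
    simp only [Context.plug, RootMarkedOff, rootMarkedOffList_iff] at this
    exact ih (this.2 _ (by simp))
  | int u C z ih =>
    simp only [Context.plug, RootMarkedOff, rootMarkedOffList_iff] at this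
    exact ih (this _ (by simp))

theorem nonunital_eq_self (hi : i ∉ S) (hx : x ∈ subcomplex K S p) : nonunital i x = x :=
  eq_of_mem_supported (nonunital i) LinearMap.id (fun _ ht => nonunital_of_not_unital
    (not_unital_of_rootMarkedOff hi ht.2.1)) hx

theorem turnHomotopy_eq_zero (hi : i ∉ S) (hx : x ∈ subcomplex K S p) : turnHomotopy i x = 0 := by
  refine eq_of_mem_supported (turnHomotopy i) 0 (fun t ht => ?_) hx
  obtain ⟨D, rfl⟩ := Admissible.exists_tree_of_notMem ht hi
  simp [turnHomotopy_edge]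

theorem turnHomotopy_unitMap (hi : i ∉ S) (hx : x ∈ subcomplex K S p) :
    turnHomotopy i (unitMap i x) = 0 := by
  refine eq_of_mem_supported (turnHomotopy i ∘ₗ unitMap i) 0 (fun t ht => ?_) hx
  obtain ⟨D, rfl⟩ := Admissible.exists_tree_of_notMem ht hi
  simp [unitMap_tree, turnHomotopy_unit]

theorem nonunital_unitMap (hi : i ∉ S) (hx : x ∈ subcomplex K S p) :
    nonunital i (unitMap i x) = 0 := by
  refine eq_of_mem_supported (nonunital i ∘ₗ unitMap i) 0 (fun t ht => ?_) hx
  obtain ⟨D, rfl⟩ := Admissible.exists_tree_of_notMem ht hi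
  simp [unitMap_tree, nonunital_unit]

theorem lastUnit_unitMap (hi : i ∉ S) (hx : x ∈ subcomplex K S p) :
    lastUnit i (unitMap i x) = x := by
  refine eq_of_mem_supported (lastUnit i ∘ₗ unitMap i) LinearMap.id (fun t ht => ?_) hx
  obtain ⟨D, rfl⟩ := Admissible.exists_tree_of_notMem ht hi
  have h1 : sgn (numEdges (D.tree (.edge 0))) * D.sign *
      (sgn (numEdges (D.tree (.edge 0))) * D.sign) = 1 := by
    rw [mul_mul_mul_comm, sgn_mul_self, D.sign_mul_self, one_mul]
  rw [LinearMap.comp_apply, unitMap_tree, map_zsmul, map_sum, Finset.sum_range_succ,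
    Finset.sum_eq_zero fun l hl => ?_, zero_add, lastUnit_unit, if_pos rfl, smul_smul, h1, one_smul]
  · rfl
  · rw [lastUnit_unit, if_neg (Finset.mem_range.1 hl).ne]

theorem turnHomotopy_mem (hy : y ∈ subcomplex K (insert i S) p) :
    turnHomotopy i y ∈ subcomplex K (insert i S) (p - 1) := by
  refine mem_of_mem_supported _ (fun t ht => ?_) hy
  obtain ⟨D, m, rfl, hm⟩ := Admissible.exists_tree ht i
  cases m with
  | edge j =>
    rw [turnHomotopy_edge]
    refine zsmul_mem (Submodule.sum_mem _ fun l hl => single_mem_subcomplex ?_) _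
    have := D.admissible_tree ht (m' := .unit l) ((Finset.mem_range.1 hl).le.trans hm)
      (Finset.subset_insert i S) (.inl (Finset.mem_insert_self i S))
    simpa [Mark.ones] using this
  | unit j =>
    rw [turnHomotopy_unit]
    exact Submodule.zero_mem _

theorem lastUnit_mem (hy : y ∈ subcomplex K (insert i S) p) :
    lastUnit i y ∈ subcomplex K S (p + 1) := by
  refine mem_of_mem_supported _ (fun t ht => ?_) hy
  obtain ⟨D, m, rfl, hm⟩ := Admissible.exists_tree ht i
  cases m with
  | edge j =>
    rw [lastUnit_edge]
    exact Submodule.zero_mem _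
  | unit j =>
    rw [lastUnit_unit]
    split_ifs
    · refine zsmul_mem (single_mem_subcomplex ?_) _
      have := D.admissible_tree ht (m' := .edge 0) (Nat.zero_le _) subset_rfl (.inr rfl)
      simpa [Mark.ones] using this
    · exact Submodule.zero_mem _

/-- The boundary of the path from edge `0` to edge `j` telescopes, so the correction replaces each
mark at edge `j` by the mark at edge `0`. -/
theorem nonunital_sub_mem (hy : y ∈ subcomplex K (insert i S) p) :
    nonunital i y - nonunital i (dTree K n (turnHomotopy i y)) ∈ subcomplex K S p := by
  refine mem_of_mem_supported (nonunital i - nonunital i ∘ₗ dTree K n ∘ₗ turnHomotopy i)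
    (fun t ht => ?_) hy
  obtain ⟨D, m, rfl, hm⟩ := Admissible.exists_tree ht i
  simp only [LinearMap.sub_apply, LinearMap.comp_apply]
  cases m with
  | edge j =>
    rw [turnHomotopy_edge, nonunital_edge]
    simp only [map_zsmul, map_sum, nonunital_dTree_unit]
    have h1 : ∀ l ∈ Finset.range j, D.sign •
        (Finsupp.single (D.tree (.edge (if l = D.arity then 0 else l + 1))) (1 : K) -
          Finsupp.single (D.tree (.edge l)) 1) =
        D.sign • (Finsupp.single (D.tree (.edge (l + 1))) (1 : K) -
          Finsupp.single (D.tree (.edge l)) 1) := by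
      intro l hl
      -- The path stays before the last corner, where the numbering of the edges would wrap around.
      have h2 : l < D.arity := (Finset.mem_range.1 hl).trans_le hm
      rw [if_neg h2.ne]
    rw [Finset.sum_congr rfl h1, ← Finset.smul_sum, smul_smul, D.sign_mul_self, one_smul,
      Finset.sum_range_sub fun l => Finsupp.single (D.tree (.edge l)) (1 : K), sub_sub_cancel]
    refine single_mem_subcomplex ?_
    have := D.admissible_tree ht (m' := .edge 0) (Nat.zero_le _) subset_rfl (.inr rfl)
    simpa [Mark.ones] using this
  | unit j =>
    rw [turnHomotopy_unit, nonunital_unit, map_zero, map_zero, sub_zero]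
    exact Submodule.zero_mem _

theorem turnHomotopy_nonunital (y : PlanarTree n →₀ K) (hy : y ∈ subcomplex K S p) :
    turnHomotopy i (nonunital i y) = turnHomotopy i y := by
  refine eq_of_mem_supported (turnHomotopy i ∘ₗ nonunital i) (turnHomotopy i) (fun t ht => ?_) hy
  obtain ⟨D, m, rfl, hm⟩ := Admissible.exists_tree ht i
  cases m with
  | edge j => simp [nonunital_edge]
  | unit j => simp [nonunital_unit, turnHomotopy_unit]

/-- The paths to the two ends of corner `j` differ by this corner. At the last corner they differ by
minus all the other corners, and the full circle supplied by `unitMap i (lastUnit i y)` corrects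
this. -/
theorem turnHomotopy_dTree_add (hy : y ∈ subcomplex K S p) :
    turnHomotopy i (dTree K n (y - nonunital i y)) + unitMap i (lastUnit i y) =
      y - nonunital i y := by
  refine eq_of_mem_supported (turnHomotopy i ∘ₗ dTree K n ∘ₗ (LinearMap.id - nonunital i) +
    unitMap i ∘ₗ lastUnit i) (LinearMap.id - nonunital i) (fun t ht => ?_) hy
  obtain ⟨D, m, rfl, hm⟩ := Admissible.exists_tree ht i
  simp only [LinearMap.add_apply, LinearMap.sub_apply, LinearMap.comp_apply, LinearMap.id_apply]
  cases m with
  | edge j => simp [nonunital_edge, lastUnit_edge]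
  | unit j =>
    rw [nonunital_unit, sub_zero, ← turnHomotopy_nonunital _ (dTree_mem (single_mem_subcomplex ht)),
      nonunital_dTree_unit, lastUnit_unit, map_zsmul, map_sub, turnHomotopy_edge, turnHomotopy_edge,
      ← zsmul_sub, smul_smul, D.sign_mul_self, one_smul]
    have h1 : sgn (numEdges (D.tree (.edge 0))) * D.sign *
        (sgn (numEdges (D.tree (.edge 0))) * D.sign) = 1 := by
      rw [mul_mul_mul_comm, sgn_mul_self, D.sign_mul_self, one_mul]
    -- At the last corner the following edge is edge `0`, whose path is empty.
    split_ifs with hj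
    · subst hj
      rw [map_zsmul, unitMap_tree, smul_smul, h1, one_smul, Finset.sum_range_succ]
      simp
    · rw [Finset.sum_range_succ]
      simp

/-- Passing from root-marked vertices with label `i` to arbitrary ones amounts to a direct sum of two
copies of the complex, up to an acyclic complex. -/
theorem exists_of_add_unitMap_eq (hi : i ∉ S) {x' : PlanarTree n →₀ K}
    (hx : x ∈ subcomplex K S (p + 1)) (hx' : x' ∈ subcomplex K S (p + 1 + 1))
    (hy : y ∈ subcomplex K (insert i S) p) (h : x + unitMap i x' = dTree K n y) :
    ∃ w ∈ subcomplex K S p, ∃ w' ∈ subcomplex K S (p + 1),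
      ∃ z ∈ subcomplex K (insert i S) (p - 1),
        x = dTree K n w ∧ x' = dTree K n w' ∧ y = w + unitMap i w' + dTree K n z := by
  set u := turnHomotopy i y with hu
  -- All marks at `i` in `y` are moved to the root along the boundary of `u`; what remains, `y'`,
  -- has an edge to `𝟙` at `i` in every term.
  set w := nonunital i y - nonunital i (dTree K n u) with hw
  have hum : u ∈ subcomplex K (insert i S) (p - 1) := turnHomotopy_mem hy
  have hwm : w ∈ subcomplex K S p := nonunital_sub_mem hy
  have hdu : dTree K n u ∈ subcomplex K (insert i S) p := by simpa using dTree_mem hum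
  set y' := y - w - dTree K n u with hy'
  have hym : y' ∈ subcomplex K (insert i S) p := Submodule.sub_mem _
    (Submodule.sub_mem _ hy (subcomplex_mono (Finset.subset_insert i S) p hwm)) hdu
  have h1 : nonunital i y' = 0 := by
    rw [hy', map_sub, map_sub, nonunital_eq_self hi hwm, hw, sub_sub_cancel, sub_self]
  set x₁ := x - dTree K n w with hx₁
  have hx₁m : x₁ ∈ subcomplex K S (p + 1) := Submodule.sub_mem _ hx (dTree_mem hwm)
  have h2 : dTree K n y' = x₁ + unitMap i x' := by
    rw [hy', map_sub, map_sub, ← h, dTree_dTree hum, hx₁]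
    abel
  have h3 := turnHomotopy_dTree_add (i := i) hym
  set w' := lastUnit i y' with hw'
  have hw'm : w' ∈ subcomplex K S (p + 1) := lastUnit_mem hym
  -- `turnHomotopy` kills root marks and edges to `𝟙`, hence the whole of `dTree K n y'`. This
  -- leaves `y' = unitMap i w'`.
  rw [h1, sub_zero, h2, map_add, turnHomotopy_eq_zero hi hx₁m, turnHomotopy_unitMap hi hx', zero_add,
    zero_add] at h3
  have h4 : x₁ + unitMap i x' = unitMap i (dTree K n w') := by
    rw [← h2, ← h3, unitMap_dTree hw'm hi]
  -- `x₁` has a mark at an edge of `i`, the other two terms have `𝟙` there; the projection separates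
  -- them.
  have h5 : x₁ = 0 := by
    have := congrArg (nonunital i) h4
    rwa [map_add, nonunital_eq_self hi hx₁m, nonunital_unitMap hi hx',
      nonunital_unitMap hi (dTree_mem hw'm), add_zero] at this
  rw [h5, zero_add] at h4
  refine ⟨w, hwm, w', hw'm, u, hum, sub_eq_zero.1 h5, ?_, ?_⟩
  · rw [← lastUnit_unitMap hi hx', h4, lastUnit_unitMap hi (dTree_mem hw'm)]
  · rw [h3, hy']
    abel

end Contraction

section InsertUnits

variable {n : ℕ} {W : Type*} [AddCommGroup W] {i : Fin n} {A : Finset (Fin n)}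

/-! ### Sums over lists -/

/-- The sum of the values of a function on the entries of a list. -/
def lsum {α : Type*} (l : List α) (h : α → W) : W := (l.map h).sum

section

variable {α β : Type*}

@[simp] theorem lsum_nil (h : α → W) : lsum [] h = 0 := rfl

@[simp] theorem lsum_cons (a : α) (l : List α) (h : α → W) : lsum (a :: l) h = h a + lsum l h := by
  simp [lsum]

theorem lsum_congr {l : List α} {h h' : α → W} (H : ∀ a ∈ l, h a = h' a) : lsum l h = lsum l h' := by
  rw [lsum, lsum, List.map_congr_left H]

theorem lsum_append (l l' : List α) (h : α → W) : lsum (l ++ l') h = lsum l h + lsum l' h := by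
  simp [lsum]

theorem lsum_map (f : β → α) (l : List β) (h : α → W) : lsum (l.map f) h = lsum l fun b => h (f b) := by
  simp [lsum, Function.comp_def]

theorem lsum_flatMap (f : β → List α) (l : List β) (h : α → W) :
    lsum (l.flatMap f) h = lsum l fun b => lsum (f b) h := by
  induction l with
  | nil => rfl
  | cons b l ih => rw [List.flatMap_cons, lsum_append, ih, lsum_cons]

theorem lsum_zero (l : List α) : lsum l (fun _ => (0 : W)) = 0 := by
  induction l with
  | nil => rfl
  | cons b l ih => simp [ih]

theorem lsum_add (l : List α) (h h' : α → W) :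
    lsum l (fun a => h a + h' a) = lsum l h + lsum l h' := by
  induction l with
  | nil => simp
  | cons b l ih => simp only [lsum_cons, ih]; abel

theorem lsum_comm (l : List α) (l' : List β) (h : α → β → W) :
    lsum l (fun a => lsum l' (h a)) = lsum l' fun b => lsum l fun a => h a b := by
  induction l with
  | nil => simp [lsum_zero]
  | cons a l ih => simp only [lsum_cons, ih, lsum_add]

end

/-! ### Inserting one more edge -/

theorem lsum_insertUnitsList_append (A : Finset (Fin n)) (u z : List (PlanarTree n))
    (h : List (PlanarTree n) → W) : lsum (insertUnitsList A (u ++ z)) h =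
      lsum (insertUnitsList A u) fun u' => lsum (insertUnitsList A z) fun z' => h (u' ++ z') := by
  induction u generalizing h with
  | nil => simp [insertUnitsList]
  | cons c u ih =>
    simp only [List.cons_append, insertUnitsList, lsum_flatMap, lsum_map]
    refine lsum_congr fun c' _ => ?_
    rw [ih fun y => h (c' :: y)]

theorem insertUnitsList_congr {A B : Finset (Fin n)} {cs : List (PlanarTree n)}
    (h : ∀ c ∈ cs, insertUnits A c = insertUnits B c) :
    insertUnitsList A cs = insertUnitsList B cs := by
  induction cs with
  | nil => rfl
  | cons c cs ih =>
    rw [insertUnitsList, insertUnitsList, h c (by simp), ih fun c hc => h c (by simp [hc])]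

theorem insertUnits_insert_of_notMem {t : PlanarTree n} (h : i ∉ labels t) :
    insertUnits (insert i A) t = insertUnits A t := by
  induction t using PlanarTree.induction with
  | ext j m cs ih =>
    simp only [labels, List.mem_cons, not_or, mem_labelsList, not_exists, not_and] at h
    rw [insertUnits, insertUnits, insertUnitsList_congr fun c hc => ih c hc (h.2 c hc)]
    simp [Finset.mem_insert, Ne.symm h.1]
  | int cs ih =>
    simp only [labels, mem_labelsList, not_exists, not_and] at h
    rw [insertUnits, insertUnits, insertUnitsList_congr fun c hc => ih c hc (h c hc)]

theorem insertUnitsList_insert_of_notMem {cs : List (PlanarTree n)} (h : i ∉ labelsList cs) :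
    insertUnitsList (insert i A) cs = insertUnitsList A cs :=
  insertUnitsList_congr fun c hc => insertUnits_insert_of_notMem
    fun h' => h (mem_labelsList.2 ⟨c, hc, h'⟩)

theorem forall₂_of_mem_insertUnitsList {cs cs' : List (PlanarTree n)}
    (h : cs' ∈ insertUnitsList A cs) : List.Forall₂ (fun c c' => c' ∈ insertUnits A c) cs cs' := by
  induction cs generalizing cs' with
  | nil => simp_all [insertUnitsList]
  | cons c cs ih =>
    simp only [insertUnitsList, List.mem_flatMap, List.mem_map] at h
    obtain ⟨c', hc', cs'', hcs, rfl⟩ := h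
    exact .cons hc' (ih hcs)

theorem labelsList_congr {cs cs' : List (PlanarTree n)}
    (h : List.Forall₂ (fun c c' => labels c' = labels c) cs cs') : labelsList cs' = labelsList cs := by
  induction h with
  | nil => rfl
  | cons h _ ih => rw [labelsList, labelsList, h, ih]

theorem mem_insertUnits_ext {j : Fin n} {m : Mark} {cs : List (PlanarTree n)} {t : PlanarTree n} :
    t ∈ insertUnits A (.ext j m cs) ↔ ∃ cs' ∈ insertUnitsList A cs,
      ∃ m' ∈ (if j ∈ A then (List.range (cs.length + 1)).map .unit else [.edge 0]),
        t = .ext j m' cs' := by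
  rw [insertUnits, List.mem_flatMap]
  refine exists_congr fun cs' => and_congr_right fun _ => ?_
  split_ifs <;> simp [eq_comm]

theorem lsum_insertUnits_ext (j : Fin n) (m : Mark) (cs : List (PlanarTree n))
    (h : PlanarTree n → W) : lsum (insertUnits A (.ext j m cs)) h =
      lsum (insertUnitsList A cs) fun cs' =>
        lsum (if j ∈ A then (List.range (cs.length + 1)).map .unit else [.edge 0])
          fun m' => h (.ext j m' cs') := by
  rw [insertUnits, lsum_flatMap]
  refine lsum_congr fun cs' _ => ?_
  split_ifs <;> simp [lsum_map]

theorem labels_of_mem_insertUnits (t : PlanarTree n) :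
    ∀ t' ∈ insertUnits A t, labels t' = labels t := by
  have key : ∀ cs : List (PlanarTree n), (∀ c ∈ cs, ∀ c' ∈ insertUnits A c, labels c' = labels c) →
      ∀ cs' ∈ insertUnitsList A cs, labelsList cs' = labelsList cs := by
    intro cs H cs' h
    refine labelsList_congr (List.forall₂_iff_get.2 ?_)
    obtain ⟨h1, h2⟩ := List.forall₂_iff_get.1 (forall₂_of_mem_insertUnitsList h)
    exact ⟨h1, fun k hk hk' => H _ (List.get_mem _ _) _ (h2 k hk hk')⟩
  induction t using PlanarTree.induction with
  | ext j m cs ih =>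
    intro t' ht
    obtain ⟨cs', hcs, m', -, rfl⟩ := mem_insertUnits_ext.1 ht
    rw [labels, labels, key cs ih cs' hcs]
  | int cs ih =>
    intro t' ht
    simp only [insertUnits, List.mem_map] at ht
    obtain ⟨cs', hcs, rfl⟩ := ht
    rw [labels, labels, key cs ih cs' hcs]

theorem labelsList_of_mem_insertUnitsList {cs cs' : List (PlanarTree n)}
    (h : cs' ∈ insertUnitsList A cs) : labelsList cs' = labelsList cs := by
  refine labelsList_congr (List.forall₂_iff_get.2 ?_)
  obtain ⟨h1, h2⟩ := List.forall₂_iff_get.1 (forall₂_of_mem_insertUnitsList h)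
  exact ⟨h1, fun k hk hk' => labels_of_mem_insertUnits _ _ (h2 k hk hk')⟩

theorem lsum_unitTermsList_of_notMem {u z : List (PlanarTree n)} (hu : i ∉ labelsList u)
    (hz : i ∉ labelsList z) (c : PlanarTree n) (h : List (PlanarTree n) → W) :
    lsum (unitTermsList i (u ++ c :: z)) (fun p => h p.2) =
      lsum (unitTerms i c) fun p => h (u ++ p.2 :: z) := by
  have hnil : ∀ cs : List (PlanarTree n), i ∉ labelsList cs → unitTermsList i cs = [] :=
    fun cs hcs => unitTermsList_eq_nil fun c hc => unitTerms_eq_nil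
      fun h' => hcs (mem_labelsList.2 ⟨c, hc, h'⟩)
  induction u generalizing h with
  | nil => simp [unitTermsList, hnil z hz, lsum_map]
  | cons a u ih =>
    simp only [labelsList, List.mem_append, not_or] at hu
    rw [List.cons_append, unitTermsList, unitTerms_eq_nil hu.1, List.map_nil, List.nil_append,
      lsum_map]
    exact ih hu.2 fun y => h (a :: y)

theorem lsum_insertUnitsList_insert {u z : List (PlanarTree n)} {c : PlanarTree n}
    (hu : i ∉ labelsList u) (hz : i ∉ labelsList z)
    (hc : ∀ h : PlanarTree n → W, lsum (insertUnits (insert i A) c) h =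
      lsum (insertUnits A c) fun t' => lsum (unitTerms i t') fun p => h p.2)
    (h : List (PlanarTree n) → W) :
    lsum (insertUnitsList (insert i A) (u ++ c :: z)) h =
      lsum (insertUnitsList A (u ++ c :: z)) fun y => lsum (unitTermsList i y) fun p => h p.2 := by
  rw [lsum_insertUnitsList_append, lsum_insertUnitsList_append, insertUnitsList_insert_of_notMem hu]
  refine lsum_congr fun u' hu' => ?_
  rw [← labelsList_of_mem_insertUnitsList hu'] at hu
  rw [insertUnitsList, insertUnitsList, lsum_flatMap, lsum_flatMap,
    insertUnitsList_insert_of_notMem hz, hc]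
  refine lsum_congr fun c' _ => ?_
  simp only [lsum_map]
  rw [lsum_comm (unitTerms i c') (insertUnitsList A z) fun p z' => h (u' ++ p.2 :: z')]
  refine lsum_congr fun z' hz' => ?_
  rw [← labelsList_of_mem_insertUnitsList hz'] at hz
  rw [lsum_unitTermsList_of_notMem hu hz]

/-- The choices of corners at different vertices are independent, and there is just one vertex
labelled `i`, so its corner can be chosen last. Signs play no role here. -/
theorem lsum_insertUnits_insert (hi : i ∉ A) {t : PlanarTree n} (ht : (labels t).count i = 1)
    (h : PlanarTree n → W) : lsum (insertUnits (insert i A) t) h =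
      lsum (insertUnits A t) fun t' => lsum (unitTerms i t') fun p => h p.2 := by
  obtain ⟨C, m, cs, hC, hcs, rfl⟩ := exists_plug_of_mem_labels ht
  clear ht
  induction C generalizing h with
  | hole =>
    rw [Context.plug, lsum_insertUnits_ext, lsum_insertUnits_ext, insertUnitsList_insert_of_notMem hcs]
    refine lsum_congr fun cs' hcs' => ?_
    have h1 : unitTermsList i cs' = [] := unitTermsList_eq_nil fun c hc => unitTerms_eq_nil
      fun h' => hcs (labelsList_of_mem_insertUnitsList hcs' ▸ mem_labelsList.2 ⟨c, hc, h'⟩)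
    have h2 := (forall₂_of_mem_insertUnitsList hcs').length_eq
    simp [hi, unitTerms, h1, lsum_map, h2]
  | ext j m' u C z ih =>
    have hji : j ∈ insert i A ↔ j ∈ A := by simp [hC.1]
    rw [Context.plug, lsum_insertUnits_ext, lsum_insertUnits_ext,
      lsum_insertUnitsList_insert hC.2.1 hC.2.2.2 fun h => ih h hC.2.2.1]
    refine lsum_congr fun y _ => ?_
    simp only [hji]
    rw [lsum_comm]
    refine lsum_congr fun m'' _ => ?_
    have : unitTerms i (.ext j m'' y) =
        (unitTermsList i y).map fun p => (sgn m''.ones * p.1, .ext j m'' p.2) := by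
      rcases m'' with (_ | k) | k <;> simp [unitTerms, hC.1]
    rw [this, lsum_map]
  | int u C z ih =>
    rw [Context.plug, insertUnits, insertUnits, lsum_map, lsum_map,
      lsum_insertUnitsList_insert hC.1 hC.2.2 fun h => ih h hC.2.1]
    refine lsum_congr fun y _ => ?_
    rw [unitTerms, lsum_map]

end InsertUnits

/-! ### The sign of the order of the edges -/

section Words

variable {n : ℕ} {i : Fin n} {A : Finset (Fin n)}

theorem edgeWordList_append (u z : List (PlanarTree n)) :
    edgeWordList (u ++ z) = edgeWordList u ++ edgeWordList z := by
  induction u with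
  | nil => rfl
  | cons c u ih => simp [edgeWordList, ih]

theorem length_edgeWord (t : PlanarTree n) : (edgeWord t).length = numEdges t := by
  have key : ∀ cs : List (PlanarTree n), (∀ c ∈ cs, (edgeWord c).length = numEdges c) →
      (edgeWordList cs).length = numEdgesList cs := by
    intro cs h
    induction cs with
    | nil => rfl
    | cons c cs ih =>
      simp only [edgeWordList, numEdgesList, List.length_cons, List.length_append]
      rw [h c (by simp), ih fun c hc => h c (by simp [hc])]
      ring
  induction t using PlanarTree.induction with
  | ext j m cs ih =>
    rcases m with k | k <;> simp [edgeWord, numEdges, key cs ih, Mark.ones, add_comm]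
  | int cs ih => rw [edgeWord, numEdges, key cs ih]

theorem length_edgeWordList (cs : List (PlanarTree n)) :
    (edgeWordList cs).length = numEdgesList cs := by
  simpa [edgeWord, numEdges] using length_edgeWord (.int cs)

theorem exists_of_mem_unitTermsList {cs : List (PlanarTree n)} {p : ℤ × List (PlanarTree n)}
    (hp : p ∈ unitTermsList i cs) : ∃ u c z, cs = u ++ c :: z ∧ ∃ q ∈ unitTerms i c,
      p = (- wsign tsign u * q.1, u ++ q.2 :: z) := by
  induction cs generalizing p with
  | nil => simp [unitTermsList] at hp
  | cons c cs ih =>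
    simp only [unitTermsList, List.mem_append, List.mem_map] at hp
    rcases hp with ⟨q, hq, rfl⟩ | ⟨q, hq, rfl⟩
    · exact ⟨[], c, cs, rfl, q, hq, by simp⟩
    · obtain ⟨u, c', z, rfl, r, hr, rfl⟩ := ih hq
      exact ⟨c :: u, c', z, rfl, r, hr, by simp [tsign, mul_assoc]⟩

/-- The coefficient of a term counts the edges that the new edge passes on its way from the first
place to its canonical place. -/
theorem edgeWord_of_mem_unitTerms (t : PlanarTree n) : ∀ p ∈ unitTerms i t, ∃ w₁ w₂,
    edgeWord t = w₁ ++ w₂ ∧ edgeWord p.2 = w₁ ++ (i : WithBot (Fin n)) :: w₂ ∧ p.1 = sgn w₁.length := by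
  have key : ∀ cs : List (PlanarTree n), (∀ c ∈ cs, ∀ p ∈ unitTerms i c, ∃ w₁ w₂,
      edgeWord c = w₁ ++ w₂ ∧ edgeWord p.2 = w₁ ++ (i : WithBot (Fin n)) :: w₂ ∧ p.1 = sgn w₁.length) →
      ∀ p ∈ unitTermsList i cs, ∃ w₁ w₂, edgeWordList cs = w₁ ++ w₂ ∧
        edgeWordList p.2 = w₁ ++ (i : WithBot (Fin n)) :: w₂ ∧ p.1 = sgn w₁.length := by
    intro cs h p hp
    obtain ⟨u, c, z, rfl, q, hq, rfl⟩ := exists_of_mem_unitTermsList hp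
    obtain ⟨w₁, w₂, h1, h2, h3⟩ := h c (by simp) q hq
    refine ⟨edgeWordList u ++ ⊥ :: w₁, w₂ ++ edgeWordList z, ?_, ?_, ?_⟩
    · simp [edgeWordList_append, edgeWordList, h1]
    · simp [edgeWordList_append, edgeWordList, h2]
    · rw [List.length_append, List.length_cons, length_edgeWordList, h3, wsign_tsign, sgn_add,
        sgn_add, sgn_one]
      ring
  induction t using PlanarTree.induction with
  | ext j m cs ih =>
    intro p hp
    simp only [unitTerms, List.mem_append, List.mem_map] at hp
    rcases hp with hp | ⟨q, hq, rfl⟩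
    · split at hp
      · split_ifs at hp with hj
        · subst hj
          simp only [List.mem_map] at hp
          obtain ⟨l, hl, rfl⟩ := hp
          exact ⟨[], edgeWordList cs, by simp [edgeWord], by simp [edgeWord], by simp⟩
        · simp at hp
      · simp at hp
    · obtain ⟨w₁, w₂, h1, h2, h3⟩ := key cs ih q hq
      rcases m with k | k
      · exact ⟨w₁, w₂, by simp [edgeWord, h1], by simp [edgeWord, h2], by simp [Mark.ones, h3]⟩
      · refine ⟨(j : WithBot (Fin n)) :: w₁, w₂, by simp [edgeWord, h1], by simp [edgeWord, h2], ?_⟩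
        rw [h3, Mark.ones, List.length_cons, sgn_add, mul_comm]
  | int cs ih =>
    intro p hp
    simp only [unitTerms, List.mem_map] at hp
    obtain ⟨q, hq, rfl⟩ := hp
    obtain ⟨w₁, w₂, h1, h2, h3⟩ := key cs ih q hq
    exact ⟨w₁, w₂, by rw [edgeWord, h1], by rw [edgeWord, h2], h3⟩

theorem mem_edgeWord_of_mem_insertUnits (t : PlanarTree n) : ∀ t' ∈ insertUnits A t,
    ∀ x ∈ edgeWord t', x = ⊥ ∨ ∃ a ∈ A, x = (a : WithBot (Fin n)) := by
  have key : ∀ cs : List (PlanarTree n), (∀ c ∈ cs, ∀ c' ∈ insertUnits A c,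
      ∀ x ∈ edgeWord c', x = ⊥ ∨ ∃ a ∈ A, x = (a : WithBot (Fin n))) →
      ∀ cs' ∈ insertUnitsList A cs, ∀ x ∈ edgeWordList cs',
        x = ⊥ ∨ ∃ a ∈ A, x = (a : WithBot (Fin n)) := by
    intro cs h cs' hcs'
    have h' := forall₂_of_mem_insertUnitsList hcs'
    clear hcs'
    induction h' with
    | nil => simp [edgeWordList]
    | cons hc _ ih =>
      simp only [edgeWordList, List.mem_cons, List.mem_append]
      rintro x (hx | hx | hx)
      · exact .inl hx
      · exact h _ (by simp) _ hc x hx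
      · exact ih (fun c hc => h c (by simp [hc])) x hx
  induction t using PlanarTree.induction with
  | ext j m cs ih =>
    intro t' ht x hx
    obtain ⟨cs', hcs, m', hm', rfl⟩ := mem_insertUnits_ext.1 ht
    split_ifs at hm' with hj
    · simp only [List.mem_map] at hm'
      obtain ⟨l, -, rfl⟩ := hm'
      simp only [edgeWord, List.cons_append, List.nil_append, List.mem_cons] at hx
      rcases hx with rfl | hx
      · exact .inr ⟨j, hj, rfl⟩
      · exact key cs ih cs' hcs x hx
    · rw [List.mem_singleton] at hm'
      subst hm'
      exact key cs ih cs' hcs x (by simpa [edgeWord] using hx)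
  | int cs ih =>
    intro t' ht x hx
    simp only [insertUnits, List.mem_map] at ht
    obtain ⟨cs', hcs, rfl⟩ := ht
    exact key cs ih cs' hcs x (by simpa [edgeWord] using hx)

/-- A letter above all others forms an inversion with each letter behind it and with none before it.
-/
theorem inversions_insert {x : WithBot (Fin n)} (w₁ w₂ : List (WithBot (Fin n)))
    (h : ∀ y ∈ w₁ ++ w₂, y < x) :
    inversions (w₁ ++ x :: w₂) = inversions (w₁ ++ w₂) + w₂.length := by
  induction w₁ with
  | nil =>
    rw [List.nil_append, List.nil_append, inversions, add_comm, List.countP_eq_length.2]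
    exact fun y hy => by simpa using h y (by simp [hy])
  | cons a w₁ ih =>
    rw [List.cons_append, List.cons_append, inversions, inversions,
      ih fun y hy => h y (by simp only [List.cons_append, List.mem_cons]; exact .inr hy),
      List.countP_append, List.countP_append, List.countP_cons_of_neg (by simpa using (h a (by simp)).le)]
    ring

/-- As `i` exceeds the labels in `A`, the edge from `i` to `𝟙` belongs at the very end. The new
inversions count the edges behind it, and this parity is that of all edges minus those before it. -/
theorem unitSign_of_mem_unitTerms (hi : ∀ a ∈ A, a < i) {t t' : PlanarTree n}
    (ht' : t' ∈ insertUnits A t) {p : ℤ × PlanarTree n} (hp : p ∈ unitTerms i t') :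
    unitSign p.2 = unitSign t' * (sgn (numEdges t') * p.1) := by
  obtain ⟨w₁, w₂, h1, h2, h3⟩ := edgeWord_of_mem_unitTerms t' p hp
  have h4 : ∀ y ∈ w₁ ++ w₂, y < (i : WithBot (Fin n)) := by
    intro y hy
    rcases mem_edgeWord_of_mem_insertUnits t t' ht' y (h1 ▸ hy) with rfl | ⟨a, ha, rfl⟩
    · exact WithBot.bot_lt_coe i
    · exact WithBot.coe_lt_coe.2 (hi a ha)
  have h5 := sgn_mul_self w₁.length
  rw [unitSign, unitSign, h1, h2, h3, inversions_insert w₁ w₂ h4, ← length_edgeWord, h1,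
    List.length_append, sgn_add, sgn_add]
  linear_combination (- sgn (inversions (w₁ ++ w₂)) * sgn w₂.length) * h5

end Words

-- The components of `f` as iterated insertions

section Component

variable {n : ℕ} {K : Type*} [Field K] {i : Fin n} {A S : Finset (Fin n)} {p : ℤ}
  {x : PlanarTree n →₀ K}

theorem fComponent_single (A : Finset (Fin n)) (t : PlanarTree n) :
    fComponent K A (Finsupp.single t 1) =
      lsum (insertUnits A t) fun t' => unitSign t' • Finsupp.single t' (1 : K) := by
  rw [fComponent, Finsupp.linearCombination_single, one_smul, ofTerms, lsum, List.map_map]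
  congr 2
  funext t'
  simp

theorem map_lsum {α M N : Type*} [AddCommGroup M] [Module K M] [AddCommGroup N] [Module K N]
    (φ : M →ₗ[K] N) (l : List α) (h : α → M) : φ (lsum l h) = lsum l fun a => φ (h a) := by
  induction l with
  | nil => simp
  | cons a l ih => simp [ih]

/-- The order by labels puts the edge of the largest label last, exactly where `unitMap` puts it.
For this reason all inductions over `A` add the maximum. -/
theorem fComponent_insert (hi : ∀ a ∈ A, a < i) (hx : x ∈ subcomplex K S p) :
    fComponent K (insert i A) x = unitMap i (fComponent K A x) := by
  refine eq_of_mem_supported (fComponent K (insert i A)) (unitMap i ∘ₗ fComponent K A)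
    (fun t ht => ?_) hx
  rw [LinearMap.comp_apply, fComponent_single, fComponent_single, map_lsum,
    lsum_insertUnits_insert (fun h => lt_irrefl i (hi i h)) (ht.1.2 i)]
  refine lsum_congr fun t' ht' => ?_
  rw [map_zsmul, unitMap_single, smul_smul, ← ev_zsmul, ev, lsum]
  refine congrArg List.sum (List.map_congr_left fun q hq => ?_)
  rw [unitSign_of_mem_unitTerms hi ht' hq, smul_smul]
  congr 1
  ring

theorem fComponent_empty (hx : x ∈ subcomplex K (∅ : Finset (Fin n)) p) : fComponent K ∅ x = x := by
  refine eq_of_mem_supported (fComponent K ∅) LinearMap.id (fun t ht => ?_) hx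
  have h1 : ∀ t : PlanarTree n, RootMarkedOff ∅ t → insertUnits ∅ t = [t] := by
    intro t ht
    have key : ∀ cs : List (PlanarTree n), (∀ c ∈ cs, insertUnits ∅ c = [c]) →
        insertUnitsList ∅ cs = [cs] := by
      intro cs h
      induction cs with
      | nil => rfl
      | cons c cs ih =>
        rw [insertUnitsList, h c (by simp), ih fun c hc => h c (by simp [hc])]
        rfl
    induction t using PlanarTree.induction with
    | ext j m cs ih =>
      simp only [RootMarkedOff, rootMarkedOffList_iff] at ht
      rw [insertUnits, key cs fun c hc => ih c hc (ht.2 c hc), ht.1 (Finset.notMem_empty j)]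
      simp
    | int cs ih =>
      simp only [RootMarkedOff, rootMarkedOffList_iff] at ht
      rw [insertUnits, key cs fun c hc => ih c hc (ht c hc)]
      rfl
  have h2 : ∀ w : List (WithBot (Fin n)), (∀ y ∈ w, y = ⊥) → inversions w = 0 := by
    intro w hw
    induction w with
    | nil => rfl
    | cons a w ih =>
      rw [inversions, ih fun y hy => hw y (by simp [hy]), hw a (by simp)]
      simp
  have h3 : unitSign t = 1 := by
    rw [unitSign, h2, sgn_zero]
    intro y hy
    have := mem_edgeWord_of_mem_insertUnits (A := ∅) t t (by rw [h1 t ht.2.1]; simp) y hy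
    simpa using this
  rw [fComponent_single, h1 t ht.2.1]
  simp [h3]

theorem fComponent_mem (A : Finset (Fin n)) : ∀ {p : ℤ} {x : PlanarTree n →₀ K},
    x ∈ subcomplex K ∅ p → fComponent K A x ∈ subcomplex K A (p - A.card) := by
  induction A using Finset.induction_on_max with
  | empty =>
    intro p x hx
    rw [fComponent_empty hx]
    simpa using hx
  | insert i A hi ih =>
    intro p x hx
    rw [fComponent_insert hi hx, Finset.card_insert_of_notMem fun h => lt_irrefl i (hi i h)]
    have := unitMap_mem (ih hx) i
    rwa [Nat.cast_add, Nat.cast_one, ← sub_sub]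

theorem fComponent_dTree (A : Finset (Fin n)) : ∀ {p : ℤ} {x : PlanarTree n →₀ K},
    x ∈ subcomplex K ∅ p → fComponent K A (dTree K n x) = dTree K n (fComponent K A x) := by
  induction A using Finset.induction_on_max with
  | empty =>
    intro p x hx
    rw [fComponent_empty hx, fComponent_empty (dTree_mem hx)]
  | insert i A hi ih =>
    intro p x hx
    rw [fComponent_insert hi hx, fComponent_insert hi (dTree_mem hx), ih hx,
      unitMap_dTree (fComponent_mem A hx) fun h => lt_irrefl i (hi i h)]

/-- The cone of the map `f`, restricted to the tensor factors with labels in `S`, is acyclic. -/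
theorem exists_of_sum_fComponent_eq (S : Finset (Fin n)) : ∀ {p : ℤ}
    {x : Finset (Fin n) → PlanarTree n →₀ K} {y : PlanarTree n →₀ K},
    (∀ A, x A ∈ subcomplex K ∅ (p + 1 + A.card)) → y ∈ subcomplex K S p →
    ∑ A ∈ S.powerset, fComponent K A (x A) = dTree K n y →
    ∃ v : Finset (Fin n) → PlanarTree n →₀ K, (∀ A, v A ∈ subcomplex K ∅ (p + A.card)) ∧
      (∀ A ∈ S.powerset, x A = dTree K n (v A)) ∧ ∃ z ∈ subcomplex K S (p - 1),
        y = ∑ A ∈ S.powerset, fComponent K A (v A) + dTree K n z := by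
  induction S using Finset.induction_on_max with
  | empty =>
    intro p x y hx hy h
    refine ⟨fun A => if A = ∅ then y else 0, fun A => ?_, ?_, 0, Submodule.zero_mem _, ?_⟩
    · dsimp only
      split_ifs with hA
      · subst hA
        simpa using hy
      · exact Submodule.zero_mem _
    · have h1 := hx ∅
      rw [Finset.powerset_empty, Finset.sum_singleton, fComponent_empty h1] at h
      simpa using h
    · simp [fComponent_empty hy]
  | insert i S hi ih =>
    intro p x y hx hy h
    have hiS : i ∉ S := fun h => lt_irrefl i (hi i h)
    have hlt : ∀ A ∈ S.powerset, ∀ a ∈ A, a < i := fun A hA a ha =>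
      hi a (Finset.mem_powerset.1 hA ha)
    have hmem : ∀ A ∈ S.powerset, i ∉ A := fun A hA h => lt_irrefl i (hlt A hA i h)
    -- The subsets of `insert i S` are sorted by whether they contain `i`; those that do contribute
    -- through `unitMap i`.
    have hsum : ∀ v : Finset (Fin n) → PlanarTree n →₀ K, ∀ q : ℤ,
        (∀ A, v A ∈ subcomplex K ∅ (q + A.card)) →
        ∑ A ∈ (insert i S).powerset, fComponent K A (v A) =
          ∑ A ∈ S.powerset, fComponent K A (v A) +
            unitMap i (∑ A ∈ S.powerset, fComponent K A (v (insert i A))) := by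
      intro v q hv
      rw [Finset.sum_powerset_insert hiS, map_sum]
      congr 1
      exact Finset.sum_congr rfl fun A hA => fComponent_insert (hlt A hA) (hv _)
    have hsmem : ∀ v : Finset (Fin n) → PlanarTree n →₀ K, ∀ q : ℤ,
        (∀ A ∈ S.powerset, v A ∈ subcomplex K ∅ (q + A.card)) →
        ∑ A ∈ S.powerset, fComponent K A (v A) ∈ subcomplex K S q := by
      intro v q hv
      refine Submodule.sum_mem _ fun A hA => ?_
      have := fComponent_mem A (hv A hA)
      rw [add_sub_cancel_right] at this
      exact subcomplex_mono (Finset.mem_powerset.1 hA) q this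
    have hcard : ∀ A : Finset (Fin n), i ∉ A → ∀ q : ℤ, q + (insert i A).card = q + 1 + A.card := by
      intro A hA q
      rw [Finset.card_insert_of_notMem hA]
      push_cast
      ring
    rw [hsum x (p + 1) hx] at h
    obtain ⟨w, hw, w', hw', z, hz, h1, h2, h3⟩ := exists_of_add_unitMap_eq hiS
      (hsmem x (p + 1) fun A _ => hx A)
      (hsmem (fun A => x (insert i A)) (p + 1 + 1) fun A hA =>
        hcard A (hmem A hA) (p + 1) ▸ hx (insert i A)) hy h
    obtain ⟨v, hv, h4, z₁, hz₁, h5⟩ := ih hx hw h1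
    obtain ⟨v', hv', h6, z₂, hz₂, h7⟩ := ih (p := p + 1)
      -- The degree of `x (insert i A)` is the required one only for `i ∉ A`, whereas the induction
      -- hypothesis constrains all sets; the other entries are not summed and are set to `0`.
      (x := fun A => if i ∈ A then 0 else x (insert i A)) (fun A => by
        split_ifs with hA
        · exact Submodule.zero_mem _
        · exact hcard A hA (p + 1) ▸ hx (insert i A)) hw' (by
        rw [← h2]
        exact Finset.sum_congr rfl fun A hA => by rw [if_neg (hmem A hA)])
    have hz₂' : unitMap i z₂ ∈ subcomplex K (insert i S) (p - 1) := by
      have := unitMap_mem hz₂ i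
      rwa [add_sub_cancel_right] at this
    -- The two families are merged: `v` serves the sets without `i`, and `v'` those with `i`.
    have hvv : ∀ A, (if i ∈ A then v' (A.erase i) else v A) ∈ subcomplex K ∅ (p + A.card) := by
      intro A
      split_ifs with hA
      · have h8 := hv' (A.erase i)
        rwa [← hcard _ (Finset.notMem_erase i A), Finset.insert_erase hA] at h8
      · exact hv A
    refine ⟨fun A => if i ∈ A then v' (A.erase i) else v A, hvv, ?_, z₁ + unitMap i z₂ + z,
      Submodule.add_mem _ (Submodule.add_mem _
        (subcomplex_mono (Finset.subset_insert i S) _ hz₁) hz₂') hz, ?_⟩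
    · intro A hA
      dsimp only
      split_ifs with hiA
      · have h8 : A.erase i ∈ S.powerset :=
          Finset.mem_powerset.2 (Finset.subset_insert_iff.1 (Finset.mem_powerset.1 hA))
        have h9 := h6 _ h8
        rwa [if_neg (Finset.notMem_erase i A), Finset.insert_erase hiA] at h9
      · refine h4 A (Finset.mem_powerset.2 ?_)
        rw [← Finset.erase_eq_of_notMem hiA]
        exact Finset.subset_insert_iff.1 (Finset.mem_powerset.1 hA)
    · have h8 : ∑ A ∈ S.powerset, fComponent K A (if i ∈ A then v' (A.erase i) else v A) =
          ∑ A ∈ S.powerset, fComponent K A (v A) :=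
        Finset.sum_congr rfl fun A hA => by rw [if_neg (hmem A hA)]
      have h9 : ∑ A ∈ S.powerset, fComponent K A (if i ∈ insert i A then v' ((insert i A).erase i)
          else v (insert i A)) = ∑ A ∈ S.powerset, fComponent K A (v' A) :=
        Finset.sum_congr rfl fun A hA => by
          rw [if_pos (Finset.mem_insert_self i A), Finset.erase_insert (hmem A hA)]
      rw [hsum _ p hvv, h8, h9, h3]
      nth_rewrite 1 [h5]
      rw [h7, map_add, unitMap_dTree hz₂ hiS, map_add, map_add]
      abel

end Component

/-! ### Quasi-isomorphisms of internally graded complexes -/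

section QuasiIso

universe u

variable {K : Type u} [Field K] {M N : Type u} [AddCommGroup M] [Module K M] [AddCommGroup N]
  [Module K N] {gr : ℤ → Submodule K M} {d : M →ₗ[K] M} {gr' : ℤ → Submodule K N}
  {d' : N →ₗ[K] N} {f : M →ₗ[K] N}

theorem cochainComplex_d (h : IsDifferential gr d) (p : ℤ) :
    (cochainComplex gr d h).d p (p + 1) = ModuleCat.ofHom (d.restrict (h.degree_one p)) := by
  simp only [cochainComplex, CochainComplex.of_d]

/-- The two conditions are injectivity and surjectivity on cohomology in terms of elements. They are
turned into the criteria for monomorphisms and epimorphisms up to refinement. -/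
theorem quasiIso_cochainMap (h : IsDifferential gr d) (h' : IsDifferential gr' d')
    (hf : IsCochainMap gr d gr' d' f)
    (inj : ∀ p, ∀ x ∈ gr (p + 1), d x = 0 → ∀ y ∈ gr' p, f x = d' y → ∃ w ∈ gr p, x = d w)
    (surj : ∀ p, ∀ y ∈ gr' (p + 1), d' y = 0 →
      ∃ x ∈ gr (p + 1), d x = 0 ∧ ∃ z ∈ gr' p, y = f x + d' z) :
    QuasiIso (cochainMap h h' hf) := by
  rw [quasiIso_iff]
  intro j
  obtain ⟨p, rfl⟩ : ∃ p, j = p + 1 := ⟨j - 1, by ring⟩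
  have hprev : (ComplexShape.up ℤ).prev (p + 1) = p := by simp
  have hnext : (ComplexShape.up ℤ).next (p + 1) = p + 1 + 1 := by simp
  rw [quasiIsoAt_iff_isIso_homologyMap]
  have hmono : Mono (HomologicalComplex.homologyMap (cochainMap h h' hf) (p + 1)) := by
    rw [HomologicalComplex.mono_homologyMap_iff_up_to_refinements _ p (p + 1) (p + 1 + 1) hprev hnext]
    intro A x₂ hx₂ y₁ hy₁
    rw [cochainComplex_d] at hx₂ hy₁
    -- The witnesses need not depend linearly on `a`. The refinement is the module of all pairs of
    -- an element with a witness, and existence makes its projection to `A` surjective.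
    let P : Submodule K (A × gr p) :=
      LinearMap.eqLocus ((gr (p + 1)).subtype ∘ₗ x₂.hom ∘ₗ LinearMap.fst K A (gr p))
        (d ∘ₗ (gr p).subtype ∘ₗ LinearMap.snd K A (gr p))
    refine ⟨ModuleCat.of K P, ModuleCat.ofHom (LinearMap.fst K A (gr p) ∘ₗ P.subtype), ?_,
      ModuleCat.ofHom (LinearMap.snd K A (gr p) ∘ₗ P.subtype), ?_⟩
    · rw [ModuleCat.epi_iff_surjective]
      intro a
      have h1 : d (x₂.hom a).1 = 0 := congrArg Subtype.val (ConcreteCategory.congr_hom hx₂ a)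
      have h2 : f (x₂.hom a).1 = d' (y₁.hom a).1 :=
        congrArg Subtype.val (ConcreteCategory.congr_hom hy₁ a)
      obtain ⟨w, hw, h3⟩ := inj p _ (x₂.hom a).2 h1 _ (y₁.hom a).2 h2
      exact ⟨⟨(a, ⟨w, hw⟩), h3⟩, rfl⟩
    · rw [cochainComplex_d]
      ext x
      exact Subtype.ext x.2
  have hepi : Epi (HomologicalComplex.homologyMap (cochainMap h h' hf) (p + 1)) := by
    rw [HomologicalComplex.epi_homologyMap_iff_up_to_refinements _ p (p + 1) (p + 1 + 1) hprev hnext]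
    intro A y₂ hy₂
    rw [cochainComplex_d] at hy₂
    -- The triples of an element, a cocycle mapping to it up to a boundary, and an element with this
    -- boundary.
    let P : Submodule K (A × gr (p + 1) × gr' p) :=
      LinearMap.eqLocus ((gr' (p + 1)).subtype ∘ₗ y₂.hom ∘ₗ LinearMap.fst K A (gr (p + 1) × gr' p))
        (f ∘ₗ (gr (p + 1)).subtype ∘ₗ LinearMap.fst K _ _ ∘ₗ LinearMap.snd K _ _ +
          d' ∘ₗ (gr' p).subtype ∘ₗ LinearMap.snd K _ _ ∘ₗ LinearMap.snd K _ _) ⊓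
      LinearMap.ker (d ∘ₗ (gr (p + 1)).subtype ∘ₗ LinearMap.fst K _ _ ∘ₗ
        LinearMap.snd K A (gr (p + 1) × gr' p))
    refine ⟨ModuleCat.of K P, ModuleCat.ofHom (LinearMap.fst K _ _ ∘ₗ P.subtype), ?_,
      ModuleCat.ofHom (LinearMap.fst K _ _ ∘ₗ LinearMap.snd K _ _ ∘ₗ P.subtype), ?_,
      ModuleCat.ofHom (LinearMap.snd K _ _ ∘ₗ LinearMap.snd K _ _ ∘ₗ P.subtype), ?_⟩
    · rw [ModuleCat.epi_iff_surjective]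
      intro a
      have h1 : d' (y₂.hom a).1 = 0 := congrArg Subtype.val (ConcreteCategory.congr_hom hy₂ a)
      obtain ⟨x, hx, h2, z, hz, h3⟩ := surj p _ (y₂.hom a).2 h1
      exact ⟨⟨(a, ⟨x, hx⟩, ⟨z, hz⟩), h3, h2⟩, rfl⟩
    · rw [cochainComplex_d]
      ext x
      exact Subtype.ext x.2.2
    · rw [cochainComplex_d]
      ext x
      exact Subtype.ext x.2.1
  exact isIso_of_mono_of_epi _

end QuasiIso

/-! ### The tensor product with the circles -/

section Circles

variable {n : ℕ} {K : Type*} [Field K]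

theorem rootMarked_iff_admissible {t : PlanarTree n} {p : ℤ} :
    (IsBracesTree t ∧ degree t = p) ↔ Admissible ∅ p t := by
  rw [IsBracesTree, Admissible, rootMarkedOff_empty, and_assoc]

theorem Br_eq_subcomplex (p : ℤ) : Br K n p = subcomplex K ∅ p := by
  simp only [Br, subcomplex, rootMarked_iff_admissible]

theorem CBr_eq_subcomplex (p : ℤ) : CBr K n p = subcomplex K Finset.univ p := by
  simp only [CBr, subcomplex, Admissible, rootMarkedOff_univ, true_and]

theorem circleCoord_circleTensor (A B : Finset (Fin n)) :
    circleCoord K A (circleTensor K B) = if A = B then 1 else 0 := by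
  rw [circleCoord, circleTensor, PiTensorProduct.lift.tprod,
    MultilinearMap.compLinearMap_apply, MultilinearMap.mkPiAlgebra_apply]
  split_ifs with h
  · subst h
    refine Finset.prod_eq_one fun i _ => ?_
    split_ifs <;> rfl
  · obtain ⟨i, hi⟩ : ∃ i, ¬ (i ∈ A ↔ i ∈ B) := by
      by_contra! h'
      exact h (Finset.ext h')
    refine Finset.prod_eq_zero (Finset.mem_univ i) ?_
    by_cases hA : i ∈ A <;> by_cases hB : i ∈ B <;> simp_all

/-- The sum of the tensor products with the standard basis of `(K ⊕ K[1])^{⊗ n}`. -/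
noncomputable def assemble (K : Type*) [Field K] (n : ℕ) : (Finset (Fin n) → PlanarTree n →₀ K) →ₗ[K]
    (PlanarTree n →₀ K) ⊗[K] Circles K n :=
  ∑ A, (TensorProduct.mk K (PlanarTree n →₀ K) (Circles K n)).flip (circleTensor K A) ∘ₗ
    LinearMap.proj A

theorem assemble_apply (x : Finset (Fin n) → PlanarTree n →₀ K) :
    assemble K n x = ∑ A, x A ⊗ₜ[K] circleTensor K A := by
  simp [assemble]

theorem assemble_mem {p : ℤ} {x : Finset (Fin n) → PlanarTree n →₀ K}
    (hx : ∀ A, x A ∈ subcomplex K ∅ (p + A.card)) : assemble K n x ∈ BrCircles K n p := by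
  rw [assemble_apply]
  refine Submodule.sum_mem _ fun A _ => ?_
  refine Submodule.mem_iSup_of_mem (p + A.card) (Submodule.mem_iSup_of_mem (-(A.card : ℤ))
    (Submodule.mem_iSup_of_mem (by ring) ?_))
  exact Submodule.apply_mem_map₂ _ (by rw [Br_eq_subcomplex]; exact hx A)
    (Submodule.subset_span ⟨A, rfl, rfl⟩)

/-- Every element is a sum over the basis tensors of the circles. The degree of the coefficient at
`A` is raised by the cardinality of `A`, as each factor from `K[1]` has degree `-1`. -/
theorem exists_assemble_eq {p : ℤ} {ξ : (PlanarTree n →₀ K) ⊗[K] Circles K n}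
    (hξ : ξ ∈ BrCircles K n p) : ∃ x : Finset (Fin n) → PlanarTree n →₀ K,
      (∀ A, x A ∈ subcomplex K ∅ (p + A.card)) ∧ ξ = assemble K n x := by
  have key : BrCircles K n p ≤ (Submodule.pi Set.univ fun A : Finset (Fin n) =>
      subcomplex K ∅ (p + A.card)).map (assemble K n) := by
    refine iSup_le fun q => iSup_le fun r => iSup_le fun hqr => ?_
    rw [circleGrading, Submodule.map₂_le]
    intro x hx c hc
    rw [Br_eq_subcomplex] at hx
    induction hc using Submodule.span_induction with
    | mem c hc =>
      obtain ⟨A, hA, rfl⟩ := hc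
      refine ⟨Pi.single A x, fun B _ => ?_, ?_⟩
      · by_cases hB : B = A
        · subst hB
          rw [Pi.single_eq_same]
          have h1 : p + B.card = q := by rw [← hqr, ← hA, neg_add_cancel_right]
          change x ∈ subcomplex K ∅ (p + B.card)
          rwa [h1]
        · rw [Pi.single_eq_of_ne hB]
          exact Submodule.zero_mem _
      · rw [assemble_apply, Finset.sum_eq_single A, Pi.single_eq_same]
        · rfl
        · intro B _ hB
          rw [Pi.single_eq_of_ne hB, TensorProduct.zero_tmul]
        · simp
    | zero => rw [map_zero]; exact Submodule.zero_mem _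
    | add c c' _ _ h h' => rw [map_add]; exact Submodule.add_mem _ h h'
    | smul a c _ h => rw [map_smul]; exact Submodule.smul_mem _ a h
  obtain ⟨x, hx, rfl⟩ := key hξ
  exact ⟨x, fun A => hx A trivial, rfl⟩

theorem dBrCircles_assemble (x : Finset (Fin n) → PlanarTree n →₀ K) :
    dBrCircles K n (assemble K n x) = assemble K n fun A => dTree K n (x A) := by
  simp [assemble_apply, dBrCircles]

theorem f_assemble (x : Finset (Fin n) → PlanarTree n →₀ K) :
    f K n (assemble K n x) = ∑ A, fComponent K A (x A) := by
  rw [assemble_apply, map_sum]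
  refine Finset.sum_congr rfl fun A _ => ?_
  rw [f, LinearMap.sum_apply, Finset.sum_eq_single A]
  · simp [circleCoord_circleTensor]
  · intro B _ hB
    simp [circleCoord_circleTensor, hB]
  · simp

theorem isDifferential_CBr : IsDifferential (CBr K n) (dTree K n) where
  degree_one p x hx := by
    rw [CBr_eq_subcomplex] at hx ⊢
    exact dTree_mem hx
  square_zero p x hx := by
    rw [CBr_eq_subcomplex] at hx
    exact dTree_dTree hx

theorem isDifferential_BrCircles :
    IsDifferential (M := (PlanarTree n →₀ K) ⊗[K] Circles K n) (BrCircles K n) (dBrCircles K n) where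
  degree_one p ξ hξ := by
    obtain ⟨x, hx, rfl⟩ := exists_assemble_eq hξ
    rw [dBrCircles_assemble]
    refine assemble_mem fun A => ?_
    rw [add_right_comm]
    exact dTree_mem (hx A)
  square_zero p ξ hξ := by
    obtain ⟨x, hx, rfl⟩ := exists_assemble_eq hξ
    rw [dBrCircles_assemble, dBrCircles_assemble]
    simp only [dTree_dTree (hx _)]
    exact map_zero (assemble K n)

theorem isCochainMap_f :
    IsCochainMap (M := (PlanarTree n →₀ K) ⊗[K] Circles K n)
      (BrCircles K n) (dBrCircles K n) (CBr K n) (dTree K n) (f K n) where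
  degree_zero p ξ hξ := by
    obtain ⟨x, hx, rfl⟩ := exists_assemble_eq hξ
    rw [f_assemble, CBr_eq_subcomplex]
    refine Submodule.sum_mem _ fun A _ => ?_
    have := fComponent_mem A (hx A)
    rw [add_sub_cancel_right] at this
    exact subcomplex_mono (Finset.subset_univ A) p this
  comm p ξ hξ := by
    obtain ⟨x, hx, rfl⟩ := exists_assemble_eq hξ
    rw [dBrCircles_assemble, f_assemble, f_assemble, map_sum]
    exact Finset.sum_congr rfl fun A _ => fComponent_dTree A (hx A)

/-- Both halves are the acyclicity of the cone with `S = univ`: injectivity from an equation `f ξ =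
d y`, surjectivity from the case `ξ = 0`. -/
theorem quasiIso_f : QuasiIso (cochainMap (M := (PlanarTree n →₀ K) ⊗[K] Circles K n)
    (isDifferential_BrCircles (K := K) (n := n)) isDifferential_CBr isCochainMap_f) := by
  refine quasiIso_cochainMap _ _ _ ?_ ?_
  · intro p ξ hξ _ y hy h
    obtain ⟨x, hx, rfl⟩ := exists_assemble_eq hξ
    rw [CBr_eq_subcomplex] at hy
    rw [f_assemble, ← Finset.powerset_univ] at h
    obtain ⟨v, hv, h1, -⟩ := exists_of_sum_fComponent_eq Finset.univ hx hy h
    refine ⟨assemble K n v, assemble_mem hv, ?_⟩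
    rw [dBrCircles_assemble]
    congr 1
    funext A
    exact h1 A (by simp)
  · intro p y hy hdy
    rw [CBr_eq_subcomplex] at hy
    -- With the zero family, the equation of the lemma says that `y` is a cocycle, and the resulting
    -- `v` are cocycles whose images represent its class.
    obtain ⟨v, hv, h1, z, hz, h2⟩ := exists_of_sum_fComponent_eq Finset.univ (x := fun _ => 0)
      (fun A => Submodule.zero_mem _) hy (by simp [hdy])
    refine ⟨assemble K n v, assemble_mem hv, ?_, z, ?_, ?_⟩
    · rw [dBrCircles_assemble, ← map_zero (assemble K n)]
      congr 1
      funext A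
      exact (h1 A (by simp)).symm
    · rw [CBr_eq_subcomplex]
      simpa using hz
    · rw [f_assemble, h2, Finset.powerset_univ]

end Circles

end CyclicBraces

open CyclicBraces TensorProduct in
theorem mainTheorem4 {K : Type*} [Field K] [CharZero K] (n : ℕ) :
    ∃ (hBr : IsDifferential (BrCircles K n) (dBrCircles K n))
      (hCBr : IsDifferential (CBr K n) (dTree K n))
      (hf : IsCochainMap (M := (PlanarTree n →₀ K) ⊗[K] Circles K n)
        (BrCircles K n) (dBrCircles K n) (CBr K n) (dTree K n) (f K n)),
      QuasiIso (cochainMap (M := (PlanarTree n →₀ K) ⊗[K] Circles K n) hBr hCBr hf) :=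
  ⟨isDifferential_BrCircles, isDifferential_CBr, isCochainMap_f, quasiIso_f⟩
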